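/- Let $m>0$ (the mass of one particle interacting with $N$ spinless fermions of mass $1$). Let $\hat f(q)=(2\pi)^{-3k/2}\int_{\mathbb{R}^{3k}} e^{-iq\cdot x}f(x)\,dx$ denote the unitary Fourier transform on $L^2(\mathbb{R}^{3k})$, and let the subscript "as" denote functions of $k$ variables in $\mathbb{R}^3$ that are antisymmetric under permutations of these variables. For $\mu>0$, $N\ge 2$ and $q_i\in\mathbb{R}^3$ put $$G(q_1,\dots,q_N)=\Big(\sum_{i=1}^N q_i^2+\tfrac{2}{m+1}\sum_{1\le i<j\le N}q_i\cdot q_j+\mu\Big)^{-1},$$ $$L(q_1,\dots,q_{N-1})=2\pi^2\Big(\tfrac{m(m+2)}{(m+1)^2}\sum_{i=1}^{N-1}q_i^2+\tfrac{2m}{(m+1)^2}\sum_{1\le i<j\le N-1}q_i\cdot q_j+\mu\Big)^{1/2},$$ and, for $\xi\in H^{1/2}_{\rm as}(\mathbb{R}^{3(N-1)})$, with $\vec q=(q_1,\dots,q_{N-2})$, $$T_{\rm diag}(\xi)=\int_{\mathbb{R}^{3(N-1)}}|\hat\xi(s,\vec q)|^2L(s,\vec q)\,ds\,d\vec q,\qquad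 T_{\rm off}(\xi)=(N-1)\int_{\mathbb{R}^{3N}}\overline{\hat\xi(s,\vec q)}\,\hat\xi(t,\vec q)\,G(s,t,\vec q)\,ds\,dt\,d\vec q .$$ Let $G\xi$ be the function with Fourier transform $\widehat{G\xi}(q_1,\dots,q_N)=G(q_1,\dots,q_N)\sum_{i=1}^N(-1)^{i+1}\hat\xi(q_1,\dots,q_{i-1},q_{i+1},\dots,q_N)$. For $\alpha\in\mathbb{R}$ the quadratic form $F_\alpha$ has the domain $$D(F_\alpha)=\{u\in L^2_{\rm as}(\mathbb{R}^{3N}) : u=w+G\xi,\ w\in H^1_{\rm as}(\mathbb{R}^{3N}),\ \xi\in H^{1/2}_{\rm as}(\mathbb{R}^{3(N-1)})\}$$ and, for $u=w+G\xi\in D(F_\alpha)$ (this decomposition is unique), the value $$F_\alpha(u)=\int_{\mathbb{R}^{3N}}\frac{|\hat w(q)|^2}{G(q)}\,dq-\mu\|u\|^2+N\big(\alpha\|\xi\|^2+T_{\rm diag}(\xi)+T_{\rm off}(\xi)\big),$$ where $\|\cdot\|$ is the $L^2$ norm. (Neither $D(F_\alpha)$ nor $F_\alpha(u)$ depends on $\mu>0$.)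 Finally, with $A=(2+m)^{-1}$ and $\ell_m(s,K,Q)=\big(\tfrac{m}{(m+1)^2}(s+K)^2+\tfrac{m}{m+1}(s^2+Q^2)\big)^{1/2}$, let $$\Lambda(m)=\sup_{s,K\in\mathbb{R}^3,\,Q>0}\frac{s^2+Q^2}{\pi^2(1+m)}\,\ell_m(s,K,Q)^{-1/2}\int_{\mathbb{R}^3}\frac{\ell_m(t,K,Q)^{-1/2}}{t^2}\,\frac{|(s+AK)\cdot(t+AK)|}{\big[(s+AK)^2+(t+AK)^2+\frac{m}{1+m}(Q^2+AK^2)\big]^2-\big[\frac{2}{1+m}(s+AK)\cdot(t+AK)\big]^2}\,dt .$$ Then $\Lambda(m)<\infty$, and for all $N\ge2$, $\mu>0$ and $\xi\in H^{1/2}_{\rm as}(\mathbb{R}^{3(N-1)})$ the integrals defining $T_{\rm diag}(\xi)$ and $T_{\rm off}(\xi)$ converge absolutely and $$T_{\rm off}(\xi)\ge-\Lambda(m)\,T_{\rm diag}(\xi).$$ If $\Lambda(m)<1$, then for all $N\ge 2$ and $\alpha\in\mathbb{R}$ the form $F_\alpha$ is closed, that is, whenever $u_n\in D(F_\alpha)$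 is a Cauchy sequence in $L^2$ with $F_\alpha(u_n-u_k)\to0$ as $n,k\to\infty$, there is $u\in D(F_\alpha)$ with $\|u_n-u\|\to0$ and $F_\alpha(u_n-u)\to0$. Moreover, for all $u\in D(F_\alpha)$, $$F_\alpha(u)\ge 0\ \text{ if }\alpha\ge0,\qquad F_\alpha(u)\ge-\Big(\frac{\alpha}{2\pi^2(1-\Lambda(m))}\Big)^2\|u\|^2\ \text{ if }\alpha<0 .$$ -/

import Mathlib

open MeasureTheory Filter Topology
open scoped ENNReal FourierTransform SchwartzMap

noncomputable section

namespace PointInteraction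

/-- Euclidean `ℝ³`. -/
abbrev R3 : Type := EuclideanSpace ℝ (Fin 3)

/-- Position space `ℝ^{3k}` of `k` particles, with its Euclidean norm and Lebesgue measure. -/
abbrev Conf (k : ℕ) : Type := PiLp 2 (fun _ : Fin k => R3)

/-- The complex Hilbert space `L²(ℝ^{3k})`. -/
abbrev L2 (k : ℕ) : Type := Lp ℂ 2 (volume : Measure (Conf k))

/-- Antisymmetry under permutations of the `k` particles. -/
def IsAntisymm {k : ℕ} (f : L2 k) : Prop :=
  ∀ σ : Equiv.Perm (Fin k), ∀ᵐ x : Conf k,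
    f (WithLp.toLp 2 fun i => x (σ i)) = ((Equiv.Perm.sign σ : ℤ) : ℂ) * f x

/-- `H^r_as(ℝ^{3k})`, as a subset of `L²(ℝ^{3k})`. -/
def sobolevAs (r : ℝ) (k : ℕ) : Set (L2 k) :=
  {f | IsAntisymm f ∧ TemperedDistribution.MemSobolev r 2 (f : 𝓢'(Conf k, ℂ))}

/-- The unitary Fourier transform `(2π)^{-3k/2} ∫ e^{-i q·x} f(x) dx`, as a function of the `k`
momenta. Mathlib's `𝓕` uses the character `e^{-2πi p·x}`, hence the rescaling `q = 2π p`. -/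
def hat {k : ℕ} (f : L2 k) (q : Fin k → R3) : ℂ :=
  (((2 * Real.pi) ^ (-(3 * (k : ℝ) / 2)) : ℝ) : ℂ) *
    (𝓕 f : L2 k) ((2 * Real.pi)⁻¹ • (WithLp.toLp 2 q : Conf k))

/-- `∑ qᵢ² + 2/(m+1) ∑_{i<j} qᵢ·qⱼ + μ`, the Fourier symbol of the shifted kinetic energy. -/
def symbol (m μ : ℝ) {k : ℕ} (q : Fin k → R3) : ℝ :=
  ∑ i, ‖q i‖ ^ 2 + 2 / (m + 1) * ∑ i, ∑ j ∈ Finset.Ioi i, inner ℝ (q i) (q j) + μ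

/-- The function `G`. -/
def G (m μ : ℝ) {k : ℕ} (q : Fin k → R3) : ℝ := (symbol m μ q)⁻¹

/-- The function `L`. -/
def L (m μ : ℝ) {k : ℕ} (q : Fin k → R3) : ℝ :=
  2 * Real.pi ^ 2 * Real.sqrt (m * (m + 2) / (m + 1) ^ 2 * ∑ i, ‖q i‖ ^ 2
    + 2 * m / (m + 1) ^ 2 * ∑ i, ∑ j ∈ Finset.Ioi i, inner ℝ (q i) (q j) + μ)

/-- The Fourier transform of `Gξ`; the index `j` starts at `0`, which gives the sign `(-1)^j`. -/
def potentialHat (m μ : ℝ) {k : ℕ} (ξ : L2 k) (q : Fin (k + 1) → R3) : ℂ :=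
  (G m μ q : ℂ) * ∑ j : Fin (k + 1), (-1) ^ (j : ℕ) * hat ξ (j.removeNth q)

def diagIntegrand (m μ : ℝ) {k : ℕ} (ξ : L2 k) (q : Fin k → R3) : ℝ :=
  ‖hat ξ q‖ ^ 2 * L m μ q

/-- `T_diag(ξ)`. -/
def Tdiag (m μ : ℝ) {k : ℕ} (ξ : L2 k) : ℝ := ∫ q, diagIntegrand m μ ξ q

/-- The integrand of `T_off`, as a function of `((s, t), q)`. -/
def offIntegrand (m μ : ℝ) {n : ℕ} (ξ : L2 (n + 1)) (p : (R3 × R3) × (Fin n → R3)) : ℂ :=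
  star (hat ξ (Fin.cons p.1.1 p.2)) * hat ξ (Fin.cons p.1.2 p.2) *
    (G m μ (Fin.cons p.1.1 (Fin.cons p.1.2 p.2 : Fin (n + 1) → R3) : Fin (n + 2) → R3) : ℂ)

/-- `T_off(ξ)` for `N = n + 2`, so that `N - 1 = n + 1`. The integral is real because its
integrand is Hermitian in `(s, t)`, see `integral_offIntegrand_im`. -/
def Toff (m μ : ℝ) {n : ℕ} (ξ : L2 (n + 1)) : ℝ :=
  ((n : ℝ) + 1) * (∫ p, offIntegrand m μ ξ p).re

/-- `u = w + Gξ` with `w ∈ H¹_as(ℝ^{3(n+2)})` and `ξ ∈ H^{1/2}_as(ℝ^{3(n+1)})`. -/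
def IsDecomp (m μ : ℝ) {n : ℕ} (u w : L2 (n + 2)) (ξ : L2 (n + 1)) : Prop :=
  w ∈ sobolevAs 1 (n + 2) ∧ ξ ∈ sobolevAs (1 / 2) (n + 1) ∧
    hat (u - w) =ᵐ[volume] potentialHat m μ ξ

/-- The form domain `D(F_α)` for `N = n + 2`. -/
def formDomain (m μ : ℝ) (n : ℕ) : Set (L2 (n + 2)) :=
  {u | IsAntisymm u ∧ ∃ w ξ, IsDecomp m μ u w ξ}

/-- The expression for `F_α(u)` in terms of `u = w + Gξ`, for `N = n + 2`. -/
def formValue (m μ α : ℝ) {n : ℕ} (u w : L2 (n + 2)) (ξ : L2 (n + 1)) : ℝ :=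
  (∫ q, ‖hat w q‖ ^ 2 * symbol m μ q) - μ * ‖u‖ ^ 2
    + ((n : ℝ) + 2) * (α * ‖ξ‖ ^ 2 + Tdiag m μ ξ + Toff m μ ξ)

open Classical in
/-- The quadratic form `F_α` on its domain. The decomposition `u = w + Gξ` is unique for `m, μ > 0`,
so the choice of `(w, ξ)` is immaterial. Outside the domain the value is irrelevant. -/
def form (m μ α : ℝ) {n : ℕ} (u : L2 (n + 2)) : ℝ :=
  if h : ∃ p : L2 (n + 2) × L2 (n + 1), IsDecomp m μ u p.1 p.2 then
    formValue m μ α u h.choose.1 h.choose.2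
  else 0

/-- Closedness of a quadratic form `F` with domain `D`. -/
def IsClosedForm {H : Type*} [NormedAddCommGroup H] (D : Set H) (F : H → ℝ) : Prop :=
  ∀ u : ℕ → H, (∀ i, u i ∈ D) → CauchySeq u →
    Tendsto (fun p : ℕ × ℕ => F (u p.1 - u p.2)) atTop (𝓝 0) →
    ∃ v ∈ D, Tendsto u atTop (𝓝 v) ∧ Tendsto (fun i => F (u i - v)) atTop (𝓝 0)

/-- The function `ℓ_m(s, K, Q)`. -/
def ell (m : ℝ) (s K : R3) (Q : ℝ) : ℝ :=
  Real.sqrt (m / (m + 1) ^ 2 * ‖s + K‖ ^ 2 + m / (m + 1) * (‖s‖ ^ 2 + Q ^ 2))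

/-- The integrand (in `t`) in the definition of `Λ(m)`, where `A = 1/(2+m)`. It is non-negative
for `m, Q > 0`. -/
def lambdaIntegrand (m : ℝ) (s K : R3) (Q : ℝ) (t : R3) : ℝ :=
  let A : ℝ := (2 + m)⁻¹
  1 / ‖t‖ ^ 2 * ell m t K Q ^ (-(1 / 2) : ℝ) *
    (|inner ℝ (s + A • K) (t + A • K)| /
      ((‖s + A • K‖ ^ 2 + ‖t + A • K‖ ^ 2 + m / (1 + m) * (Q ^ 2 + A * ‖K‖ ^ 2)) ^ 2
        - (2 / (1 + m) * inner ℝ (s + A • K) (t + A • K)) ^ 2))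

/-- `Λ(m)`, a supremum of integrals of non-negative functions, with values in `[0, ∞]`. -/
def Lam (m : ℝ) : ℝ≥0∞ :=
  ⨆ (s : R3) (K : R3) (Q : ℝ) (_ : 0 < Q),
    ENNReal.ofReal ((‖s‖ ^ 2 + Q ^ 2) / (Real.pi ^ 2 * (1 + m)) * ell m s K Q ^ (-(1 / 2) : ℝ)) *
      ∫⁻ t : R3, ENNReal.ofReal (lambdaIntegrand m s K Q t)

theorem symbol_swap (m μ : ℝ) {n : ℕ} (s t : R3) (q : Fin n → R3) :
    symbol m μ (Fin.cons s (Fin.cons t q : Fin (n + 1) → R3) : Fin (n + 2) → R3)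
      = symbol m μ (Fin.cons t (Fin.cons s q : Fin (n + 1) → R3) : Fin (n + 2) → R3) := by
  simp only [symbol, Fin.sum_univ_succ, Fin.cons_zero, Fin.cons_succ, Fin.Ioi_zero_eq_map,
    Fin.Ioi_succ, Finset.sum_map, Fin.coe_succEmb, real_inner_comm t s]
  ring

theorem integral_offIntegrand_im (m μ : ℝ) {n : ℕ} (ξ : L2 (n + 1)) :
    (∫ p, offIntegrand m μ ξ p).im = 0 := by
  have hmp : MeasurePreserving
      (MeasurableEquiv.prodCongr (MeasurableEquiv.prodComm (α := R3) (β := R3))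
        (MeasurableEquiv.refl (Fin n → R3))) volume volume :=
    (Measure.measurePreserving_swap (μ := (volume : Measure R3)) (ν := (volume : Measure R3))).prod
      (MeasurePreserving.id (volume : Measure (Fin n → R3)))
  have h := hmp.integral_comp' (offIntegrand m μ ξ)
  have h2 : (∫ p, offIntegrand m μ ξ p) = star (∫ p, offIntegrand m μ ξ p) := by
    conv_lhs => rw [← h]
    rw [Complex.star_def, ← integral_conj]
    congr 1
    ext1 p
    change offIntegrand m μ ξ ((p.1.2, p.1.1), p.2) = _
    simp only [offIntegrand, G, symbol_swap m μ p.1.2 p.1.1 p.2, map_mul, Complex.star_def,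
      Complex.conj_conj, Complex.conj_ofReal]
    ring
  exact Complex.conj_eq_iff_im.mp h2.symm

end PointInteraction

end

open PointInteraction

/-!
Write `G(s, t, q) = (even + odd)⁻¹`, where in terms of the shifted momenta `s + AK` and `t + AK`,
with `K` the total momentum of the remaining particles, `even` is even and `odd` is odd in each of
the two. The part `even / (even² - odd²)` of `G` is a superposition of rank one kernels, hence
positive definite, and it does not contribute to the negative part of `T_off`. The remaining part
is estimated by a Schur test with the weight `‖t‖² ℓ_m(t)^{1/2}`: antisymmetry of `ξ` makes it
possible to trade `(N - 1) ‖s‖²` for `‖s‖² + ∑ ‖q_i‖²`, and the resulting constant is `Λ(m)`.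
Therefore `T_diag + T_off ≥ (1 - Λ(m)) T_diag ≥ 2π² √μ (1 - Λ(m)) ‖ξ‖²`.

Integrating `G_μ - G_μ'` over one momentum gives `L_μ' - L_μ`, which makes `F_α` independent of `μ`.
For `α < 0` the choice `√μ = -α / (2π² (1 - Λ(m)))` makes the bracket multiplying `N` non-negative,
which leaves `F_α(u) ≥ -μ ‖u‖²`. For larger `μ` the form controls both the `H¹` norm of `w` and the
`H^{1/2}` norm of `ξ`, and closedness follows from the completeness of weighted `L²` spaces.
-/

noncomputable section

namespace PointInteraction

/-! ### Square integrability and Sobolev spaces -/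

section LpTwo

variable {X E : Type*} [MeasurableSpace X] {ρ : Measure X} [NormedAddCommGroup E]

theorem memLp_two_iff_lintegral_enorm_sq_lt_top {f : X → E} (hf : AEStronglyMeasurable f ρ) :
    MemLp f 2 ρ ↔ ∫⁻ x, ‖f x‖ₑ ^ 2 ∂ρ < ⊤ := by
  rw [MemLp, eLpNorm_lt_top_iff_lintegral_rpow_enorm_lt_top two_ne_zero ENNReal.ofNat_ne_top]
  simp only [hf, true_and, ENNReal.toReal_ofNat, ENNReal.rpow_ofNat]

theorem enorm_sq_eq_lintegral_enorm_sq (f : Lp E 2 ρ) : ‖f‖ₑ ^ 2 = ∫⁻ x, ‖f x‖ₑ ^ 2 ∂ρ := by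
  rw [Lp.enorm_def, eLpNorm_eq_lintegral_rpow_enorm_toReal two_ne_zero ENNReal.ofNat_ne_top,
    ← ENNReal.rpow_natCast, ← ENNReal.rpow_mul]
  norm_num

end LpTwo

section PiLp

variable {ι : Type*} [Fintype ι] {E : ι → Type*} [∀ i, NormedAddCommGroup (E i)]
  [∀ i, InnerProductSpace ℝ (E i)]

theorem toLp_preimage_parallelepiped_orthonormalBasis {κ : ι → Type*} [∀ i, Fintype (κ i)]
    (b : ∀ i, OrthonormalBasis (κ i) ℝ (E i)) :
    WithLp.toLp 2 ⁻¹' parallelepiped (Pi.orthonormalBasis b) =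
      Set.univ.pi fun i => parallelepiped (b i) := by
  ext q
  simp_rw [← OrthonormalBasis.coe_toBasis, parallelepiped_basis_eq]
  exact ⟨fun h i _ j => h ⟨i, j⟩, fun h j => h j.1 trivial j.2⟩

variable [∀ i, FiniteDimensional ℝ (E i)] [∀ i, MeasurableSpace (E i)] [∀ i, BorelSpace (E i)]

theorem volume_preserving_toLp_pi :
    MeasurePreserving (fun q : ∀ i, E i => (WithLp.toLp 2 q : PiLp 2 E)) := by
  let e : (∀ i, E i) ≃L[ℝ] PiLp 2 E := (PiLp.continuousLinearEquiv 2 ℝ E).symm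
  let b := Pi.orthonormalBasis fun i => stdOrthonormalBasis ℝ (E i)
  have : (Measure.map e (volume : Measure (∀ i, E i))).IsAddHaarMeasure := e.isAddHaarMeasure_map _
  refine ⟨e.continuous.measurable, ?_⟩
  change Measure.map e volume = volume
  rw [← b.addHaar_eq_volume, eq_comm, Module.Basis.addHaar_eq_iff,
    Measure.map_apply e.continuous.measurable b.toBasis.parallelepiped.isCompact.measurableSet,
    Module.Basis.coe_parallelepiped, OrthonormalBasis.coe_toBasis]
  change volume (WithLp.toLp 2 ⁻¹' parallelepiped b) = 1
  rw [toLp_preimage_parallelepiped_orthonormalBasis, volume_pi_pi]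
  exact Finset.prod_eq_one fun i _ => (stdOrthonormalBasis ℝ (E i)).volume_parallelepiped

end PiLp

section Sobolev

variable {E F : Type*} [NormedAddCommGroup E] [InnerProductSpace ℝ E] [NormedAddCommGroup F]

section SmulLeft

variable [NormedSpace ℂ F] {g h : E → ℂ}

theorem smulLeftCLM_smulLeftCLM_of_mul_eq_one (hg : g.HasTemperateGrowth)
    (hh : h.HasTemperateGrowth) (hgh : g * h = 1) (d : 𝓢'(E, F)) :
    TemperedDistribution.smulLeftCLM F g (TemperedDistribution.smulLeftCLM F h d) = d := by
  have h1 : h * g = fun _ => 1 := by rw [mul_comm, hgh]; rfl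
  rw [TemperedDistribution.smulLeftCLM_smulLeftCLM_apply hh hg, h1,
    TemperedDistribution.smulLeftCLM_const, one_smul]

variable [FiniteDimensional ℝ E] [MeasurableSpace E] [BorelSpace E] [CompleteSpace F]

theorem toTemperedDistribution_injective {p : ℝ≥0∞} [Fact (1 ≤ p)] :
    Function.Injective (fun f : Lp F p (volume : Measure E) => (f : 𝓢'(E, F))) :=
  LinearMap.ker_eq_bot.1 (Lp.ker_toTemperedDistributionCLM_eq_bot (μ := volume) (p := p))

theorem smulLeftCLM_toTemperedDistribution_eq_iff {p : ℝ≥0∞} [Fact (1 ≤ p)]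
    (hg : g.HasTemperateGrowth) (hh : h.HasTemperateGrowth) (hgh : g * h = 1)
    (hb : MemLp h ⊤ (volume : Measure E)) (f f' : Lp F p (volume : Measure E)) :
    TemperedDistribution.smulLeftCLM F g (f : 𝓢'(E, F)) = f' ↔
      (fun x => g x • f x) =ᵐ[volume] f' := by
  have hgh' : ∀ x, g x * h x = 1 := fun x => congrFun hgh x
  have hmul : ((hb.toLp h • f' : Lp F p (volume : Measure E)) : 𝓢'(E, F)) =
      TemperedDistribution.smulLeftCLM F h f' := Lp.toTemperedDistribution_smul_eq hh hb f'
  have hdiv : TemperedDistribution.smulLeftCLM F g (f : 𝓢'(E, F)) = f' ↔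
      f = hb.toLp h • f' := by
    rw [← toTemperedDistribution_injective.eq_iff, hmul]
    constructor
    · intro H
      rw [← H, smulLeftCLM_smulLeftCLM_of_mul_eq_one hh hg (by rw [mul_comm, hgh])]
    · intro H
      rw [H, smulLeftCLM_smulLeftCLM_of_mul_eq_one hg hh hgh]
  rw [hdiv, Lp.ext_iff]
  have hae := (Lp.coeFn_lpSMul (r := p) (hb.toLp h) f').and hb.coeFn_toLp
  refine eventually_congr (hae.mono fun x hx => ?_)
  rw [hx.1, Pi.smul_apply', hx.2]
  constructor
  · intro H
    simp only [H, smul_smul, hgh', one_smul]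
  · intro H
    rw [← H, smul_smul, mul_comm, hgh', one_smul]

end SmulLeft

variable [FiniteDimensional ℝ E] [MeasurableSpace E] [BorelSpace E]

theorem memLp_top_one_add_norm_sq_rpow {r : ℝ} (hr : r ≤ 0) :
    MemLp (fun x : E => (((1 + ‖x‖ ^ 2) ^ r : ℝ) : ℂ)) ⊤ volume := by
  have hc : Continuous fun x : E => (((1 + ‖x‖ ^ 2) ^ r : ℝ) : ℂ) :=
    Complex.continuous_ofReal.comp <|
      (by fun_prop : Continuous fun x : E => 1 + ‖x‖ ^ 2).rpow_const fun x => .inl (by positivity)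
  refine memLp_top_of_bound hc.aestronglyMeasurable 1 (.of_forall fun x => ?_)
  rw [Complex.norm_real, Real.norm_of_nonneg (by positivity)]
  exact Real.rpow_le_one_of_one_le_of_nonpos (by simp) hr

variable [InnerProductSpace ℂ F]

theorem compMeasurePreserving_schwartz_toLp (A : E ≃ₗᵢ[ℝ] E) (φ : 𝓢(E, F)) :
    Lp.compMeasurePreserving A A.measurePreserving (φ.toLp 2 volume) =
      (SchwartzMap.compCLMOfContinuousLinearEquiv ℂ A.toContinuousLinearEquiv φ).toLp 2 volume := by
  apply Lp.ext
  filter_upwards [Lp.coeFn_compMeasurePreserving (φ.toLp 2 volume) A.measurePreserving,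
    A.measurePreserving.quasiMeasurePreserving.ae (φ.coeFn_toLp 2 volume),
    SchwartzMap.coeFn_toLp (SchwartzMap.compCLMOfContinuousLinearEquiv ℂ
      A.toContinuousLinearEquiv φ) 2 volume] with x h1 h2 h3
  rw [h1, h3, Function.comp_apply, h2]
  rfl

variable [CompleteSpace F]

theorem memSobolev_two_iff_lintegral {r : ℝ} (hr : 0 ≤ r) (f : Lp F 2 (volume : Measure E)) :
    TemperedDistribution.MemSobolev r 2 (f : 𝓢'(E, F)) ↔
      ∫⁻ x, ‖(𝓕 f : Lp F 2 (volume : Measure E)) x‖ₑ ^ 2 * ENNReal.ofReal ((1 + ‖x‖ ^ 2) ^ r)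
        < ⊤ := by
  let g : E → ℂ := fun x => (((1 + ‖x‖ ^ 2) ^ (r / 2) : ℝ) : ℂ)
  let h : E → ℂ := fun x => (((1 + ‖x‖ ^ 2) ^ (-r / 2) : ℝ) : ℂ)
  have hg : g.HasTemperateGrowth := by fun_prop
  have hh : h.HasTemperateGrowth := by fun_prop
  have hpos (x : E) : 0 < 1 + ‖x‖ ^ 2 := by positivity
  have hgh : g * h = 1 := funext fun x => by
    simp only [g, h, Pi.mul_apply, Pi.one_apply]
    rw [← Complex.ofReal_mul, ← Real.rpow_add (hpos x), neg_div, add_neg_cancel, Real.rpow_zero,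
      Complex.ofReal_one]
  have hnorm (x : E) : ‖g x‖ₑ ^ 2 = ENNReal.ofReal ((1 + ‖x‖ ^ 2) ^ r) := by
    rw [← ofReal_norm, Complex.norm_real, Real.norm_of_nonneg (by positivity),
      ← ENNReal.ofReal_pow (by positivity), ← Real.rpow_mul_natCast (hpos x).le]
    norm_num
  have hmeas : AEStronglyMeasurable (fun x => g x • (𝓕 f : Lp F 2 (volume : Measure E)) x) :=
    hg.1.continuous.aestronglyMeasurable.smul (Lp.aestronglyMeasurable _)
  calc TemperedDistribution.MemSobolev r 2 (f : 𝓢'(E, F))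
      ↔ ∃ f' : Lp F 2 (volume : Measure E),
          (fun x => g x • (𝓕 f : Lp F 2 (volume : Measure E)) x) =ᵐ[volume] f' := by
        rw [TemperedDistribution.memSobolev_iff_exists_smulLeftCLM_fourier,
          Lp.fourier_toTemperedDistribution_eq]
        exact exists_congr fun f' => smulLeftCLM_toTemperedDistribution_eq_iff hg hh hgh
          (memLp_top_one_add_norm_sq_rpow (by linarith)) _ f'
    _ ↔ MemLp (fun x => g x • (𝓕 f : Lp F 2 (volume : Measure E)) x) 2 volume :=
        ⟨fun ⟨f', hf'⟩ => (memLp_congr_ae hf').2 (Lp.memLp f'),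
          fun H => ⟨H.toLp _, H.coeFn_toLp.symm⟩⟩
    _ ↔ _ := by
        rw [memLp_two_iff_lintegral_enorm_sq_lt_top hmeas]
        simp only [enorm_smul, mul_pow, hnorm, mul_comm]

theorem fourier_compMeasurePreserving (A : E ≃ₗᵢ[ℝ] E) (f : Lp F 2 (volume : Measure E)) :
    𝓕 (Lp.compMeasurePreserving A A.measurePreserving f) =
      Lp.compMeasurePreserving A A.measurePreserving (𝓕 f : Lp F 2 (volume : Measure E)) := by
  refine DenseRange.induction_on (SchwartzMap.denseRange_toLpCLM (p := 2) ENNReal.ofNat_ne_top) f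
    (p := fun f : Lp F 2 (volume : Measure E) =>
      𝓕 (Lp.compMeasurePreserving A A.measurePreserving f) =
        Lp.compMeasurePreserving A A.measurePreserving (𝓕 f : Lp F 2 (volume : Measure E))) ?_ ?_
  · have hA := (Lp.isometry_compMeasurePreserving (E := F) (p := 2) A.measurePreserving).continuous
    have hF := (Lp.fourierTransformₗᵢ E F).continuous
    exact isClosed_eq (hF.comp hA) (hA.comp hF)
  · intro φ
    rw [SchwartzMap.toLpCLM_apply, compMeasurePreserving_schwartz_toLp,
      SchwartzMap.toLp_fourier_eq, SchwartzMap.toLp_fourier_eq, compMeasurePreserving_schwartz_toLp]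
    congr 1
    ext x
    rw [SchwartzMap.fourier_coe]
    exact Real.fourier_comp_linearIsometry A φ x

end Sobolev

/-! ### The unitary Fourier transform -/

section Hat

variable {k : ℕ}

/-- The frequency at which Mathlib's Fourier transform has to be evaluated to obtain the unitary
one at the momenta `q`. -/
def freq (q : Fin k → R3) : Conf k := (2 * Real.pi)⁻¹ • WithLp.toLp 2 q

theorem measurable_freq : Measurable (freq : (Fin k → R3) → Conf k) :=
  ((PiLp.continuous_toLp 2 fun _ : Fin k => R3).const_smul (2 * Real.pi)⁻¹).measurable

theorem finrank_conf (k : ℕ) : Module.finrank ℝ (Conf k) = 3 * k := by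
  rw [LinearEquiv.finrank_eq (WithLp.linearEquiv 2 ℝ (Fin k → R3)), Module.finrank_pi_fintype]
  simp [mul_comm]

theorem map_freq (k : ℕ) :
    Measure.map freq (volume : Measure (Fin k → R3)) =
      ENNReal.ofReal ((2 * Real.pi) ^ (3 * k)) • (volume : Measure (Conf k)) := by
  have hcomp : (freq : (Fin k → R3) → Conf k) =
      (fun x : Conf k => (2 * Real.pi)⁻¹ • x) ∘ fun q => WithLp.toLp 2 q := rfl
  rw [hcomp, ← Measure.map_map (measurable_const_smul _) volume_preserving_toLp_pi.measurable,
    volume_preserving_toLp_pi.map_eq, Measure.map_addHaar_smul _ (by positivity), finrank_conf,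
    inv_pow, inv_inv, abs_of_pos (by positivity)]

theorem quasiMeasurePreserving_freq (k : ℕ) :
    Measure.QuasiMeasurePreserving (freq : (Fin k → R3) → Conf k) volume volume :=
  ⟨measurable_freq, by rw [map_freq]; exact Measure.smul_absolutelyContinuous⟩

theorem ae_freq_iff {p : Conf k → Prop} (hp : MeasurableSet {x | p x}) :
    (∀ᵐ q : Fin k → R3, p (freq q)) ↔ ∀ᵐ x : Conf k, p x := by
  rw [← ae_map_iff measurable_freq.aemeasurable hp, map_freq,
    Measure.ae_ennreal_smul_measure_iff (ENNReal.ofReal_pos.2 (by positivity)).ne']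

theorem lintegral_comp_freq {F : Conf k → ℝ≥0∞} (hF : Measurable F) :
    ∫⁻ q : Fin k → R3, F (freq q) = ENNReal.ofReal ((2 * Real.pi) ^ (3 * k)) * ∫⁻ x, F x := by
  rw [← lintegral_map hF measurable_freq, map_freq, lintegral_smul_measure, smul_eq_mul]

theorem norm_freq_sq (q : Fin k → R3) :
    ‖freq q‖ ^ 2 = ((2 * Real.pi) ^ 2)⁻¹ * ∑ i, ‖q i‖ ^ 2 := by
  rw [freq, norm_smul, mul_pow, PiLp.norm_sq_eq_of_L2, norm_inv, inv_pow,
    Real.norm_of_nonneg (by positivity)]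

theorem hat_eq (f : L2 k) (q : Fin k → R3) :
    hat f q = (((2 * Real.pi) ^ (-(3 * (k : ℝ) / 2)) : ℝ) : ℂ) * (𝓕 f : L2 k) (freq q) := rfl

@[fun_prop]
theorem measurable_hat (f : L2 k) : Measurable (hat f) :=
  measurable_const.mul ((Lp.stronglyMeasurable (𝓕 f : L2 k)).measurable.comp measurable_freq)

theorem hat_sub (f g : L2 k) : hat (f - g) =ᵐ[volume] fun q => hat f q - hat g q := by
  have hF : (𝓕 (f - g) : L2 k) = 𝓕 f - 𝓕 g := map_sub (Lp.fourierTransformₗᵢ (Conf k) ℂ) f g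
  have h : ∀ᵐ x : Conf k, (𝓕 (f - g) : L2 k) x = (𝓕 f : L2 k) x - (𝓕 g : L2 k) x :=
    hF ▸ Lp.coeFn_sub _ _
  filter_upwards [(quasiMeasurePreserving_freq k).ae h] with q hq
  rw [hat_eq, hat_eq, hat_eq, hq, mul_sub]

theorem enorm_hat_sq (f : L2 k) (q : Fin k → R3) :
    ‖hat f q‖ₑ ^ 2 =
      (ENNReal.ofReal ((2 * Real.pi) ^ (3 * k)))⁻¹ * ‖(𝓕 f : L2 k) (freq q)‖ₑ ^ 2 := by
  have hpi : 0 < 2 * Real.pi := by positivity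
  rw [hat_eq, enorm_mul, mul_pow]
  congr 1
  rw [← ofReal_norm, Complex.norm_real, Real.norm_of_nonneg (by positivity),
    ← ENNReal.ofReal_pow (by positivity), ← ENNReal.ofReal_inv_of_pos (by positivity),
    ← Real.rpow_mul_natCast hpi.le, ← Real.rpow_natCast, ← Real.rpow_neg hpi.le]
  congr 2
  push_cast
  ring

theorem lintegral_enorm_hat_sq_mul (f : L2 k) {w : Conf k → ℝ≥0∞} (hw : Measurable w) :
    ∫⁻ q, ‖hat f q‖ₑ ^ 2 * w (freq q) = ∫⁻ x, ‖(𝓕 f : L2 k) x‖ₑ ^ 2 * w x := by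
  have hc : ENNReal.ofReal ((2 * Real.pi) ^ (3 * k)) ≠ 0 :=
    (ENNReal.ofReal_pos.2 (by positivity)).ne'
  have hm : Measurable fun x => ‖(𝓕 f : L2 k) x‖ₑ ^ 2 * w x :=
    ((Lp.stronglyMeasurable (𝓕 f : L2 k)).measurable.enorm.pow_const 2).mul hw
  simp_rw [enorm_hat_sq, mul_assoc]
  rw [lintegral_const_mul' _ _ (ENNReal.inv_ne_top.2 hc), lintegral_comp_freq hm, ← mul_assoc,
    ENNReal.inv_mul_cancel hc ENNReal.ofReal_ne_top, one_mul]

theorem lintegral_enorm_hat_sq (f : L2 k) : ∫⁻ q, ‖hat f q‖ₑ ^ 2 = ‖f‖ₑ ^ 2 := by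
  have h := lintegral_enorm_hat_sq_mul f (w := fun _ => 1) measurable_const
  simp only [mul_one] at h
  rw [h, ← enorm_sq_eq_lintegral_enorm_sq, ← ofReal_norm, ← ofReal_norm, Lp.norm_fourier_eq]

theorem integrable_norm_hat_sq (f : L2 k) : Integrable fun q => ‖hat f q‖ ^ 2 := by
  have hm := (measurable_hat f).aestronglyMeasurable (μ := volume)
  refine (memLp_two_iff_integrable_sq_norm hm).1 ((memLp_two_iff_lintegral_enorm_sq_lt_top hm).2 ?_)
  rw [lintegral_enorm_hat_sq]
  exact ENNReal.pow_lt_top enorm_lt_top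

theorem integral_norm_hat_sq (f : L2 k) : ∫ q, ‖hat f q‖ ^ 2 = ‖f‖ ^ 2 := by
  rw [integral_eq_lintegral_of_nonneg_ae (.of_forall fun _ => by positivity)
    ((measurable_hat f).norm.pow_const 2).aestronglyMeasurable]
  simp only [ENNReal.ofReal_pow (norm_nonneg _), ofReal_norm, lintegral_enorm_hat_sq,
    ENNReal.toReal_pow, toReal_enorm]

theorem eq_of_hat_ae_eq {f g : L2 k} (h : hat f =ᵐ[volume] hat g) : f = g := by
  have hzero : ∫ q, ‖hat (f - g) q‖ ^ 2 = 0 := by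
    refine integral_eq_zero_of_ae ?_
    filter_upwards [hat_sub f g, h] with q hsub hq
    simp only [hsub, hq, sub_self, norm_zero, Pi.zero_apply, zero_pow two_ne_zero]
  rw [integral_norm_hat_sq] at hzero
  exact sub_eq_zero.1 (norm_eq_zero.1 (pow_eq_zero_iff two_ne_zero |>.1 hzero))

theorem exists_hat_ae_eq {h : (Fin k → R3) → ℂ} (hm : Measurable h)
    (hh : ∫⁻ q, ‖h q‖ₑ ^ 2 < ⊤) : ∃ f : L2 k, hat f =ᵐ[volume] h := by
  set c : ℝ := (2 * Real.pi) ^ (-(3 * (k : ℝ) / 2))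
  have hc : (c : ℂ) ≠ 0 := Complex.ofReal_ne_zero.2 (by positivity)
  let g : Conf k → ℂ := fun x => (c : ℂ)⁻¹ * h (fun i => (2 * Real.pi) • x i)
  have hgm : Measurable g := measurable_const.mul <| hm.comp <| measurable_pi_lambda _ fun i =>
    ((continuous_const_smul _).comp (PiLp.continuous_apply 2 _ i)).measurable
  have hg_freq (q : Fin k → R3) : g (freq q) = (c : ℂ)⁻¹ * h q := by
    simp only [g, freq, PiLp.smul_apply, smul_smul, mul_inv_cancel₀ Real.two_pi_pos.ne', one_smul]
  have hg : MemLp g 2 volume := by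
    rw [memLp_two_iff_lintegral_enorm_sq_lt_top hgm.aestronglyMeasurable]
    refine ENNReal.lt_top_of_mul_ne_top_right (a := ENNReal.ofReal ((2 * Real.pi) ^ (3 * k))) ?_
      (ENNReal.ofReal_pos.2 (by positivity)).ne'
    rw [← lintegral_comp_freq (hgm.enorm.pow_const 2)]
    simp_rw [hg_freq, enorm_mul, mul_pow]
    rw [lintegral_const_mul _ (hm.enorm.pow_const 2)]
    exact (ENNReal.mul_lt_top (ENNReal.pow_lt_top enorm_lt_top) hh).ne
  refine ⟨𝓕⁻ (hg.toLp g), ?_⟩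
  filter_upwards [(quasiMeasurePreserving_freq k).ae hg.coeFn_toLp] with q hq
  rw [hat_eq, FourierTransform.fourier_fourierInv_eq, hq, hg_freq, mul_inv_cancel_left₀ hc]

theorem exists_subseq_tendsto_hat {f : ℕ → L2 k} {g : L2 k} (h : Tendsto f atTop (𝓝 g)) :
    ∃ ns : ℕ → ℕ, StrictMono ns ∧
      ∀ᵐ q, Tendsto (fun i => hat (f (ns i)) q) atTop (𝓝 (hat g q)) := by
  have hF : Tendsto (fun i => (𝓕 (f i) : L2 k)) atTop (𝓝 (𝓕 g)) :=
    ((Lp.fourierTransformₗᵢ (Conf k) ℂ).continuous.tendsto g).comp h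
  obtain ⟨ns, hns, hlim⟩ := (tendstoInMeasure_of_tendsto_Lp hF).exists_seq_tendsto_ae
  refine ⟨ns, hns, ?_⟩
  filter_upwards [(quasiMeasurePreserving_freq k).ae hlim] with q hq
  exact hq.const_mul _

theorem memSobolev_iff_lintegral_hat {r : ℝ} (hr : 0 ≤ r) (f : L2 k) :
    TemperedDistribution.MemSobolev r 2 (f : 𝓢'(Conf k, ℂ)) ↔
      ∫⁻ q, ‖hat f q‖ₑ ^ 2 * ENNReal.ofReal ((1 + ∑ i, ‖q i‖ ^ 2) ^ r) < ⊤ := by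
  have hw : Measurable fun x : Conf k => ENNReal.ofReal ((1 + ‖x‖ ^ 2) ^ r) := by fun_prop
  rw [memSobolev_two_iff_lintegral hr, ← lintegral_enorm_hat_sq_mul f hw]
  have h0 : (2 * Real.pi) ^ 2 ≠ 0 := by positivity
  have h1 : 1 ≤ (2 * Real.pi) ^ 2 := by nlinarith [Real.pi_gt_three]
  constructor
  · intro h
    refine lt_of_le_of_lt ?_
      (ENNReal.mul_lt_top (a := ENNReal.ofReal (((2 * Real.pi) ^ 2) ^ r)) ENNReal.ofReal_lt_top h)
    rw [← lintegral_const_mul' _ _ ENNReal.ofReal_ne_top]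
    refine lintegral_mono fun q => ?_
    rw [mul_left_comm, ← ENNReal.ofReal_mul (by positivity),
      ← Real.mul_rpow (by positivity) (by positivity), norm_freq_sq, mul_add,
      mul_inv_cancel_left₀ h0, mul_one]
    gcongr
  · refine lt_of_le_of_lt (lintegral_mono fun q => ?_)
    gcongr
    rw [norm_freq_sq]
    exact mul_le_of_le_one_left (by positivity) (inv_le_one_of_one_le₀ h1)

end Hat

section Antisymmetry

variable {k : ℕ}

/-- The isometry `x ↦ x ∘ σ` of configuration space, which permutes the particles. -/
def permIso (σ : Equiv.Perm (Fin k)) : Conf k ≃ₗᵢ[ℝ] Conf k :=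
  LinearIsometryEquiv.piLpCongrLeft 2 ℝ R3 σ.symm

theorem permIso_apply (σ : Equiv.Perm (Fin k)) (x : Conf k) :
    permIso σ x = WithLp.toLp 2 fun i => x (σ i) := rfl

theorem freq_comp_perm (σ : Equiv.Perm (Fin k)) (q : Fin k → R3) :
    freq (q ∘ σ) = permIso σ (freq q) := rfl

theorem isAntisymm_iff_compMeasurePreserving (f : L2 k) :
    IsAntisymm f ↔ ∀ σ : Equiv.Perm (Fin k),
      Lp.compMeasurePreserving (permIso σ) (permIso σ).measurePreserving f =
        ((Equiv.Perm.sign σ : ℤ) : ℂ) • f := by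
  refine forall_congr' fun σ => ?_
  rw [Lp.ext_iff]
  refine eventually_congr ?_
  filter_upwards [Lp.coeFn_compMeasurePreserving f (permIso σ).measurePreserving,
    Lp.coeFn_smul ((Equiv.Perm.sign σ : ℤ) : ℂ) f] with x hcomp hsmul
  rw [hcomp, hsmul, Function.comp_apply, permIso_apply, Pi.smul_apply, smul_eq_mul]

theorem isAntisymm_fourier_iff (f : L2 k) : IsAntisymm (𝓕 f : L2 k) ↔ IsAntisymm f := by
  rw [isAntisymm_iff_compMeasurePreserving, isAntisymm_iff_compMeasurePreserving]
  refine forall_congr' fun σ => ?_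
  rw [← fourier_compMeasurePreserving, ← FourierTransform.fourier_smul]
  exact (Lp.fourierTransformₗᵢ (Conf k) ℂ).injective.eq_iff

theorem isAntisymm_iff_hat (f : L2 k) :
    IsAntisymm f ↔ ∀ σ : Equiv.Perm (Fin k), ∀ᵐ q : Fin k → R3,
      hat f (q ∘ σ) = ((Equiv.Perm.sign σ : ℤ) : ℂ) * hat f q := by
  rw [← isAntisymm_fourier_iff]
  refine forall_congr' fun σ => ?_
  have hm := (Lp.stronglyMeasurable (𝓕 f : L2 k)).measurable
  refine (ae_freq_iff (measurableSet_eq_fun (hm.comp (permIso σ).continuous.measurable)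
    (hm.const_mul _))).symm.trans ?_
  refine eventually_congr (.of_forall fun q => ?_)
  rw [hat_eq, hat_eq, mul_left_comm, freq_comp_perm, Function.comp_apply,
    mul_right_inj' (Complex.ofReal_ne_zero.2 (Real.rpow_pos_of_pos Real.two_pi_pos _).ne')]

theorem IsAntisymm.sub {f g : L2 k} (hf : IsAntisymm f) (hg : IsAntisymm g) :
    IsAntisymm (f - g) := by
  rw [isAntisymm_iff_compMeasurePreserving] at *
  intro σ
  rw [map_sub, hf, hg, smul_sub]

theorem isClosed_isAntisymm (k : ℕ) : IsClosed {f : L2 k | IsAntisymm f} := by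
  simp only [isAntisymm_iff_compMeasurePreserving, Set.ofPred_forall]
  exact isClosed_iInter fun σ => isClosed_eq
    (Lp.isometry_compMeasurePreserving (permIso σ).measurePreserving).continuous
    (continuous_const_smul _)

theorem IsAntisymm.norm_hat_perm {ξ : L2 k} (h : IsAntisymm ξ) (σ : Equiv.Perm (Fin k)) :
    ∀ᵐ q : Fin k → R3, ‖hat ξ (q ∘ σ)‖ = ‖hat ξ q‖ := by
  filter_upwards [(isAntisymm_iff_hat ξ).1 h σ] with q hq
  rw [hq, norm_mul, Complex.norm_intCast]
  rcases Int.units_eq_one_or (Equiv.Perm.sign σ) with h1 | h1 <;> simp [h1]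

end Antisymmetry

/-! ### Integrals over momentum space -/

section NormRpow

theorem norm_rpow_div_sq_add_eq {E : Type*} [NormedAddCommGroup E] [NormedSpace ℝ E] {e : ℝ}
    (he : 0 < e) (p : ℝ) (t : E) :
    ‖t‖ ^ (-p) / (e ^ 2 + ‖t‖ ^ 2) =
      e ^ (-p - 2) * (‖e⁻¹ • t‖ ^ (-p) / (1 + ‖e⁻¹ • t‖ ^ 2)) := by
  rw [norm_smul, norm_inv, Real.norm_of_nonneg he.le, Real.mul_rpow (by positivity) (norm_nonneg t),
    Real.inv_rpow he.le, Real.rpow_sub he, Real.rpow_two]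
  have := (Real.rpow_pos_of_pos he (-p)).ne'
  field_simp

variable {E : Type*} [NormedAddCommGroup E] [NormedSpace ℝ E] [FiniteDimensional ℝ E]
  [MeasurableSpace E] [BorelSpace E] (ν : Measure E) [ν.IsAddHaarMeasure]

theorem integrable_norm_rpow_div_one_add_sq [Nontrivial E] {p : ℝ}
    (hp : Module.finrank ℝ E - 2 < p) (hp' : p < Module.finrank ℝ E) :
    Integrable (fun t : E => ‖t‖ ^ (-p) / (1 + ‖t‖ ^ 2)) ν := by
  rw [integrable_fun_norm_addHaar ν (f := fun y : ℝ => y ^ (-p) / (1 + y ^ 2))]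
  set d := Module.finrank ℝ E
  have hd : ((d - 1 : ℕ) : ℝ) = d - 1 := Nat.cast_pred Module.finrank_pos
  have hmeas : Measurable fun y : ℝ => y ^ (d - 1) • (y ^ (-p) / (1 + y ^ 2)) := by fun_prop
  have hnorm : ∀ y : ℝ, 0 < y →
      ‖y ^ (d - 1) • (y ^ (-p) / (1 + y ^ 2))‖ = y ^ (d - 1 - p) / (1 + y ^ 2) := fun y hy => by
    rw [Real.norm_of_nonneg (by positivity), smul_eq_mul, ← mul_div_assoc, ← Real.rpow_natCast,
      hd, ← Real.rpow_add hy, sub_eq_add_neg _ p]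
  rw [← Set.Ioc_union_Ioi_eq_Ioi zero_le_one]
  refine IntegrableOn.union ?_ ?_
  · have hint := (intervalIntegral.intervalIntegrable_rpow' (a := 0) (b := 1)
      (r := d - 1 - p) (by linarith)).1
    refine Integrable.mono' hint hmeas.aestronglyMeasurable ?_
    filter_upwards [ae_restrict_mem measurableSet_Ioc] with y hy
    rw [hnorm y hy.1]
    exact div_le_self (Real.rpow_nonneg hy.1.le _) (by nlinarith)
  · have hint := integrableOn_Ioi_rpow_of_lt (a := d - 1 - p - 2) (by linarith) zero_lt_one
    refine Integrable.mono' hint hmeas.aestronglyMeasurable ?_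
    filter_upwards [ae_restrict_mem measurableSet_Ioi] with y hy
    have hy0 : 0 < y := zero_lt_one.trans hy
    rw [hnorm y hy0, Real.rpow_sub hy0 _ 2, Real.rpow_two]
    gcongr
    linarith

theorem lintegral_comp_inv_smul {F : E → ℝ≥0∞} (hF : Measurable F) {e : ℝ} (he : 0 < e) :
    ∫⁻ t, F (e⁻¹ • t) ∂ν = ENNReal.ofReal (e ^ Module.finrank ℝ E) * ∫⁻ t, F t ∂ν := by
  rw [← lintegral_map hF (measurable_const_smul e⁻¹),
    Measure.map_addHaar_smul ν (inv_ne_zero he.ne'), lintegral_smul_measure, smul_eq_mul,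
    inv_pow, inv_inv, abs_of_pos (pow_pos he _)]

theorem lintegral_norm_rpow_div_sq_add [Nontrivial E] {p : ℝ}
    (hp : Module.finrank ℝ E - 2 < p) (hp' : p < Module.finrank ℝ E) {e : ℝ} (he : 0 < e) :
    ∫⁻ t : E, ENNReal.ofReal (‖t‖ ^ (-p) / (e ^ 2 + ‖t‖ ^ 2)) ∂ν =
      ENNReal.ofReal (e ^ (Module.finrank ℝ E - 2 - p) * ∫ t, ‖t‖ ^ (-p) / (1 + ‖t‖ ^ 2) ∂ν) := by
  have hpow : e ^ (-p - 2) * e ^ Module.finrank ℝ E = e ^ (Module.finrank ℝ E - 2 - p) := by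
    rw [← Real.rpow_natCast, ← Real.rpow_add he]
    ring_nf
  simp_rw [norm_rpow_div_sq_add_eq he, ENNReal.ofReal_mul (Real.rpow_nonneg he.le _)]
  rw [lintegral_const_mul' _ _ ENNReal.ofReal_ne_top,
    lintegral_comp_inv_smul ν (F := fun t => ENNReal.ofReal (‖t‖ ^ (-p) / (1 + ‖t‖ ^ 2)))
      (by fun_prop) he,
    ← ofReal_integral_eq_lintegral_ofReal (integrable_norm_rpow_div_one_add_sq ν hp hp')
      (.of_forall fun t => by positivity),
    ← mul_assoc, ← ENNReal.ofReal_mul (by positivity), hpow]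

end NormRpow

theorem volume_real_ball_R3 : (volume : Measure R3).real (Metric.ball 0 1) = 4 * Real.pi / 3 := by
  rw [Measure.real, EuclideanSpace.volume_ball_fin_three, ENNReal.ofReal_one, one_pow, one_mul,
    ENNReal.toReal_ofReal (by positivity), mul_comm, mul_div_assoc]

theorem hasDerivAt_mul_arctan_div {c : ℝ} (hc : 0 < c) (r : ℝ) :
    HasDerivAt (fun r => c * Real.arctan (r / c)) (c ^ 2 * (r ^ 2 + c ^ 2)⁻¹) r := by
  convert! (((hasDerivAt_id r).div_const c).arctan).const_mul c using 1
  simp only [id]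
  field_simp
  ring

theorem tendsto_mul_arctan_div_atTop {c : ℝ} (hc : 0 < c) :
    Tendsto (fun r => c * Real.arctan (r / c)) atTop (𝓝 (c * (Real.pi / 2))) :=
  ((Real.tendsto_arctan_atTop.mono_right nhdsWithin_le_nhds).comp
    (tendsto_id.atTop_div_const hc)).const_mul c

theorem integral_inv_sub_inv_of_le {a b : ℝ} (ha : 0 < a) (hab : a ≤ b) :
    Integrable (fun x : R3 => (‖x‖ ^ 2 + a ^ 2)⁻¹ - (‖x‖ ^ 2 + b ^ 2)⁻¹) ∧
      ∫ x : R3, ((‖x‖ ^ 2 + a ^ 2)⁻¹ - (‖x‖ ^ 2 + b ^ 2)⁻¹) = 2 * Real.pi ^ 2 * (b - a) := by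
  have hb : 0 < b := ha.trans_le hab
  let f : ℝ → ℝ := fun r => (r ^ 2 + a ^ 2)⁻¹ - (r ^ 2 + b ^ 2)⁻¹
  let F : ℝ → ℝ := fun r => b * Real.arctan (r / b) - a * Real.arctan (r / a)
  have hderiv : ∀ r ∈ Set.Ici (0 : ℝ), HasDerivAt F (r ^ 2 * f r) r := fun r _ => by
    convert! (hasDerivAt_mul_arctan_div hb r).sub (hasDerivAt_mul_arctan_div ha r) using 1
    simp only [f]
    field_simp
    ring
  have hpos : ∀ r ∈ Set.Ioi (0 : ℝ), 0 ≤ r ^ 2 * f r := fun r _ =>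
    mul_nonneg (by positivity) (sub_nonneg.2 (by gcongr))
  have hlim := (tendsto_mul_arctan_div_atTop hb).sub (tendsto_mul_arctan_div_atTop ha)
  have hint : IntegrableOn (fun r => r ^ 2 * f r) (Set.Ioi 0) :=
    integrableOn_Ioi_deriv_of_nonneg' hderiv hpos hlim
  have hval : ∫ r in Set.Ioi 0, r ^ 2 * f r = (b - a) * (Real.pi / 2) := by
    rw [integral_Ioi_of_hasDerivAt_of_nonneg' hderiv hpos hlim]
    simp only [F, zero_div, Real.arctan_zero]
    ring
  constructor
  · exact (integrable_fun_norm_addHaar volume (f := f)).2 (by simpa using hint)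
  · rw [integral_fun_norm_addHaar volume f]
    simp only [finrank_euclideanSpace, Fintype.card_fin, Nat.add_one_sub_one, smul_eq_mul,
      nsmul_eq_mul, volume_real_ball_R3, hval]
    push_cast
    ring

theorem integral_inv_sub_inv {a b : ℝ} (ha : 0 < a) (hb : 0 < b) (d : R3) :
    Integrable (fun x : R3 => (‖x + d‖ ^ 2 + a ^ 2)⁻¹ - (‖x + d‖ ^ 2 + b ^ 2)⁻¹) ∧
      ∫ x : R3, ((‖x + d‖ ^ 2 + a ^ 2)⁻¹ - (‖x + d‖ ^ 2 + b ^ 2)⁻¹) =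
        2 * Real.pi ^ 2 * (b - a) := by
  suffices hzero : Integrable (fun x : R3 => (‖x‖ ^ 2 + a ^ 2)⁻¹ - (‖x‖ ^ 2 + b ^ 2)⁻¹) ∧
      ∫ x : R3, ((‖x‖ ^ 2 + a ^ 2)⁻¹ - (‖x‖ ^ 2 + b ^ 2)⁻¹) = 2 * Real.pi ^ 2 * (b - a) from
    ⟨hzero.1.comp_add_right d, hzero.2 ▸ integral_add_right_eq_self
      (fun x : R3 => (‖x‖ ^ 2 + a ^ 2)⁻¹ - (‖x‖ ^ 2 + b ^ 2)⁻¹) d⟩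
  rcases le_total a b with hab | hba
  · exact integral_inv_sub_inv_of_le ha hab
  · obtain ⟨hint, hval⟩ := integral_inv_sub_inv_of_le hb hba
    refine ⟨hint.neg.congr (.of_forall fun x => by simp), ?_⟩
    rw [← neg_sub a b, mul_neg, ← hval, ← integral_neg]
    simp only [neg_sub]

theorem not_integrable_inv_norm_sq_add {D : ℝ} (hD : 0 < D) :
    ¬ Integrable fun x : R3 => (‖x‖ ^ 2 + D)⁻¹ := by
  rw [integrable_fun_norm_addHaar volume (f := fun y : ℝ => (y ^ 2 + D)⁻¹)]
  intro hint
  have hconst : IntegrableOn (fun _ : ℝ => (1 / 2 : ℝ)) (Set.Ioi (Real.sqrt D)) := by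
    refine Integrable.mono' (hint.mono_set (Set.Ioi_subset_Ioi (Real.sqrt_nonneg D)))
      aestronglyMeasurable_const ?_
    filter_upwards [ae_restrict_mem measurableSet_Ioi] with y hy
    have hDy : D < y ^ 2 := Real.lt_sq_of_sqrt_lt hy
    simp only [finrank_euclideanSpace, Fintype.card_fin, Nat.add_one_sub_one, smul_eq_mul]
    rw [Real.norm_of_nonneg (by norm_num), ← div_eq_mul_inv, le_div_iff₀ (by positivity)]
    linarith
  simp [integrableOn_const_iff] at hconst

theorem lintegral_inv_norm_add_sq_add {D : ℝ} (hD : 0 < D) (d : R3) :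
    ∫⁻ x : R3, ENNReal.ofReal (‖x + d‖ ^ 2 + D)⁻¹ = ⊤ := by
  rw [lintegral_add_right_eq_self (fun x : R3 => ENNReal.ofReal (‖x‖ ^ 2 + D)⁻¹) d]
  by_contra hfin
  refine not_integrable_inv_norm_sq_add hD ⟨by fun_prop, ?_⟩
  rw [hasFiniteIntegral_iff_ofReal (.of_forall fun x => by positivity)]
  exact lt_top_iff_ne_top.2 hfin

/-! ### The symbol in shifted momenta -/

theorem norm_sq_le_two_mul_norm_add_sq {E : Type*} [SeminormedAddCommGroup E] (x y : E) :
    ‖x‖ ^ 2 ≤ 2 * (‖x + y‖ ^ 2 + ‖y‖ ^ 2) :=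
  (pow_le_pow_left₀ (norm_nonneg x) (norm_le_add_norm_add x y) 2).trans add_sq_le

theorem norm_sum_sq_eq {E : Type*} [NormedAddCommGroup E] [InnerProductSpace ℝ E] {k : ℕ}
    (q : Fin k → E) :
    ‖∑ i, q i‖ ^ 2 = ∑ i, ‖q i‖ ^ 2 + 2 * ∑ i, ∑ j ∈ Finset.Ioi i, inner ℝ (q i) (q j) := by
  induction k with
  | zero => simp
  | succ k ih =>
    rw [Fin.sum_univ_succ, norm_add_sq_real, ih (fun i => q i.succ), inner_sum]
    simp only [Fin.sum_univ_succ, Fin.Ioi_zero_eq_map, Fin.Ioi_succ, Finset.sum_map,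
      Fin.coe_succEmb]
    ring

theorem norm_sum_sq_le {E ι : Type*} [SeminormedAddCommGroup E] [Fintype ι] (q : ι → E) :
    ‖∑ i, q i‖ ^ 2 ≤ Fintype.card ι * ∑ i, ‖q i‖ ^ 2 := by
  calc ‖∑ i, q i‖ ^ 2 ≤ (∑ i, ‖q i‖) ^ 2 := by gcongr; exact norm_sum_le _ _
    _ ≤ _ := sq_sum_le_card_mul_sum_sq (s := Finset.univ) (f := fun i => ‖q i‖)

section Symbol

variable {m μ : ℝ} {k : ℕ}

theorem symbol_eq (hm : 0 < m) (μ : ℝ) (q : Fin k → R3) :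
    symbol m μ q = m / (m + 1) * ∑ i, ‖q i‖ ^ 2 + 1 / (m + 1) * ‖∑ i, q i‖ ^ 2 + μ := by
  rw [symbol, norm_sum_sq_eq]
  field_simp
  ring

theorem L_eq (hm : 0 < m) (μ : ℝ) (q : Fin k → R3) :
    L m μ q = 2 * Real.pi ^ 2 * Real.sqrt
      (m / (m + 1) * ∑ i, ‖q i‖ ^ 2 + m / (m + 1) ^ 2 * ‖∑ i, q i‖ ^ 2 + μ) := by
  rw [L, norm_sum_sq_eq]
  congr 2
  field_simp
  ring

theorem le_symbol (hm : 0 < m) (μ : ℝ) (q : Fin k → R3) : μ ≤ symbol m μ q := by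
  rw [symbol_eq hm]
  exact le_add_of_nonneg_left (by positivity)

theorem symbol_pos (hm : 0 < m) (hμ : 0 < μ) (q : Fin k → R3) : 0 < symbol m μ q :=
  hμ.trans_le (le_symbol hm μ q)

theorem L_pos (hm : 0 < m) (hμ : 0 < μ) (q : Fin k → R3) : 0 < L m μ q := by
  rw [L_eq hm]
  positivity

theorem sqrt_le_L (hm : 0 < m) (μ : ℝ) (q : Fin k → R3) :
    2 * Real.pi ^ 2 * Real.sqrt μ ≤ L m μ q := by
  rw [L_eq hm]
  gcongr
  exact le_add_of_nonneg_left (by positivity)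

theorem symbol_perm (hm : 0 < m) (μ : ℝ) (σ : Equiv.Perm (Fin k)) (q : Fin k → R3) :
    symbol m μ (q ∘ σ) = symbol m μ q := by
  simp only [symbol_eq hm, Function.comp_apply, Equiv.sum_comp σ (fun i => ‖q i‖ ^ 2),
    Equiv.sum_comp σ q]

theorem L_perm (hm : 0 < m) (μ : ℝ) (σ : Equiv.Perm (Fin k)) (q : Fin k → R3) :
    L m μ (q ∘ σ) = L m μ q := by
  simp only [L_eq hm, Function.comp_apply, Equiv.sum_comp σ (fun i => ‖q i‖ ^ 2),
    Equiv.sum_comp σ q]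

@[fun_prop]
theorem measurable_symbol (m μ : ℝ) : Measurable fun q : Fin k → R3 => symbol m μ q := by
  unfold symbol
  fun_prop

@[fun_prop]
theorem measurable_G (m μ : ℝ) : Measurable fun q : Fin k → R3 => G m μ q :=
  (measurable_symbol m μ).inv

@[fun_prop]
theorem measurable_L (m μ : ℝ) : Measurable fun q : Fin k → R3 => L m μ q := by
  unfold L
  fun_prop

-- Completing the square in one momentum: this is where `L` comes from.
theorem symbol_cons (hm : 0 < m) (hμ : 0 < μ) (x : R3) (q : Fin k → R3) :
    symbol m μ (Fin.cons x q : Fin (k + 1) → R3) =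
      ‖x + (m + 1)⁻¹ • ∑ i, q i‖ ^ 2 + (L m μ q / (2 * Real.pi ^ 2)) ^ 2 := by
  rw [symbol_eq hm, L_eq hm, mul_div_cancel_left₀ _ (by positivity), Real.sq_sqrt (by positivity),
    Fin.sum_univ_succ, Fin.sum_univ_succ]
  simp only [Fin.cons_zero, Fin.cons_succ]
  rw [norm_add_sq_real, norm_add_sq_real, inner_smul_right, norm_smul, mul_pow, norm_inv,
    Real.norm_of_nonneg (by positivity)]
  field_simp
  ring

/-- The value of `Q` for which `L(s, q) = 2π² ℓ_m(s, ∑ qᵢ, Q)`. It absorbs the spectral parameter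
`μ`, which does not occur in `ℓ_m`. -/
def effQ (m μ : ℝ) {k : ℕ} (q : Fin k → R3) : ℝ :=
  Real.sqrt (∑ i, ‖q i‖ ^ 2 + μ * (m + 1) / m)

theorem effQ_pos (hm : 0 < m) (hμ : 0 < μ) (q : Fin k → R3) : 0 < effQ m μ q :=
  Real.sqrt_pos.2 (by positivity)

theorem effQ_sq (hm : 0 < m) (hμ : 0 < μ) (q : Fin k → R3) :
    effQ m μ q ^ 2 = ∑ i, ‖q i‖ ^ 2 + μ * (m + 1) / m := Real.sq_sqrt (by positivity)

@[fun_prop]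
theorem measurable_effQ (m μ : ℝ) : Measurable fun q : Fin k → R3 => effQ m μ q := by
  unfold effQ
  fun_prop

theorem L_cons (hm : 0 < m) (hμ : 0 < μ) (s : R3) (q : Fin k → R3) :
    L m μ (Fin.cons s q : Fin (k + 1) → R3) =
      2 * Real.pi ^ 2 * ell m s (∑ i, q i) (effQ m μ q) := by
  rw [L_eq hm, ell, effQ_sq hm hμ, Fin.sum_univ_succ, Fin.sum_univ_succ]
  simp only [Fin.cons_zero, Fin.cons_succ]
  congr 2
  field_simp
  ring

/-- The part of the symbol that is even in each of the shifted momenta `s + AK` and `t + AK`,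
where `A = (2 + m)⁻¹` and `K` is the sum of the remaining momenta. -/
def evenSymbol (m : ℝ) (s t K : R3) (Q : ℝ) : ℝ :=
  ‖s + (2 + m)⁻¹ • K‖ ^ 2 + ‖t + (2 + m)⁻¹ • K‖ ^ 2 + m / (1 + m) * (Q ^ 2 + (2 + m)⁻¹ * ‖K‖ ^ 2)

/-- The part of the symbol that is odd in each of the shifted momenta `s + AK` and `t + AK`. -/
def oddSymbol (m : ℝ) (s t K : R3) : ℝ :=
  2 / (1 + m) * inner ℝ (s + (2 + m)⁻¹ • K) (t + (2 + m)⁻¹ • K)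

theorem symbol_cons_cons (hm : 0 < m) (hμ : 0 < μ) (s t : R3) (q : Fin k → R3) :
    symbol m μ (Fin.cons s (Fin.cons t q : Fin (k + 1) → R3) : Fin (k + 2) → R3) =
      evenSymbol m s t (∑ i, q i) (effQ m μ q) + oddSymbol m s t (∑ i, q i) := by
  rw [symbol_eq hm, evenSymbol, oddSymbol, effQ_sq hm hμ]
  simp only [Fin.sum_univ_succ, Fin.cons_zero, Fin.cons_succ]
  set K := ∑ i, q i
  rw [norm_add_sq_real s, norm_add_sq_real t K, norm_add_sq_real s, norm_add_sq_real t,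
    inner_add_left, inner_add_right, inner_add_right, inner_add_right]
  simp only [inner_smul_left, inner_smul_right, norm_smul, mul_pow, norm_inv,
    Real.norm_of_nonneg (by positivity : 0 ≤ 2 + m), map_inv₀, conj_trivial,
    real_inner_self_eq_norm_sq, real_inner_comm t K]
  field_simp
  ring

end Symbol

section SymbolBounds

variable {m : ℝ} {Q : ℝ}

theorem evenSymbol_swap (m : ℝ) (s t K : R3) (Q : ℝ) :
    evenSymbol m s t K Q = evenSymbol m t s K Q := by
  simp only [evenSymbol, add_comm (‖s + (2 + m)⁻¹ • K‖ ^ 2)]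

theorem oddSymbol_swap (m : ℝ) (s t K : R3) : oddSymbol m s t K = oddSymbol m t s K := by
  rw [oddSymbol, oddSymbol, real_inner_comm]

theorem evenSymbol_pos (hm : 0 < m) (s t K : R3) (hQ : 0 < Q) : 0 < evenSymbol m s t K Q := by
  unfold evenSymbol
  positivity

theorem two_mul_abs_inner_le_evenSymbol (hm : 0 < m) (s t K : R3) (Q : ℝ) :
    2 * |inner ℝ (s + (2 + m)⁻¹ • K) (t + (2 + m)⁻¹ • K)| ≤ evenSymbol m s t K Q := by
  have hcauchy := abs_real_inner_le_norm (s + (2 + m)⁻¹ • K) (t + (2 + m)⁻¹ • K)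
  have hrest : 0 ≤ m / (1 + m) * (Q ^ 2 + (2 + m)⁻¹ * ‖K‖ ^ 2) := by positivity
  unfold evenSymbol
  linarith [two_mul_le_add_sq ‖s + (2 + m)⁻¹ • K‖ ‖t + (2 + m)⁻¹ • K‖]

theorem abs_oddSymbol_le (hm : 0 < m) (s t K : R3) (Q : ℝ) :
    |oddSymbol m s t K| ≤ (1 + m)⁻¹ * evenSymbol m s t K Q := by
  rw [oddSymbol, abs_mul, abs_of_pos (by positivity), div_eq_inv_mul, mul_assoc]
  gcongr
  exact two_mul_abs_inner_le_evenSymbol hm s t K Q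

theorem abs_oddSymbol_lt (hm : 0 < m) (s t K : R3) (hQ : 0 < Q) :
    |oddSymbol m s t K| < evenSymbol m s t K Q :=
  (abs_oddSymbol_le hm s t K Q).trans_lt <|
    mul_lt_of_lt_one_left (evenSymbol_pos hm s t K hQ) (inv_lt_one_of_one_lt₀ (by linarith))

theorem le_evenSymbol (hm : 0 < m) (s t K : R3) (Q : ℝ) :
    m * (2 + m)⁻¹ / (1 + m) / 2 * (‖s‖ ^ 2 + ‖K‖ ^ 2 + Q ^ 2 + ‖t‖ ^ 2) ≤ evenSymbol m s t K Q := by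
  unfold evenSymbol
  set A : ℝ := (2 + m)⁻¹
  set κ : ℝ := m * A / (1 + m) with hκ
  have hA0 : 0 < A := by positivity
  have hA : A ≤ 1 / 2 := inv_le_of_inv_le₀ (by norm_num) (by linarith)
  have hr0 : 0 ≤ m / (1 + m) := by positivity
  have hr1 : m / (1 + m) ≤ 1 := (div_le_one (by positivity)).2 (by linarith)
  have hκr : m / (1 + m) * A = κ := by rw [hκ]; ring
  have hκ0 : 0 ≤ κ := by positivity
  have hshift : ∀ x : R3, ‖x‖ ^ 2 ≤ 2 * ‖x + A • K‖ ^ 2 + ‖K‖ ^ 2 / 2 := fun x => by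
    have h := norm_sq_le_two_mul_norm_add_sq x (A • K)
    rw [norm_smul, Real.norm_of_nonneg hA0.le, mul_pow] at h
    have hA2 : A ^ 2 * ‖K‖ ^ 2 ≤ (1 / 2) ^ 2 * ‖K‖ ^ 2 := by gcongr
    linarith
  have hst : κ * (‖s‖ ^ 2 + ‖t‖ ^ 2) ≤
      κ * (2 * (‖s + A • K‖ ^ 2 + ‖t + A • K‖ ^ 2) + ‖K‖ ^ 2) :=
    mul_le_mul_of_nonneg_left (by linarith [hshift s, hshift t]) hκ0
  have hκ1 : κ * (‖s + A • K‖ ^ 2 + ‖t + A • K‖ ^ 2) ≤ ‖s + A • K‖ ^ 2 + ‖t + A • K‖ ^ 2 :=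
    mul_le_of_le_one_left (by positivity) (hκr ▸ mul_le_one₀ hr1 hA0.le (by linarith))
  have hκQ : κ * Q ^ 2 ≤ m / (1 + m) * Q ^ 2 :=
    mul_le_mul_of_nonneg_right (hκr ▸ mul_le_of_le_one_right hr0 (by linarith)) (sq_nonneg Q)
  have hK : m / (1 + m) * (A * ‖K‖ ^ 2) = κ * ‖K‖ ^ 2 := by rw [← hκr]; ring
  linarith [mul_nonneg hr0 (sq_nonneg Q)]

theorem ell_pos (hm : 0 < m) (s K : R3) (hQ : 0 < Q) : 0 < ell m s K Q :=
  Real.sqrt_pos.2 (by positivity)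

theorem le_ell_sq (hm : 0 < m) (s K : R3) (Q : ℝ) :
    m / (3 * (m + 1) ^ 2) * (‖s‖ ^ 2 + ‖K‖ ^ 2 + Q ^ 2) ≤ ell m s K Q ^ 2 := by
  have hK := norm_sq_le_two_mul_norm_add_sq K s
  rw [add_comm K s] at hK
  have hm' : 0 ≤ m * (‖s‖ ^ 2 + Q ^ 2) := by positivity
  rw [ell, Real.sq_sqrt (by positivity)]
  calc _ = m / (m + 1) ^ 2 * ((‖s‖ ^ 2 + ‖K‖ ^ 2 + Q ^ 2) / 3) := by field_simp
    _ ≤ m / (m + 1) ^ 2 * (‖s + K‖ ^ 2 + (m + 1) * (‖s‖ ^ 2 + Q ^ 2)) := by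
      gcongr
      linarith [sq_nonneg ‖s + K‖, sq_nonneg Q]
    _ = _ := by field_simp

theorem ell_rpow_le (hm : 0 < m) (s K : R3) {e : ℝ} (he : 0 < e)
    (h : e ^ 2 ≤ ‖s‖ ^ 2 + ‖K‖ ^ 2 + Q ^ 2) :
    ell m s K Q ^ (-(1 / 2) : ℝ) ≤
      (m / (3 * (m + 1) ^ 2)) ^ (-(1 / 4) : ℝ) * e ^ (-(1 / 2) : ℝ) := by
  set c := m / (3 * (m + 1) ^ 2)
  have hc : 0 < c := by positivity
  have hle : c ^ (1 / 2 : ℝ) * e ≤ ell m s K Q := by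
    rw [← Real.sqrt_eq_rpow]
    refine le_of_sq_le_sq ?_ (Real.sqrt_nonneg _)
    rw [mul_pow, Real.sq_sqrt hc.le]
    exact (mul_le_mul_of_nonneg_left h hc.le).trans (le_ell_sq hm s K Q)
  refine (Real.rpow_le_rpow_of_nonpos (by positivity) hle (by norm_num)).trans_eq ?_
  rw [Real.mul_rpow (by positivity) he.le, ← Real.rpow_mul hc.le]
  norm_num

variable {α : Type*} [MeasurableSpace α] {s t K : α → R3} {Q : α → ℝ}

@[fun_prop]
theorem measurable_ell (m : ℝ) (hs : Measurable s) (hK : Measurable K) (hQ : Measurable Q) :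
    Measurable fun x => ell m (s x) (K x) (Q x) := by
  unfold ell
  fun_prop

@[fun_prop]
theorem measurable_evenSymbol (m : ℝ) (hs : Measurable s) (ht : Measurable t) (hK : Measurable K)
    (hQ : Measurable Q) : Measurable fun x => evenSymbol m (s x) (t x) (K x) (Q x) := by
  unfold evenSymbol
  fun_prop

@[fun_prop]
theorem measurable_oddSymbol (m : ℝ) (hs : Measurable s) (ht : Measurable t) (hK : Measurable K) :
    Measurable fun x => oddSymbol m (s x) (t x) (K x) := by
  unfold oddSymbol
  fun_prop

end SymbolBounds

/-! ### The Schur test -/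

/-- The weighted Schur integral of a kernel `κ s t K Q` in `t`, for the weight `‖t‖² ℓ_m(t)^{1/2}`
and normalised so that the Schur test compares it with `T_diag`. -/
def schurIntegral (m : ℝ) (κ : R3 → R3 → R3 → ℝ → ℝ) (s K : R3) (Q : ℝ) : ℝ≥0∞ :=
  ENNReal.ofReal ((‖s‖ ^ 2 + Q ^ 2) * ell m s K Q ^ (-(1 / 2) : ℝ)) *
    ∫⁻ t, ENNReal.ofReal (1 / ‖t‖ ^ 2 * ell m t K Q ^ (-(1 / 2) : ℝ) * κ s t K Q)

/-- The Schur constant of a kernel, of which `Λ(m)` is a multiple for the kernel `oddKernel m`. -/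
def schurBound (m : ℝ) (κ : R3 → R3 → R3 → ℝ → ℝ) : ℝ≥0∞ :=
  ⨆ (s : R3) (K : R3) (Q : ℝ) (_ : 0 < Q), schurIntegral m κ s K Q

/-- Minus the part of `G = (even + odd)⁻¹` that is odd in each of the shifted momenta. -/
def oddKernel (m : ℝ) (s t K : R3) (Q : ℝ) : ℝ :=
  oddSymbol m s t K / (evenSymbol m s t K Q ^ 2 - oddSymbol m s t K ^ 2)

section SchurBound

variable {m Q : ℝ} {κ κ' : R3 → R3 → R3 → ℝ → ℝ}

theorem schurIntegral_le_schurBound (m : ℝ) (κ : R3 → R3 → R3 → ℝ → ℝ) (s K : R3) (hQ : 0 < Q) :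
    schurIntegral m κ s K Q ≤ schurBound m κ :=
  le_iSup_of_le s (le_iSup_of_le K (le_iSup_of_le Q (le_iSup_of_le hQ le_rfl)))

theorem schurBound_le_of_forall_le {C : ℝ≥0∞}
    (h : ∀ s K Q, 0 < Q → schurIntegral m κ s K Q ≤ C) : schurBound m κ ≤ C :=
  iSup_le fun s => iSup_le fun K => iSup_le fun Q => iSup_le fun hQ => h s K Q hQ

theorem schurBound_le_mul (hm : 0 < m) {c : ℝ} (hc : 0 ≤ c)
    (h : ∀ s t K Q, 0 < Q → κ s t K Q ≤ c * κ' s t K Q) :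
    schurBound m κ ≤ ENNReal.ofReal c * schurBound m κ' := by
  refine schurBound_le_of_forall_le fun s K Q hQ => ?_
  refine le_trans ?_ (mul_le_mul_right (schurIntegral_le_schurBound m κ' s K hQ) _)
  rw [schurIntegral, schurIntegral, mul_left_comm,
    ← lintegral_const_mul' (ENNReal.ofReal c) _ ENNReal.ofReal_ne_top]
  gcongr with t
  rw [← ENNReal.ofReal_mul hc, mul_left_comm c]
  have := ell_pos hm t K hQ
  gcongr
  exact h s t K Q hQ

theorem inv_norm_sq_mul_ell_rpow_mul_evenSymbol_inv_le (hm : 0 < m) (s t K : R3) (hQ : 0 < Q) :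
    1 / ‖t‖ ^ 2 * ell m t K Q ^ (-(1 / 2) : ℝ) * (evenSymbol m s t K Q)⁻¹ ≤
      (m / (3 * (m + 1) ^ 2)) ^ (-(1 / 4) : ℝ) * (m * (2 + m)⁻¹ / (1 + m) / 2)⁻¹ *
        (‖t‖ ^ (-(5 / 2) : ℝ) / (‖s‖ ^ 2 + ‖K‖ ^ 2 + Q ^ 2 + ‖t‖ ^ 2)) := by
  rcases eq_or_ne t 0 with rfl | ht
  · rw [norm_zero, Real.zero_rpow (by norm_num)]
    simp
  have ht0 : 0 < ‖t‖ := norm_pos_iff.2 ht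
  have hell := ell_rpow_le (Q := Q) hm t K ht0 (by linarith [sq_nonneg ‖K‖, sq_nonneg Q])
  have heven := inv_anti₀ (by positivity) (le_evenSymbol hm s t K Q)
  have hpow : 1 / ‖t‖ ^ 2 * ‖t‖ ^ (-(1 / 2) : ℝ) = ‖t‖ ^ (-(5 / 2) : ℝ) := by
    rw [one_div, ← Real.rpow_natCast, ← Real.rpow_neg ht0.le, ← Real.rpow_add ht0]
    norm_num
  have hpos := inv_pos.2 (evenSymbol_pos hm s t K hQ)
  refine (mul_le_mul (mul_le_mul_of_nonneg_left hell (by positivity)) heven hpos.le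
    (by positivity)).trans_eq ?_
  rw [← hpow]
  field_simp

theorem norm_sq_add_sq_mul_ell_rpow_le (hm : 0 < m) (s K : R3) (hQ : 0 < Q) :
    (‖s‖ ^ 2 + Q ^ 2) * ell m s K Q ^ (-(1 / 2) : ℝ) ≤ (m / (3 * (m + 1) ^ 2)) ^ (-(1 / 4) : ℝ) *
      Real.sqrt (‖s‖ ^ 2 + ‖K‖ ^ 2 + Q ^ 2) ^ (3 / 2 : ℝ) := by
  set e := Real.sqrt (‖s‖ ^ 2 + ‖K‖ ^ 2 + Q ^ 2)
  have he : e ^ 2 = ‖s‖ ^ 2 + ‖K‖ ^ 2 + Q ^ 2 := Real.sq_sqrt (by positivity)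
  have he0 : 0 < e := Real.sqrt_pos.2 (by positivity)
  have hpow : e ^ 2 * e ^ (-(1 / 2) : ℝ) = e ^ (3 / 2 : ℝ) := by
    rw [← Real.rpow_natCast, ← Real.rpow_add he0]
    norm_num
  have hpos := ell_pos hm s K hQ
  rw [← hpow, mul_left_comm]
  gcongr
  · linarith [sq_nonneg ‖K‖]
  · exact ell_rpow_le hm s K he0 he.le

theorem schurBound_evenSymbol_inv_lt_top (hm : 0 < m) :
    schurBound m (fun s t K Q => (evenSymbol m s t K Q)⁻¹) < ⊤ := by
  let C := ∫ t : R3, ‖t‖ ^ (-(5 / 2) : ℝ) / (1 + ‖t‖ ^ 2)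
  set c₁ := (m / (3 * (m + 1) ^ 2)) ^ (-(1 / 4) : ℝ)
  set c₂ := (m * (2 + m)⁻¹ / (1 + m) / 2)⁻¹
  have hc : 0 ≤ c₁ * c₂ := by positivity
  refine (schurBound_le_of_forall_le (C := ENNReal.ofReal (c₁ * (c₁ * c₂ * C)))
    fun s K Q hQ => ?_).trans_lt ENNReal.ofReal_lt_top
  set e := Real.sqrt (‖s‖ ^ 2 + ‖K‖ ^ 2 + Q ^ 2)
  have he : e ^ 2 = ‖s‖ ^ 2 + ‖K‖ ^ 2 + Q ^ 2 := Real.sq_sqrt (by positivity)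
  have he0 : 0 < e := Real.sqrt_pos.2 (by positivity)
  have hint : ∫⁻ t : R3, ENNReal.ofReal (1 / ‖t‖ ^ 2 * ell m t K Q ^ (-(1 / 2) : ℝ) *
      (evenSymbol m s t K Q)⁻¹) ≤ ENNReal.ofReal (c₁ * c₂ * (e ^ (-(3 / 2) : ℝ) * C)) := by
    have hrad := lintegral_norm_rpow_div_sq_add (volume : Measure R3) (p := 5 / 2)
      (by norm_num [finrank_euclideanSpace]) (by norm_num [finrank_euclideanSpace]) he0
    have hexp : (Module.finrank ℝ R3 : ℝ) - 2 - 5 / 2 = -(3 / 2) := by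
      norm_num [finrank_euclideanSpace]
    rw [ENNReal.ofReal_mul hc, ← hexp, ← hrad, ← lintegral_const_mul' _ _ ENNReal.ofReal_ne_top]
    gcongr with t
    rw [← ENNReal.ofReal_mul hc, he]
    exact ENNReal.ofReal_le_ofReal (inv_norm_sq_mul_ell_rpow_mul_evenSymbol_inv_le hm s t K hQ)
  have hcancel : e ^ (3 / 2 : ℝ) * e ^ (-(3 / 2) : ℝ) = 1 := by
    rw [← Real.rpow_add he0, add_neg_cancel, Real.rpow_zero]
  refine (mul_le_mul' (ENNReal.ofReal_le_ofReal (norm_sq_add_sq_mul_ell_rpow_le hm s K hQ))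
    hint).trans_eq ?_
  rw [← ENNReal.ofReal_mul (by positivity)]
  congr 1
  linear_combination (c₁ * (c₁ * c₂ * C)) * hcancel

theorem schurBound_lt_top_of_le (hm : 0 < m) {D : ℝ} (hD : 0 ≤ D)
    (h : ∀ s t K Q, 0 < Q → κ s t K Q ≤ D * (evenSymbol m s t K Q)⁻¹) : schurBound m κ < ⊤ :=
  (schurBound_le_mul hm hD h).trans_lt
    (ENNReal.mul_lt_top ENNReal.ofReal_lt_top (schurBound_evenSymbol_inv_lt_top hm))

theorem sq_evenSymbol_sub_sq_oddSymbol_pos (hm : 0 < m) (s t K : R3) (hQ : 0 < Q) :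
    0 < evenSymbol m s t K Q ^ 2 - oddSymbol m s t K ^ 2 :=
  sub_pos.2 (sq_lt_sq.2 ((abs_oddSymbol_lt hm s t K hQ).trans_le (le_abs_self _)))

theorem abs_oddKernel (hm : 0 < m) (s t K : R3) (hQ : 0 < Q) :
    |oddKernel m s t K Q| =
      |oddSymbol m s t K| / (evenSymbol m s t K Q ^ 2 - oddSymbol m s t K ^ 2) := by
  rw [oddKernel, abs_div, abs_of_pos (sq_evenSymbol_sub_sq_oddSymbol_pos hm s t K hQ)]

theorem oddKernel_swap (m : ℝ) (s t K : R3) (Q : ℝ) :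
    oddKernel m s t K Q = oddKernel m t s K Q := by
  rw [oddKernel, oddKernel, evenSymbol_swap, oddSymbol_swap]

@[fun_prop]
theorem measurable_oddKernel (m : ℝ) {α : Type*} [MeasurableSpace α] {s t K : α → R3} {Q : α → ℝ}
    (hs : Measurable s) (ht : Measurable t) (hK : Measurable K) (hQ : Measurable Q) :
    Measurable fun x => oddKernel m (s x) (t x) (K x) (Q x) := by
  unfold oddKernel
  fun_prop

theorem one_sub_inv_one_add_sq_pos (hm : 0 < m) : 0 < 1 - (1 + m)⁻¹ ^ 2 :=
  sub_pos.2 (pow_lt_one₀ (by positivity) (inv_lt_one_of_one_lt₀ (by linarith)) two_ne_zero)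

theorem div_sq_evenSymbol_sub_sq_oddSymbol_le (hm : 0 < m) {s t K : R3} (hQ : 0 < Q) {e : ℝ}
    (he : e ≤ evenSymbol m s t K Q) :
    e / (evenSymbol m s t K Q ^ 2 - oddSymbol m s t K ^ 2) ≤
      (1 - (1 + m)⁻¹ ^ 2)⁻¹ * (evenSymbol m s t K Q)⁻¹ := by
  have heven := evenSymbol_pos hm s t K hQ
  have hr := one_sub_inv_one_add_sq_pos hm
  have hodd_sq : oddSymbol m s t K ^ 2 ≤ ((1 + m)⁻¹ * evenSymbol m s t K Q) ^ 2 :=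
    sq_le_sq' (neg_le_of_abs_le (abs_oddSymbol_le hm s t K Q))
      (le_of_abs_le (abs_oddSymbol_le hm s t K Q))
  calc e / (evenSymbol m s t K Q ^ 2 - oddSymbol m s t K ^ 2)
      ≤ evenSymbol m s t K Q / ((1 - (1 + m)⁻¹ ^ 2) * evenSymbol m s t K Q ^ 2) := by
        gcongr
        linarith
    _ = _ := by field_simp

theorem abs_oddKernel_le (hm : 0 < m) (s t K : R3) (hQ : 0 < Q) :
    |oddKernel m s t K Q| ≤ (1 - (1 + m)⁻¹ ^ 2)⁻¹ * (evenSymbol m s t K Q)⁻¹ := by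
  rw [abs_oddKernel hm s t K hQ]
  exact div_sq_evenSymbol_sub_sq_oddSymbol_le hm hQ (abs_oddSymbol_lt hm s t K hQ).le

theorem lambdaIntegrand_eq (hm : 0 < m) (s t K : R3) (hQ : 0 < Q) :
    lambdaIntegrand m s K Q t =
      (1 + m) / 2 * (1 / ‖t‖ ^ 2 * ell m t K Q ^ (-(1 / 2) : ℝ) * |oddKernel m s t K Q|) := by
  have habs : |oddSymbol m s t K| =
      2 / (1 + m) * |inner ℝ (s + (2 + m)⁻¹ • K) (t + (2 + m)⁻¹ • K)| := by
    rw [oddSymbol, abs_mul, abs_of_pos (by positivity)]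
  rw [abs_oddKernel hm s t K hQ, habs]
  simp only [lambdaIntegrand, evenSymbol, oddSymbol]
  field_simp

theorem Lam_eq_schurBound (hm : 0 < m) :
    Lam m = ENNReal.ofReal (2 * Real.pi ^ 2)⁻¹ *
      schurBound m (fun s t K Q => |oddKernel m s t K Q|) := by
  simp only [Lam, schurBound, ENNReal.mul_iSup]
  refine iSup_congr fun s => iSup_congr fun K => iSup_congr fun Q => iSup_congr fun hQ => ?_
  have hs := ell_pos hm s K hQ
  simp only [lambdaIntegrand_eq hm s _ K hQ, ENNReal.ofReal_mul (p := (1 + m) / 2) (by positivity)]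
  rw [schurIntegral, lintegral_const_mul' _ _ ENNReal.ofReal_ne_top, ← mul_assoc, ← mul_assoc,
    ← ENNReal.ofReal_mul (by positivity), ← ENNReal.ofReal_mul (by positivity)]
  congr 2
  field_simp

theorem schurBound_abs_oddKernel_lt_top (hm : 0 < m) :
    schurBound m (fun s t K Q => |oddKernel m s t K Q|) < ⊤ :=
  schurBound_lt_top_of_le hm (inv_nonneg.2 (one_sub_inv_one_add_sq_pos hm).le)
    fun s t K _ hQ => abs_oddKernel_le hm s t K hQ

theorem Lam_lt_top (hm : 0 < m) : Lam m < ⊤ := by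
  rw [Lam_eq_schurBound hm]
  exact ENNReal.mul_lt_top ENNReal.ofReal_lt_top (schurBound_abs_oddKernel_lt_top hm)

end SchurBound

section Product

variable {X : Type*}

section Measurable

variable [MeasurableSpace X]

theorem measurableEmbedding_cons (n : ℕ) :
    MeasurableEmbedding fun p : X × (Fin n → X) => (Fin.cons p.1 p.2 : Fin (n + 1) → X) := by
  convert! (MeasurableEquiv.piFinSuccAbove (fun _ : Fin (n + 1) => X) 0).symm.measurableEmbedding
    using 1
  ext1 p
  simp [MeasurableEquiv.piFinSuccAbove, Fin.insertNthEquiv]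

@[fun_prop]
theorem measurable_cons {α : Type*} [MeasurableSpace α] {n : ℕ} {x : α → X} {q : α → Fin n → X}
    (hx : Measurable x) (hq : Measurable q) :
    Measurable fun a => (Fin.cons (x a) (q a) : Fin (n + 1) → X) :=
  (measurableEmbedding_cons n).measurable.comp (hx.prodMk hq)

theorem measurableEmbedding_perm {ι : Type*} (σ : Equiv.Perm ι) :
    MeasurableEmbedding fun q : ι → X => q ∘ σ :=
  (MeasurableEquiv.arrowCongr' σ.symm (.refl X)).measurableEmbedding

end Measurable

variable [MeasureSpace X] [SigmaFinite (volume : Measure X)]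

theorem measurePreserving_cons (n : ℕ) :
    MeasurePreserving fun p : X × (Fin n → X) => (Fin.cons p.1 p.2 : Fin (n + 1) → X) := by
  convert! (volume_preserving_piFinSuccAbove (fun _ : Fin (n + 1) => X) 0).symm using 1
  ext1 p
  simp [MeasurableEquiv.piFinSuccAbove, Fin.insertNthEquiv]

theorem lintegral_cons {n : ℕ} {F : (Fin (n + 1) → X) → ℝ≥0∞} (hF : Measurable F) :
    ∫⁻ q, F q = ∫⁻ q : Fin n → X, ∫⁻ x, F (Fin.cons x q) := by
  rw [← (measurePreserving_cons n).lintegral_comp hF]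
  exact lintegral_prod_symm _ (by fun_prop)

theorem measurePreserving_perm {ι : Type*} [Fintype ι] (σ : Equiv.Perm ι) :
    MeasurePreserving fun q : ι → X => q ∘ σ :=
  volume_preserving_arrowCongr' σ.symm (.refl X) (.id volume)

theorem lintegral_mul_sum_eq_card_mul {ι : Type*} [Fintype ι] {F : (ι → X) → ℝ≥0∞}
    {w : X → ℝ≥0∞} (hF : Measurable F) (hw : Measurable w)
    (hsymm : ∀ σ : Equiv.Perm ι, ∀ᵐ q, F (q ∘ σ) = F q) (j : ι) :
    ∫⁻ q, F q * ∑ i, w (q i) = Fintype.card ι * ∫⁻ q, F q * w (q j) := by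
  classical
  have heq (i : ι) : ∫⁻ q, F q * w (q i) = ∫⁻ q, F q * w (q j) := by
    rw [← (measurePreserving_perm (Equiv.swap j i)).lintegral_comp (by fun_prop)]
    refine lintegral_congr_ae ?_
    filter_upwards [hsymm (Equiv.swap j i)] with q hq
    rw [hq, Function.comp_apply, Equiv.swap_apply_right]
  simp_rw [Finset.mul_sum]
  rw [lintegral_finsetSum _ fun i _ => by fun_prop, Finset.sum_congr rfl fun i _ => heq i,
    Finset.sum_const, nsmul_eq_mul, Finset.card_univ]

end Product

section SchurTest

theorem mul_le_weighted_add (x y : ℝ) {a b : ℝ} (ha : 0 < a) (hb : 0 < b) :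
    x * y ≤ 2⁻¹ * (x ^ 2 * a * b⁻¹ + y ^ 2 * b * a⁻¹) := by
  have hsq : 0 ≤ (x * a - y * b) ^ 2 / (2 * a * b) := by positivity
  have hexpand : (x * a - y * b) ^ 2 / (2 * a * b) =
      2⁻¹ * (x ^ 2 * a * b⁻¹ + y ^ 2 * b * a⁻¹) - x * y := by
    field_simp
    ring
  linarith

theorem lintegral_lintegral_symmetrize {α : Type*} [MeasurableSpace α] {ν : Measure α} [SFinite ν]
    {R : α → α → ℝ≥0∞} (hR : Measurable R.uncurry) :
    ∫⁻ x, ∫⁻ y, 2⁻¹ * (R x y + R y x) ∂ν ∂ν = ∫⁻ x, ∫⁻ y, R x y ∂ν ∂ν := by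
  have hRx (x : α) : Measurable (R x) := hR.comp measurable_prodMk_left
  have hinv : (2⁻¹ : ℝ≥0∞) ≠ ∞ := ENNReal.inv_ne_top.2 two_ne_zero
  simp_rw [lintegral_const_mul' _ _ hinv, lintegral_add_left (hRx _)]
  rw [lintegral_add_left hR.lintegral_prod_right,
    ← lintegral_lintegral_swap hR.aemeasurable, ← two_mul, ← mul_assoc,
    ENNReal.inv_mul_cancel two_ne_zero ENNReal.ofNat_ne_top, one_mul]

theorem lintegral_lintegral_mul_le_of_symm {α : Type*} [MeasurableSpace α] {ν : Measure α}
    [SFinite ν] {f w : α → ℝ} {κ : α → α → ℝ} (hf : Measurable f) (hw : Measurable w)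
    (hκ : Measurable κ.uncurry) (hw0 : ∀ᵐ x ∂ν, 0 < w x) (hκ0 : ∀ x y, 0 ≤ κ x y)
    (hsymm : ∀ x y, κ x y = κ y x) :
    ∫⁻ x, ∫⁻ y, ENNReal.ofReal (f x * f y * κ x y) ∂ν ∂ν ≤
      ∫⁻ x, ENNReal.ofReal (f x ^ 2 * w x) *
        ∫⁻ y, ENNReal.ofReal ((w y)⁻¹ * κ x y) ∂ν ∂ν := by
  let R : α → α → ℝ≥0∞ := fun x y =>
    ENNReal.ofReal (f x ^ 2 * w x) * ENNReal.ofReal ((w y)⁻¹ * κ x y)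
  have hR : Measurable R.uncurry := by
    unfold R Function.uncurry
    fun_prop
  have hle : ∀ᵐ x ∂ν, ∀ᵐ y ∂ν,
      ENNReal.ofReal (f x * f y * κ x y) ≤ 2⁻¹ * (R x y + R y x) := by
    filter_upwards [hw0] with x hx
    filter_upwards [hw0] with y hy
    have hxy := hκ0 x y
    have htwo : (2⁻¹ : ℝ≥0∞) = ENNReal.ofReal 2⁻¹ := by
      rw [ENNReal.ofReal_inv_of_pos two_pos, ENNReal.ofReal_ofNat]
    simp only [R]
    rw [hsymm y x, ← ENNReal.ofReal_mul (by positivity), ← ENNReal.ofReal_mul (by positivity),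
      ← ENNReal.ofReal_add (by positivity) (by positivity), htwo,
      ← ENNReal.ofReal_mul (by norm_num)]
    refine ENNReal.ofReal_le_ofReal ?_
    calc f x * f y * κ x y ≤ 2⁻¹ * (f x ^ 2 * w x * (w y)⁻¹ + f y ^ 2 * w y * (w x)⁻¹) * κ x y := by
          exact mul_le_mul_of_nonneg_right (mul_le_weighted_add _ _ hx hy) hxy
      _ = _ := by ring
  calc ∫⁻ x, ∫⁻ y, ENNReal.ofReal (f x * f y * κ x y) ∂ν ∂ν
      ≤ ∫⁻ x, ∫⁻ y, 2⁻¹ * (R x y + R y x) ∂ν ∂ν :=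
        lintegral_mono_ae (hle.mono fun x hx => lintegral_mono_ae hx)
    _ = ∫⁻ x, ∫⁻ y, R x y ∂ν ∂ν := lintegral_lintegral_symmetrize hR
    _ = _ := by simp only [R, lintegral_const_mul' _ _ ENNReal.ofReal_ne_top]

variable {m μ : ℝ} {n : ℕ} {h : (Fin (n + 1) → R3) → ℂ}

-- For a symmetric density each momentum carries the same share of `∑ ‖qᵢ‖²`.
theorem mul_lintegral_zero_weight_le (hm : 0 < m) (hμ : 0 < μ) (hh : Measurable h)
    (hsymm : ∀ σ : Equiv.Perm (Fin (n + 1)), ∀ᵐ q, ‖h (q ∘ σ)‖ = ‖h q‖) :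
    ENNReal.ofReal ((n : ℝ) + 1) * ∫⁻ q, ENNReal.ofReal
        (‖h q‖ ^ 2 * L m μ q / (∑ i, ‖q i‖ ^ 2 + μ * (m + 1) / m) * ‖q 0‖ ^ 2) ≤
      ∫⁻ q, ENNReal.ofReal (‖h q‖ ^ 2 * L m μ q) := by
  let ρ : (Fin (n + 1) → R3) → ℝ := fun q =>
    ‖h q‖ ^ 2 * L m μ q / (∑ i, ‖q i‖ ^ 2 + μ * (m + 1) / m)
  have hρ (q) : 0 ≤ ρ q := by
    have := L_pos hm hμ q
    positivity
  have hsum := lintegral_mul_sum_eq_card_mul (F := fun q => ENNReal.ofReal (ρ q))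
    (w := fun x => ENNReal.ofReal (‖x‖ ^ 2)) (by fun_prop) (by fun_prop) (fun σ => by
      filter_upwards [hsymm σ] with q hq
      simp only [ρ, hq, L_perm hm, Function.comp_apply, Equiv.sum_comp σ fun i => ‖q i‖ ^ 2]) 0
  have hcard : (Fintype.card (Fin (n + 1)) : ℝ≥0∞) = ENNReal.ofReal ((n : ℝ) + 1) := by
    rw [← Nat.cast_add_one, ENNReal.ofReal_natCast, Fintype.card_fin]
  simp_rw [hcard, ← ENNReal.ofReal_mul (hρ _)] at hsum
  rw [← hsum]
  refine lintegral_mono fun q => ?_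
  have := L_pos hm hμ q
  rw [← ENNReal.ofReal_sum_of_nonneg (fun i _ => by positivity), ← ENNReal.ofReal_mul (hρ q)]
  refine ENNReal.ofReal_le_ofReal ?_
  rw [div_mul_eq_mul_div]
  refine (div_le_iff₀ (by positivity)).2 (mul_le_mul_of_nonneg_left ?_ (by positivity))
  exact le_add_of_nonneg_right (by positivity)

theorem schur_fiber_le (hm : 0 < m) {K : R3} {Q : ℝ} (hQ : 0 < Q) {f : R3 → ℝ}
    (hf : Measurable f) {κ : R3 → R3 → R3 → ℝ → ℝ}
    (hκ : Measurable fun p : R3 × R3 => κ p.1 p.2 K Q) (hκ0 : ∀ s t, 0 ≤ κ s t K Q)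
    (hκsymm : ∀ s t, κ s t K Q = κ t s K Q) :
    ∫⁻ s, ∫⁻ t, ENNReal.ofReal (f s * f t * κ s t K Q) ≤
      schurBound m κ * ∫⁻ s, ENNReal.ofReal
        (f s ^ 2 * ell m s K Q / (‖s‖ ^ 2 + Q ^ 2) * ‖s‖ ^ 2) := by
  have hell (s) : 0 < ell m s K Q := ell_pos hm s K hQ
  let w : R3 → ℝ := fun s => ‖s‖ ^ 2 * ell m s K Q ^ (1 / 2 : ℝ)
  have hw0 : ∀ᵐ s, 0 < w s := by
    filter_upwards [Measure.ae_ne volume (0 : R3)] with s hs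
    have := hell s
    have := norm_pos_iff.2 hs
    positivity
  have hwinv (t : R3) : (w t)⁻¹ = 1 / ‖t‖ ^ 2 * ell m t K Q ^ (-(1 / 2) : ℝ) := by
    simp only [w, mul_inv, Real.rpow_neg (hell t).le, one_div]
  have hsplit (s : R3) : f s ^ 2 * w s = f s ^ 2 * ell m s K Q / (‖s‖ ^ 2 + Q ^ 2) * ‖s‖ ^ 2 *
      ((‖s‖ ^ 2 + Q ^ 2) * ell m s K Q ^ (-(1 / 2) : ℝ)) := by
    have hhalf : ell m s K Q * ell m s K Q ^ (-(1 / 2) : ℝ) = ell m s K Q ^ (1 / 2 : ℝ) := by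
      rw [← Real.rpow_one_add' (hell s).le (by norm_num)]
      norm_num
    simp only [w, ← hhalf]
    field_simp
  refine (lintegral_lintegral_mul_le_of_symm (κ := fun s t => κ s t K Q) hf
    (by fun_prop : Measurable w) hκ hw0 hκ0 hκsymm).trans ?_
  rw [mul_comm, ← lintegral_mul_const _ (by fun_prop)]
  refine lintegral_mono fun s => ?_
  have := hell s
  simp only [hwinv]
  rw [hsplit, ENNReal.ofReal_mul (by positivity), mul_assoc]
  gcongr
  exact schurIntegral_le_schurBound m κ s K hQ

theorem schur_test (hm : 0 < m) (hμ : 0 < μ) {κ : R3 → R3 → R3 → ℝ → ℝ}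
    (hκ : Measurable fun p : R3 × R3 × R3 × ℝ => κ p.1 p.2.1 p.2.2.1 p.2.2.2)
    (hκ0 : ∀ s t K Q, 0 < Q → 0 ≤ κ s t K Q) (hκsymm : ∀ s t K Q, κ s t K Q = κ t s K Q)
    (hh : Measurable h)
    (hsymm : ∀ σ : Equiv.Perm (Fin (n + 1)), ∀ᵐ q, ‖h (q ∘ σ)‖ = ‖h q‖) :
    ENNReal.ofReal ((n : ℝ) + 1) * ∫⁻ p : (R3 × R3) × (Fin n → R3),
        ENNReal.ofReal (‖h (Fin.cons p.1.1 p.2)‖ * ‖h (Fin.cons p.1.2 p.2)‖ *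
          κ p.1.1 p.1.2 (∑ i, p.2 i) (effQ m μ p.2)) ≤
      ENNReal.ofReal (2 * Real.pi ^ 2)⁻¹ * schurBound m κ *
        ∫⁻ q, ENNReal.ofReal (‖h q‖ ^ 2 * L m μ q) := by
  let ρ : (Fin (n + 1) → R3) → ℝ≥0∞ := fun q => ENNReal.ofReal
    (‖h q‖ ^ 2 * L m μ q / (∑ i, ‖q i‖ ^ 2 + μ * (m + 1) / m) * ‖q 0‖ ^ 2)
  have hρ : Measurable ρ := by fun_prop
  have hκ' : Measurable fun p : (R3 × R3) × (Fin n → R3) =>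
      κ p.1.1 p.1.2 (∑ i, p.2 i) (effQ m μ p.2) :=
    hκ.comp (f := fun p : (R3 × R3) × (Fin n → R3) =>
      (p.1.1, p.1.2, ∑ i, p.2 i, effQ m μ p.2)) (by fun_prop)
  have hfiber (q : Fin n → R3) : ∫⁻ x : R3 × R3,
      ENNReal.ofReal (‖h (Fin.cons x.1 q)‖ * ‖h (Fin.cons x.2 q)‖ *
        κ x.1 x.2 (∑ i, q i) (effQ m μ q)) ≤
      ENNReal.ofReal (2 * Real.pi ^ 2)⁻¹ * schurBound m κ * ∫⁻ s, ρ (Fin.cons s q) := by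
    have hκq := hκ'.comp (measurable_prodMk_right (y := q))
    rw [Measure.volume_eq_prod, lintegral_prod _ (by fun_prop)]
    refine (schur_fiber_le hm (effQ_pos hm hμ q) (f := fun s => ‖h (Fin.cons s q)‖)
      (by fun_prop) hκq (fun s t => hκ0 s t _ _ (effQ_pos hm hμ q))
      fun s t => hκsymm s t _ _).trans_eq ?_
    rw [mul_comm (ENNReal.ofReal _), mul_assoc, ← lintegral_const_mul' _ _ ENNReal.ofReal_ne_top]
    congr 2 with s
    rw [← ENNReal.ofReal_mul (by positivity), L_cons hm hμ, effQ_sq hm hμ, Fin.sum_univ_succ]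
    simp only [Fin.cons_zero, Fin.cons_succ]
    congr 1
    field_simp
    ring
  calc _ ≤ ENNReal.ofReal ((n : ℝ) + 1) *
        (ENNReal.ofReal (2 * Real.pi ^ 2)⁻¹ * schurBound m κ * ∫⁻ q, ρ q) := by
        rw [Measure.volume_eq_prod, lintegral_prod_symm _ (by fun_prop), lintegral_cons hρ,
          ← lintegral_const_mul (ENNReal.ofReal _ * schurBound m κ) (by fun_prop)]
        exact mul_le_mul_right (lintegral_mono hfiber) _
    _ = ENNReal.ofReal (2 * Real.pi ^ 2)⁻¹ * schurBound m κ *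
        (ENNReal.ofReal ((n : ℝ) + 1) * ∫⁻ q, ρ q) := mul_left_comm _ _ _
    _ ≤ _ := by
        gcongr
        exact mul_lintegral_zero_weight_le hm hμ hh hsymm

end SchurTest

/-! ### Positivity of the even kernel -/

section Features

variable {X Y : Type*} [MeasurableSpace X] [MeasurableSpace Y] {ρ : Measure X}
  {ν : Measure Y} [SFinite ν] {f : X → ℂ} {Φ : Y → X → ℝ} {κ : X → X → ℝ}

theorem integrable_star_mul_mul_feature (hf : Measurable f)
    (hΦ : Measurable (Function.uncurry Φ)) (hΦ0 : ∀ y s, 0 ≤ Φ y s)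
    (hκ : ∀ s t, ∫⁻ y, ENNReal.ofReal (Φ y s * Φ y t) ∂ν = ENNReal.ofReal (κ s t))
    (hint : Integrable (fun p : X × X => star (f p.1) * f p.2 * (κ p.1 p.2 : ℂ)) (ρ.prod ρ)) :
    Integrable (fun z : (X × X) × Y =>
      star (f z.1.1) * f z.1.2 * ((Φ z.2 z.1.1 * Φ z.2 z.1.2 : ℝ) : ℂ)) ((ρ.prod ρ).prod ν) := by
  have hmeas : Measurable fun z : (X × X) × Y =>
      star (f z.1.1) * f z.1.2 * ((Φ z.2 z.1.1 * Φ z.2 z.1.2 : ℝ) : ℂ) := by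
    have hΦ' {g : (X × X) × Y → X} (hg : Measurable g) :
        Measurable fun z : (X × X) × Y => Φ z.2 (g z) := hΦ.comp (measurable_snd.prodMk hg)
    exact ((continuous_star.measurable.comp (hf.comp measurable_fst.fst)).mul
      (hf.comp measurable_fst.snd)).mul <| Complex.measurable_ofReal.comp <|
        (hΦ' measurable_fst.fst).mul (hΦ' measurable_fst.snd)
  refine ⟨hmeas.aestronglyMeasurable, ?_⟩
  rw [hasFiniteIntegral_iff_enorm, lintegral_prod _ hmeas.enorm.aemeasurable]
  refine lt_of_le_of_lt (lintegral_mono fun p => ?_) hint.2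
  simp only [enorm_mul (star (f p.1) * f p.2), ← ofReal_norm (Complex.ofReal _),
    Complex.norm_real, Real.norm_of_nonneg (mul_nonneg (hΦ0 _ p.1) (hΦ0 _ p.2))]
  rw [lintegral_const_mul' _ _ enorm_ne_top, hκ]
  gcongr
  exact Real.le_norm_self _

variable [SFinite ρ]

theorem integral_star_mul_mul_ofReal_mul (f : X → ℂ) (φ : X → ℝ) :
    ∫ p : X × X, star (f p.1) * f p.2 * ((φ p.1 * φ p.2 : ℝ) : ℂ) ∂ρ.prod ρ =
      (Complex.normSq (∫ t, f t * φ t ∂ρ) : ℂ) := by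
  calc ∫ p : X × X, star (f p.1) * f p.2 * ((φ p.1 * φ p.2 : ℝ) : ℂ) ∂ρ.prod ρ
      = ∫ p : X × X, (starRingEnd ℂ) (f p.1 * φ p.1) * (f p.2 * φ p.2) ∂ρ.prod ρ := by
        refine integral_congr_ae (.of_forall fun p => ?_)
        simp only [map_mul, Complex.conj_ofReal, Complex.star_def, Complex.ofReal_mul]
        ring
    _ = (starRingEnd ℂ) (∫ s, f s * φ s ∂ρ) * ∫ t, f t * φ t ∂ρ := by
        rw [integral_prod_mul (fun s => (starRingEnd ℂ) (f s * φ s)) (fun t => f t * (φ t : ℂ)),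
          integral_conj]
    _ = _ := (Complex.normSq_eq_conj_mul_self).symm

-- Integrating over `y` last turns the form into `∫ |∫ f t Φ y t dt|² dy`.
theorem re_integral_nonneg_of_feature (hf : Measurable f)
    (hΦ : Measurable (Function.uncurry Φ)) (hΦ0 : ∀ y s, 0 ≤ Φ y s) (hκ0 : ∀ s t, 0 ≤ κ s t)
    (hκ : ∀ s t, ∫⁻ y, ENNReal.ofReal (Φ y s * Φ y t) ∂ν = ENNReal.ofReal (κ s t))
    (hint : Integrable (fun p : X × X => star (f p.1) * f p.2 * (κ p.1 p.2 : ℂ)) (ρ.prod ρ)) :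
    0 ≤ (∫ p : X × X, star (f p.1) * f p.2 * (κ p.1 p.2 : ℂ) ∂ρ.prod ρ).re := by
  have hκ_eq : ∀ s t, κ s t = ∫ y, Φ y s * Φ y t ∂ν := fun s t => by
    rw [integral_eq_lintegral_of_nonneg_ae (.of_forall fun y => mul_nonneg (hΦ0 y s) (hΦ0 y t))
      ((hΦ.of_uncurry_right.mul hΦ.of_uncurry_right).aestronglyMeasurable), hκ,
      ENNReal.toReal_ofReal (hκ0 s t)]
  have hsquares : ∫ p : X × X, star (f p.1) * f p.2 * (κ p.1 p.2 : ℂ) ∂ρ.prod ρ =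
      ((∫ y, Complex.normSq (∫ t, f t * Φ y t ∂ρ) ∂ν : ℝ) : ℂ) := by
    simp_rw [hκ_eq, ← integral_complex_ofReal, ← integral_const_mul]
    rw [integral_integral_swap (integrable_star_mul_mul_feature hf hΦ hΦ0 hκ hint)]
    simp_rw [integral_star_mul_mul_ofReal_mul]
  rw [hsquares, Complex.ofReal_re]
  exact integral_nonneg fun y => Complex.normSq_nonneg _

end Features

theorem lintegral_exp_neg_mul_Ioi {a : ℝ} (ha : 0 < a) :
    ∫⁻ r in Set.Ioi (0 : ℝ), ENNReal.ofReal (Real.exp (-a * r)) = ENNReal.ofReal a⁻¹ := by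
  rw [← ofReal_integral_eq_lintegral_ofReal (integrableOn_exp_mul_Ioi (neg_lt_zero.2 ha) 0)
    (.of_forall fun r => (Real.exp_pos _).le), integral_exp_mul_Ioi (neg_lt_zero.2 ha) 0]
  simp [neg_div_neg_eq]

section Gaussian

variable {E : Type*} [NormedAddCommGroup E] [InnerProductSpace ℝ E]

/-- The features, indexed by `y = (r, v)`, that exhibit `a / (a ^ 2 - (b ⟪s, t⟫) ^ 2)` with
`a = ‖s‖ ^ 2 + ‖t‖ ^ 2 + c` as a positive semidefinite kernel. They come from
`a / (a ^ 2 - x ^ 2) = ∫₀^∞ e ^ (-a r) cosh (x r) dr` and, for fixed `r`, from the linearization of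
`‖s ± t‖ ^ 2` by a Gaussian integral over `v`. -/
def gaussFeature (b c : ℝ) (y : ℝ × E) (s : E) : ℝ :=
  Real.pi ^ (-(Module.finrank ℝ E / 4) : ℝ) * Real.exp (-(c / 2) * y.1) *
    Real.exp (-(‖y.2‖ ^ 2 / 2)) * Real.exp (-y.1 * (1 + b / 2) * ‖s‖ ^ 2) *
    Real.cosh (inner ℝ (Real.sqrt (2 * y.1 * b) • s) y.2)

theorem gaussFeature_nonneg (b c : ℝ) (y : ℝ × E) (s : E) : 0 ≤ gaussFeature b c y s := by
  have := Real.cosh_pos (inner ℝ (Real.sqrt (2 * y.1 * b) • s) y.2)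
  unfold gaussFeature
  positivity

theorem gaussFeature_mul_gaussFeature (b c r : ℝ) (v s t : E) :
    gaussFeature b c (r, v) s * gaussFeature b c (r, v) t =
      Real.pi ^ (-(Module.finrank ℝ E / 2) : ℝ) *
        Real.exp (-(c + (1 + b / 2) * (‖s‖ ^ 2 + ‖t‖ ^ 2)) * r) / 2 *
        (Real.exp (-‖v‖ ^ 2) * Real.cosh (inner ℝ (Real.sqrt (2 * r * b) • (s + t)) v) +
          Real.exp (-‖v‖ ^ 2) * Real.cosh (inner ℝ (Real.sqrt (2 * r * b) • (s - t)) v)) := by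
  have hpi : Real.pi ^ (-(Module.finrank ℝ E / 2) : ℝ) =
      Real.pi ^ (-(Module.finrank ℝ E / 4) : ℝ) * Real.pi ^ (-(Module.finrank ℝ E / 4) : ℝ) := by
    rw [← Real.rpow_add Real.pi_pos]
    ring_nf
  have hexp_r : Real.exp (-(c + (1 + b / 2) * (‖s‖ ^ 2 + ‖t‖ ^ 2)) * r) =
      Real.exp (-(c / 2) * r) * Real.exp (-(c / 2) * r) *
        (Real.exp (-r * (1 + b / 2) * ‖s‖ ^ 2) * Real.exp (-r * (1 + b / 2) * ‖t‖ ^ 2)) := by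
    simp only [← Real.exp_add]
    ring_nf
  have hexp_v : Real.exp (-‖v‖ ^ 2) =
      Real.exp (-(‖v‖ ^ 2 / 2)) * Real.exp (-(‖v‖ ^ 2 / 2)) := by
    rw [← Real.exp_add]
    ring_nf
  simp only [gaussFeature, smul_add, smul_sub, inner_add_left, inner_sub_left, Real.cosh_add,
    Real.cosh_sub, hpi, hexp_r, hexp_v]
  ring

variable [FiniteDimensional ℝ E] [MeasurableSpace E] [BorelSpace E]

theorem lintegral_exp_neg_norm_sq_add_inner (w : E) :
    ∫⁻ v : E, ENNReal.ofReal (Real.exp (-‖v‖ ^ 2 + inner ℝ w v)) =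
      ENNReal.ofReal (Real.pi ^ (Module.finrank ℝ E / 2 : ℝ) * Real.exp (‖w‖ ^ 2 / 4)) := by
  have hsquare : ∀ v : E, Real.exp (-‖v‖ ^ 2 + inner ℝ w v) =
      Real.exp (‖w‖ ^ 2 / 4) * Real.exp (-1 * ‖v + -((2⁻¹ : ℝ) • w)‖ ^ 2) := fun v => by
    rw [← Real.exp_add, ← sub_eq_add_neg, norm_sub_sq_real, inner_smul_right, norm_smul,
      real_inner_comm, Real.norm_of_nonneg (by norm_num)]
    ring_nf
  have hgauss : ∫ v : E, Real.exp (-1 * ‖v‖ ^ 2) = Real.pi ^ (Module.finrank ℝ E / 2 : ℝ) := by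
    rw [GaussianFourier.integral_rexp_neg_mul_sq_norm one_pos, div_one]
  have hgauss_int : Integrable fun v : E => Real.exp (-1 * ‖v‖ ^ 2) :=
    Integrable.of_integral_ne_zero (hgauss ▸ (by positivity))
  simp_rw [hsquare, ENNReal.ofReal_mul (Real.exp_pos _).le]
  rw [lintegral_const_mul' _ _ ENNReal.ofReal_ne_top,
    lintegral_add_right_eq_self (fun v : E => ENNReal.ofReal (Real.exp (-1 * ‖v‖ ^ 2))),
    ← ofReal_integral_eq_lintegral_ofReal hgauss_int (.of_forall fun v => (Real.exp_pos _).le),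
    hgauss, ← ENNReal.ofReal_mul (Real.exp_pos _).le, mul_comm]

theorem lintegral_exp_neg_norm_sq_mul_cosh_inner (w : E) :
    ∫⁻ v : E, ENNReal.ofReal (Real.exp (-‖v‖ ^ 2) * Real.cosh (inner ℝ w v)) =
      ENNReal.ofReal (Real.pi ^ (Module.finrank ℝ E / 2 : ℝ) * Real.exp (‖w‖ ^ 2 / 4)) := by
  have hcosh : ∀ v : E, ENNReal.ofReal (Real.exp (-‖v‖ ^ 2) * Real.cosh (inner ℝ w v)) =
      ENNReal.ofReal (1 / 2) * (ENNReal.ofReal (Real.exp (-‖v‖ ^ 2 + inner ℝ w v)) +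
        ENNReal.ofReal (Real.exp (-‖v‖ ^ 2 + inner ℝ (-w) v))) := fun v => by
    rw [← ENNReal.ofReal_add (Real.exp_pos _).le (Real.exp_pos _).le,
      ← ENNReal.ofReal_mul (by positivity), inner_neg_left, Real.exp_add, Real.exp_add,
      Real.cosh_eq]
    ring_nf
  simp_rw [hcosh]
  rw [lintegral_const_mul' _ _ ENNReal.ofReal_ne_top, lintegral_add_left (by fun_prop),
    lintegral_exp_neg_norm_sq_add_inner, lintegral_exp_neg_norm_sq_add_inner, norm_neg,
    ← ENNReal.ofReal_add (by positivity) (by positivity), ← ENNReal.ofReal_mul (by positivity)]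
  ring_nf

@[fun_prop]
theorem measurable_gaussFeature (b c : ℝ) {α : Type*} [MeasurableSpace α] {y : α → ℝ × E}
    {s : α → E} (hy : Measurable y) (hs : Measurable s) :
    Measurable fun x => gaussFeature b c (y x) (s x) := by
  unfold gaussFeature
  fun_prop

theorem lintegral_gaussFeature_mul_snd {b c r : ℝ} (hb : 0 ≤ b) (hr : 0 < r) (s t : E) :
    ∫⁻ v, ENNReal.ofReal (gaussFeature b c (r, v) s * gaussFeature b c (r, v) t) =
      ENNReal.ofReal (1 / 2) *
        (ENNReal.ofReal (Real.exp (-(‖s‖ ^ 2 + ‖t‖ ^ 2 + c - b * inner ℝ s t) * r)) +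
          ENNReal.ofReal (Real.exp (-(‖s‖ ^ 2 + ‖t‖ ^ 2 + c + b * inner ℝ s t) * r))) := by
  have hprod (v : E) := gaussFeature_mul_gaussFeature b c r v s t
  have hβ_sq : Real.sqrt (2 * r * b) ^ 2 = 2 * r * b := Real.sq_sqrt (by positivity)
  set A := Real.pi ^ (-(Module.finrank ℝ E / 2) : ℝ) *
    Real.exp (-(c + (1 + b / 2) * (‖s‖ ^ 2 + ‖t‖ ^ 2)) * r) / 2 with hA
  have hA0 : 0 ≤ A := by positivity
  have hgauss : ∀ (w : E) (e : ℝ),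
      -(c + (1 + b / 2) * (‖s‖ ^ 2 + ‖t‖ ^ 2)) * r + 2 * r * b * ‖w‖ ^ 2 / 4 = e →
      ENNReal.ofReal A * ∫⁻ v, ENNReal.ofReal
        (Real.exp (-‖v‖ ^ 2) * Real.cosh (inner ℝ (Real.sqrt (2 * r * b) • w) v)) =
        ENNReal.ofReal (1 / 2) * ENNReal.ofReal (Real.exp e) := fun w e he => by
    rw [lintegral_exp_neg_norm_sq_mul_cosh_inner, ← ENNReal.ofReal_mul hA0,
      ← ENNReal.ofReal_mul (by norm_num), ← he, hA, Real.exp_add, Real.rpow_neg Real.pi_pos.le,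
      norm_smul, mul_pow, Real.norm_eq_abs, sq_abs, hβ_sq]
    field_simp
  have hcosh0 : ∀ w v : E, 0 ≤ Real.exp (-‖v‖ ^ 2) *
      Real.cosh (inner ℝ (Real.sqrt (2 * r * b) • w) v) :=
    fun w v => mul_nonneg (Real.exp_pos _).le (Real.cosh_pos _).le
  simp_rw [hprod, ENNReal.ofReal_mul hA0,
    fun v => ENNReal.ofReal_add (hcosh0 (s + t) v) (hcosh0 (s - t) v)]
  rw [lintegral_const_mul' _ _ ENNReal.ofReal_ne_top, lintegral_add_left (by fun_prop), mul_add,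
    mul_add]
  congr 1 <;> refine hgauss _ _ ?_
  · rw [norm_add_sq_real]
    ring
  · rw [norm_sub_sq_real]
    ring

theorem lintegral_gaussFeature_mul {b c : ℝ} (hb : 0 ≤ b) {s t : E}
    (hx : |b * inner ℝ s t| < ‖s‖ ^ 2 + ‖t‖ ^ 2 + c) :
    ∫⁻ y, ENNReal.ofReal (gaussFeature b c y s * gaussFeature b c y t)
        ∂((volume.restrict (Set.Ioi (0 : ℝ))).prod (volume : Measure E)) =
      ENNReal.ofReal ((‖s‖ ^ 2 + ‖t‖ ^ 2 + c) /
        ((‖s‖ ^ 2 + ‖t‖ ^ 2 + c) ^ 2 - (b * inner ℝ s t) ^ 2)) := by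
  rw [lintegral_prod _ (by fun_prop), setLIntegral_congr_fun measurableSet_Ioi
    fun r hr => lintegral_gaussFeature_mul_snd hb hr s t]
  set a := ‖s‖ ^ 2 + ‖t‖ ^ 2 + c
  set x := b * inner ℝ s t
  obtain ⟨hx1, hx2⟩ := abs_lt.1 hx
  have hsub : 0 < a - x := by linarith
  have hadd : 0 < a + x := by linarith
  rw [lintegral_const_mul' _ _ ENNReal.ofReal_ne_top, lintegral_add_left (by fun_prop),
    lintegral_exp_neg_mul_Ioi hsub, lintegral_exp_neg_mul_Ioi hadd,
    ← ENNReal.ofReal_add (by positivity) (by positivity), ← ENNReal.ofReal_mul (by norm_num),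
    sq_sub_sq]
  congr 1
  field_simp
  ring

end Gaussian

section EvenKernel

variable {m Q : ℝ}

/-- The part of `G` that is even in each of the shifted momenta `s + AK` and `t + AK`. -/
def evenKernel (m : ℝ) (s t K : R3) (Q : ℝ) : ℝ :=
  evenSymbol m s t K Q / (evenSymbol m s t K Q ^ 2 - oddSymbol m s t K ^ 2)

theorem evenKernel_nonneg (hm : 0 < m) (s t K : R3) (hQ : 0 < Q) : 0 ≤ evenKernel m s t K Q :=
  div_nonneg (evenSymbol_pos hm s t K hQ).le (sq_evenSymbol_sub_sq_oddSymbol_pos hm s t K hQ).le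

theorem evenKernel_le (hm : 0 < m) (s t K : R3) (hQ : 0 < Q) :
    evenKernel m s t K Q ≤ (1 - (1 + m)⁻¹ ^ 2)⁻¹ * (evenSymbol m s t K Q)⁻¹ :=
  div_sq_evenSymbol_sub_sq_oddSymbol_le hm hQ le_rfl

@[fun_prop]
theorem measurable_evenKernel (m : ℝ) {α : Type*} [MeasurableSpace α] {s t K : α → R3}
    {Q : α → ℝ} (hs : Measurable s) (ht : Measurable t) (hK : Measurable K) (hQ : Measurable Q) :
    Measurable fun x => evenKernel m (s x) (t x) (K x) (Q x) := by
  unfold evenKernel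
  fun_prop

theorem re_integral_evenKernel_nonneg (hm : 0 < m) (K : R3) (hQ : 0 < Q) {f : R3 → ℂ}
    (hf : Measurable f)
    (hint : Integrable fun p : R3 × R3 =>
      star (f p.1) * f p.2 * (evenKernel m p.1 p.2 K Q : ℂ)) :
    0 ≤ (∫ p : R3 × R3, star (f p.1) * f p.2 * (evenKernel m p.1 p.2 K Q : ℂ)).re :=
  re_integral_nonneg_of_feature (ρ := volume)
    (ν := (volume.restrict (Set.Ioi (0 : ℝ))).prod (volume : Measure R3)) hf
    (Φ := fun y s => gaussFeature (2 / (1 + m)) (m / (1 + m) * (Q ^ 2 + (2 + m)⁻¹ * ‖K‖ ^ 2)) y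
      (s + (2 + m)⁻¹ • K))
    (by fun_prop) (fun y s => gaussFeature_nonneg _ _ _ _)
    (κ := fun s t => evenKernel m s t K Q) (fun s t => evenKernel_nonneg hm s t K hQ)
    (fun s t => lintegral_gaussFeature_mul (by positivity) (abs_oddSymbol_lt hm s t K hQ)) hint

end EvenKernel

/-! ### Sobolev spaces in momentum space -/

section WeightedL2

theorem integrable_norm_sq_mul_iff_of_le {X : Type*} [MeasurableSpace X] {ρ : Measure X}
    {h : X → ℂ} (hh : Measurable h) {V W : X → ℝ} (hV : Measurable V) (hV0 : ∀ x, 0 ≤ V x)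
    {c C : ℝ} (hc : 0 < c) (hC : 0 ≤ C) (hWV : ∀ x, c * W x ≤ V x) (hVW : ∀ x, V x ≤ C * W x) :
    ∫⁻ x, ‖h x‖ₑ ^ 2 * ENNReal.ofReal (W x) ∂ρ < ⊤ ↔ Integrable (fun x => ‖h x‖ ^ 2 * V x) ρ := by
  have hmono : ∀ {U₁ U₂ : X → ℝ} {D : ℝ}, 0 ≤ D → (∀ x, U₁ x ≤ D * U₂ x) →
      ∫⁻ x, ‖h x‖ₑ ^ 2 * ENNReal.ofReal (U₂ x) ∂ρ < ⊤ →
        ∫⁻ x, ‖h x‖ₑ ^ 2 * ENNReal.ofReal (U₁ x) ∂ρ < ⊤ := fun {U₁ U₂ D} hD hU hfin => by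
    refine lt_of_le_of_lt ?_ (ENNReal.mul_lt_top (a := ENNReal.ofReal D) ENNReal.ofReal_lt_top hfin)
    rw [← lintegral_const_mul' _ _ ENNReal.ofReal_ne_top]
    refine lintegral_mono fun x => ?_
    rw [mul_left_comm, ← ENNReal.ofReal_mul hD]
    gcongr
    exact hU x
  have hint : Integrable (fun x => ‖h x‖ ^ 2 * V x) ρ ↔
      ∫⁻ x, ‖h x‖ₑ ^ 2 * ENNReal.ofReal (V x) ∂ρ < ⊤ := by
    have hmeas : AEStronglyMeasurable (fun x => ‖h x‖ ^ 2 * V x) ρ :=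
      ((hh.norm.pow_const 2).mul hV).aestronglyMeasurable
    rw [Integrable, and_iff_right hmeas,
      hasFiniteIntegral_iff_ofReal (.of_forall fun x => mul_nonneg (sq_nonneg _) (hV0 x))]
    simp_rw [ENNReal.ofReal_mul (sq_nonneg _), ENNReal.ofReal_pow (norm_nonneg _), ofReal_norm]
  rw [hint]
  exact ⟨hmono hC hVW, hmono (inv_nonneg.2 hc.le) fun x => (le_inv_mul_iff₀ hc).2 (hWV x)⟩

theorem min_mul_one_add_le {a b μ S P : ℝ} (hb : 0 ≤ b) (hS : 0 ≤ S) (hP : 0 ≤ P) :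
    min a μ * (1 + S) ≤ a * S + b * P + μ := by
  have hbP : 0 ≤ b * P := by positivity
  linarith [min_le_right a μ, mul_le_mul_of_nonneg_right (min_le_left a μ) hS]

theorem le_add_mul_one_add {a b μ S P D : ℝ} (ha : 0 ≤ a) (hb : 0 ≤ b) (hμ : 0 ≤ μ) (hS : 0 ≤ S)
    (hD : 0 ≤ D) (hP : P ≤ D * S) : a * S + b * P + μ ≤ (a + b * D + μ) * (1 + S) := by
  have hbP : b * P ≤ b * (D * S) := by gcongr
  have hrest : 0 ≤ a + b * D + μ * S := by positivity
  linarith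

variable {m μ : ℝ} {k : ℕ}

theorem mem_sobolevAs_one_iff (hm : 0 < m) (hμ : 0 < μ) (w : L2 k) :
    w ∈ sobolevAs 1 k ↔ IsAntisymm w ∧ Integrable fun q => ‖hat w q‖ ^ 2 * symbol m μ q := by
  refine and_congr_right fun _ => ?_
  rw [memSobolev_iff_lintegral_hat zero_le_one]
  simp only [Real.rpow_one]
  refine integrable_norm_sq_mul_iff_of_le (measurable_hat w) (measurable_symbol m μ)
    (fun q => (symbol_pos hm hμ q).le) (c := min (m / (m + 1)) μ)
    (C := m / (m + 1) + 1 / (m + 1) * Fintype.card (Fin k) + μ) (by positivity) (by positivity)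
    (fun q => ?_) (fun q => ?_) <;> rw [symbol_eq hm]
  · exact min_mul_one_add_le (by positivity) (by positivity) (by positivity)
  · exact le_add_mul_one_add (by positivity) (by positivity) hμ.le (by positivity) (by positivity)
      (norm_sum_sq_le q)

theorem mem_sobolevAs_half_iff (hm : 0 < m) (hμ : 0 < μ) (ξ : L2 k) :
    ξ ∈ sobolevAs (1 / 2) k ↔ IsAntisymm ξ ∧ Integrable (diagIntegrand m μ ξ) := by
  refine and_congr_right fun _ => ?_
  rw [memSobolev_iff_lintegral_hat (by norm_num)]
  simp only [← Real.sqrt_eq_rpow]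
  refine integrable_norm_sq_mul_iff_of_le (measurable_hat ξ) (measurable_L m μ)
    (fun q => (L_pos hm hμ q).le) (c := 2 * Real.pi ^ 2 * Real.sqrt (min (m / (m + 1)) μ))
    (C := 2 * Real.pi ^ 2 *
      Real.sqrt (m / (m + 1) + m / (m + 1) ^ 2 * Fintype.card (Fin k) + μ))
    (by positivity) (by positivity) (fun q => ?_) (fun q => ?_) <;>
    rw [L_eq hm, mul_assoc (2 * Real.pi ^ 2), ← Real.sqrt_mul (by positivity)] <;>
    gcongr
  · exact min_mul_one_add_le (by positivity) (by positivity) (by positivity)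
  · exact le_add_mul_one_add (by positivity) (by positivity) hμ.le (by positivity) (by positivity)
      (norm_sum_sq_le q)

theorem diagIntegrand_nonneg (hm : 0 < m) (hμ : 0 < μ) (ξ : L2 k) (q : Fin k → R3) :
    0 ≤ diagIntegrand m μ ξ q :=
  mul_nonneg (by positivity) (L_pos hm hμ q).le

end WeightedL2

/-! ### The off-diagonal form -/

section ResolventKernel

variable {m Q : ℝ}

/-- `G(s, t, q)` as a function of `s`, `t`, the total momentum `K = ∑ i, q i` and the effective
spectral parameter `Q = effQ m μ q`. -/
def resolventKernel (m : ℝ) (s t K : R3) (Q : ℝ) : ℝ :=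
  (evenSymbol m s t K Q + oddSymbol m s t K)⁻¹

theorem resolventKernel_swap (m : ℝ) (s t K : R3) (Q : ℝ) :
    resolventKernel m s t K Q = resolventKernel m t s K Q := by
  rw [resolventKernel, resolventKernel, evenSymbol_swap, oddSymbol_swap]

theorem evenKernel_swap (m : ℝ) (s t K : R3) (Q : ℝ) :
    evenKernel m s t K Q = evenKernel m t s K Q := by
  rw [evenKernel, evenKernel, evenSymbol_swap, oddSymbol_swap]

@[fun_prop]
theorem measurable_resolventKernel (m : ℝ) {α : Type*} [MeasurableSpace α] {s t K : α → R3}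
    {Q : α → ℝ} (hs : Measurable s) (ht : Measurable t) (hK : Measurable K) (hQ : Measurable Q) :
    Measurable fun x => resolventKernel m (s x) (t x) (K x) (Q x) := by
  unfold resolventKernel
  fun_prop

theorem resolventKernel_eq_evenKernel_sub_oddKernel (hm : 0 < m) (s t K : R3) (hQ : 0 < Q) :
    resolventKernel m s t K Q = evenKernel m s t K Q - oddKernel m s t K Q := by
  have hadd : evenSymbol m s t K Q + oddSymbol m s t K ≠ 0 := by
    linarith [neg_lt_of_abs_lt (abs_oddSymbol_lt hm s t K hQ)]
  have hsq := (sq_evenSymbol_sub_sq_oddSymbol_pos hm s t K hQ).ne'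
  rw [resolventKernel, evenKernel, oddKernel]
  field_simp
  ring

theorem one_sub_inv_one_add_pos (hm : 0 < m) : 0 < 1 - (1 + m)⁻¹ :=
  sub_pos.2 (inv_lt_one_of_one_lt₀ (by linarith))

theorem abs_resolventKernel_le (hm : 0 < m) (s t K : R3) (hQ : 0 < Q) :
    |resolventKernel m s t K Q| ≤ (1 - (1 + m)⁻¹)⁻¹ * (evenSymbol m s t K Q)⁻¹ := by
  have hle : (1 - (1 + m)⁻¹) * evenSymbol m s t K Q ≤
      evenSymbol m s t K Q + oddSymbol m s t K := by
    linarith [neg_le_of_abs_le (abs_oddSymbol_le hm s t K Q)]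
  have hpos := mul_pos (one_sub_inv_one_add_pos hm) (evenSymbol_pos hm s t K hQ)
  rw [resolventKernel, abs_of_pos (inv_pos.2 (hpos.trans_le hle)), ← mul_inv]
  gcongr

theorem schurBound_abs_resolventKernel_lt_top (hm : 0 < m) :
    schurBound m (fun s t K Q => |resolventKernel m s t K Q|) < ⊤ :=
  schurBound_lt_top_of_le hm (inv_nonneg.2 (one_sub_inv_one_add_pos hm).le)
    fun s t K _ hQ => abs_resolventKernel_le hm s t K hQ

theorem schurBound_abs_evenKernel_lt_top (hm : 0 < m) :
    schurBound m (fun s t K Q => |evenKernel m s t K Q|) < ⊤ :=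
  schurBound_lt_top_of_le hm (inv_nonneg.2 (one_sub_inv_one_add_sq_pos hm).le)
    fun s t K _ hQ => (abs_of_nonneg (evenKernel_nonneg hm s t K hQ)).trans_le
      (evenKernel_le hm s t K hQ)

end ResolventKernel

section PairForm

variable {m μ : ℝ} {n : ℕ}

/-- The integrand of `T_off` with `G(s, t, q)` replaced by a kernel `κ s t K Q` in the total
momentum `K = ∑ i, q i` and `Q = effQ m μ q`. -/
def pairIntegrand (m μ : ℝ) (κ : R3 → R3 → R3 → ℝ → ℝ) (ξ : L2 (n + 1))
    (p : (R3 × R3) × (Fin n → R3)) : ℂ :=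
  star (hat ξ (Fin.cons p.1.1 p.2)) * hat ξ (Fin.cons p.1.2 p.2) *
    (κ p.1.1 p.1.2 (∑ i, p.2 i) (effQ m μ p.2) : ℂ)

theorem offIntegrand_eq_pairIntegrand (hm : 0 < m) (hμ : 0 < μ) (ξ : L2 (n + 1)) :
    offIntegrand m μ ξ = pairIntegrand m μ (resolventKernel m) ξ := by
  ext p
  rw [offIntegrand, pairIntegrand, G, symbol_cons_cons hm hμ, resolventKernel]

section Bound

variable {κ : R3 → R3 → R3 → ℝ → ℝ} {ξ : L2 (n + 1)} (hm : 0 < m) (hμ : 0 < μ)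
  (hκ : Measurable fun p : R3 × R3 × R3 × ℝ => κ p.1 p.2.1 p.2.2.1 p.2.2.2)
  (hsymm : ∀ s t K Q, κ s t K Q = κ t s K Q)
  (hfin : schurBound m (fun s t K Q => |κ s t K Q|) < ⊤)
  (hξ : IsAntisymm ξ) (hd : Integrable (diagIntegrand m μ ξ))

include hκ in
theorem measurable_pairIntegrand (m μ : ℝ) (ξ : L2 (n + 1)) :
    Measurable (pairIntegrand m μ κ ξ) := by
  have hfst : Measurable fun p : (R3 × R3) × (Fin n → R3) => hat ξ (Fin.cons p.1.1 p.2) := by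
    fun_prop
  have hsnd : Measurable fun p : (R3 × R3) × (Fin n → R3) => hat ξ (Fin.cons p.1.2 p.2) := by
    fun_prop
  have hargs : Measurable fun p : (R3 × R3) × (Fin n → R3) =>
      (p.1.1, p.1.2, ∑ i, p.2 i, effQ m μ p.2) := by
    fun_prop
  exact ((continuous_star.measurable.comp hfst).mul hsnd).mul
    (Complex.measurable_ofReal.comp (hκ.comp hargs))

include hm hμ hκ hsymm hξ in
theorem lintegral_enorm_pairIntegrand_le :
    ENNReal.ofReal ((n : ℝ) + 1) * ∫⁻ p, ‖pairIntegrand m μ κ ξ p‖ₑ ≤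
      ENNReal.ofReal (2 * Real.pi ^ 2)⁻¹ * schurBound m (fun s t K Q => |κ s t K Q|) *
        ∫⁻ q, ENNReal.ofReal (diagIntegrand m μ ξ q) := by
  have hschur := schur_test (κ := fun s t K Q => |κ s t K Q|) hm hμ hκ.abs
    (fun _ _ _ _ _ => abs_nonneg _) (fun s t K Q => by rw [hsymm]) (measurable_hat ξ)
    hξ.norm_hat_perm
  simpa only [pairIntegrand, ← ofReal_norm, norm_mul, norm_star, Complex.norm_real,
    Real.norm_eq_abs, diagIntegrand] using hschur

include hm hμ hκ hsymm hfin hξ hd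

theorem integrable_pairIntegrand : Integrable (pairIntegrand m μ κ ξ) := by
  refine ⟨(measurable_pairIntegrand hκ m μ ξ).aestronglyMeasurable, ?_⟩
  have hdiag := hd.2
  rw [hasFiniteIntegral_iff_ofReal (.of_forall (diagIntegrand_nonneg hm hμ ξ))] at hdiag
  have hlt := (lintegral_enorm_pairIntegrand_le hm hμ hκ hsymm hξ).trans_lt
    (ENNReal.mul_lt_top (ENNReal.mul_lt_top ENNReal.ofReal_lt_top hfin) hdiag)
  exact ENNReal.lt_top_of_mul_ne_top_right hlt.ne (ENNReal.ofReal_pos.2 (by positivity)).ne'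

theorem mul_abs_re_integral_pairIntegrand_le :
    ((n : ℝ) + 1) * |(∫ p, pairIntegrand m μ κ ξ p).re| ≤
      (ENNReal.ofReal (2 * Real.pi ^ 2)⁻¹ *
        schurBound m (fun s t K Q => |κ s t K Q|)).toReal * Tdiag m μ ξ := by
  have hd0 := diagIntegrand_nonneg hm hμ ξ
  have hT : 0 ≤ Tdiag m μ ξ := integral_nonneg hd0
  calc ((n : ℝ) + 1) * |(∫ p, pairIntegrand m μ κ ξ p).re|
      ≤ ((n : ℝ) + 1) * ∫ p, ‖pairIntegrand m μ κ ξ p‖ := by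
        gcongr
        exact (Complex.abs_re_le_norm _).trans (norm_integral_le_integral_norm _)
    _ ≤ _ := by
        refine (ENNReal.ofReal_le_ofReal_iff (by positivity)).1 ?_
        rw [ENNReal.ofReal_mul (by positivity), ENNReal.ofReal_mul ENNReal.toReal_nonneg, Tdiag,
          ENNReal.ofReal_toReal (ENNReal.mul_lt_top ENNReal.ofReal_lt_top hfin).ne,
          ofReal_integral_norm_eq_lintegral_enorm
            (integrable_pairIntegrand hm hμ hκ hsymm hfin hξ hd),
          ofReal_integral_eq_lintegral_ofReal hd (.of_forall hd0)]
        exact lintegral_enorm_pairIntegrand_le hm hμ hκ hsymm hξ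

end Bound

variable {ξ : L2 (n + 1)}

theorem integrable_offIntegrand (hm : 0 < m) (hμ : 0 < μ) (hξ : IsAntisymm ξ)
    (hd : Integrable (diagIntegrand m μ ξ)) : Integrable (offIntegrand m μ ξ) := by
  rw [offIntegrand_eq_pairIntegrand hm hμ]
  exact integrable_pairIntegrand hm hμ (by fun_prop) (resolventKernel_swap m)
    (schurBound_abs_resolventKernel_lt_top hm) hξ hd

theorem abs_Toff_le (hm : 0 < m) (hμ : 0 < μ) (hξ : IsAntisymm ξ)
    (hd : Integrable (diagIntegrand m μ ξ)) :
    |Toff m μ ξ| ≤ (ENNReal.ofReal (2 * Real.pi ^ 2)⁻¹ *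
      schurBound m (fun s t K Q => |resolventKernel m s t K Q|)).toReal * Tdiag m μ ξ := by
  rw [Toff, offIntegrand_eq_pairIntegrand hm hμ, abs_mul, abs_of_pos (by positivity)]
  exact mul_abs_re_integral_pairIntegrand_le hm hμ (by fun_prop) (resolventKernel_swap m)
    (schurBound_abs_resolventKernel_lt_top hm) hξ hd

theorem re_integral_pairIntegrand_evenKernel_nonneg (hm : 0 < m) (hμ : 0 < μ)
    (hint : Integrable (pairIntegrand m μ (evenKernel m) ξ)) :
    0 ≤ (∫ p, pairIntegrand m μ (evenKernel m) ξ p).re := by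
  rw [Measure.volume_eq_prod] at hint ⊢
  rw [integral_prod_symm _ hint]
  refine le_of_le_of_eq (integral_nonneg_of_ae ?_) (integral_re hint.integral_prod_right)
  filter_upwards [hint.prod_left_ae] with q hq
  exact re_integral_evenKernel_nonneg hm (∑ i, q i) (effQ_pos hm hμ q)
    (f := fun s => hat ξ (Fin.cons s q)) (by fun_prop) hq

theorem neg_Lam_mul_Tdiag_le_Toff (hm : 0 < m) (hμ : 0 < μ) (hξ : IsAntisymm ξ)
    (hd : Integrable (diagIntegrand m μ ξ)) :
    -(Lam m).toReal * Tdiag m μ ξ ≤ Toff m μ ξ := by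
  have heven := integrable_pairIntegrand hm hμ (by fun_prop) (evenKernel_swap m)
    (schurBound_abs_evenKernel_lt_top hm) hξ hd
  have hodd := integrable_pairIntegrand hm hμ (by fun_prop) (oddKernel_swap m)
    (schurBound_abs_oddKernel_lt_top hm) hξ hd
  have hsplit : ∀ p, offIntegrand m μ ξ p =
      pairIntegrand m μ (evenKernel m) ξ p - pairIntegrand m μ (oddKernel m) ξ p := fun p => by
    rw [offIntegrand_eq_pairIntegrand hm hμ, pairIntegrand, pairIntegrand, pairIntegrand,
      resolventKernel_eq_evenKernel_sub_oddKernel hm _ _ _ (effQ_pos hm hμ _), Complex.ofReal_sub,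
      mul_sub]
  have hodd_le := mul_abs_re_integral_pairIntegrand_le hm hμ (by fun_prop) (oddKernel_swap m)
    (schurBound_abs_oddKernel_lt_top hm) hξ hd
  rw [← Lam_eq_schurBound hm] at hodd_le
  have heven_nonneg : 0 ≤ ((n : ℝ) + 1) * (∫ p, pairIntegrand m μ (evenKernel m) ξ p).re :=
    mul_nonneg (by positivity) (re_integral_pairIntegrand_evenKernel_nonneg hm hμ heven)
  have habs : ((n : ℝ) + 1) * (∫ p, pairIntegrand m μ (oddKernel m) ξ p).re ≤ _ :=
    mul_le_mul_of_nonneg_left (le_abs_self _) (by positivity)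
  rw [Toff, integral_congr_ae (.of_forall hsplit), integral_sub heven hodd, Complex.sub_re,
    mul_sub]
  linarith

end PairForm

/-! ### Change of the spectral parameter -/

section Charge

variable {k n : ℕ}

/-- The `i`-th term of the sum in the definition of the Fourier transform of `Gξ`. -/
def chargeTerm (ξ : L2 k) (i : Fin (k + 1)) (q : Fin (k + 1) → R3) : ℂ :=
  (-1) ^ (i : ℕ) * hat ξ (i.removeNth q)

/-- The antisymmetrization of a charge `ξ`, for which `potentialHat m μ ξ = G m μ * chargeSum ξ`. -/
def chargeSum (ξ : L2 k) (q : Fin (k + 1) → R3) : ℂ := ∑ i, chargeTerm ξ i q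

theorem potentialHat_eq (m μ : ℝ) (ξ : L2 k) (q : Fin (k + 1) → R3) :
    potentialHat m μ ξ q = (G m μ q : ℂ) * chargeSum ξ q := rfl

theorem chargeTerm_zero_cons (ξ : L2 k) (x : R3) (q : Fin k → R3) :
    chargeTerm ξ 0 (Fin.cons x q) = hat ξ q := by
  have hremove : (0 : Fin (k + 1)).removeNth (Fin.cons x q : Fin (k + 1) → R3) = q := by
    ext1 j
    simp [Fin.removeNth]
  simp [chargeTerm, hremove]

theorem quasiMeasurePreserving_removeNth (i : Fin (k + 1)) :
    Measure.QuasiMeasurePreserving (fun q : Fin (k + 1) → R3 => i.removeNth q) volume volume :=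
  Measure.quasiMeasurePreserving_snd.comp
    (volume_preserving_piFinSuccAbove (fun _ : Fin (k + 1) => R3) i).quasiMeasurePreserving

@[fun_prop]
theorem measurable_chargeTerm (ξ : L2 k) (i : Fin (k + 1)) : Measurable (chargeTerm ξ i) :=
  ((measurable_hat ξ).comp (quasiMeasurePreserving_removeNth i).measurable).const_mul _

@[fun_prop]
theorem measurable_chargeSum (ξ : L2 k) : Measurable (chargeSum ξ) :=
  Finset.measurable_fun_sum _ fun i _ => measurable_chargeTerm ξ i

theorem chargeSum_sub (ξ η : L2 k) :
    chargeSum (ξ - η) =ᵐ[volume] fun q => chargeSum ξ q - chargeSum η q := by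
  filter_upwards [ae_all_iff.2 fun i =>
    (quasiMeasurePreserving_removeNth i).ae (hat_sub ξ η)] with q hq
  simp only [chargeSum, chargeTerm, ← Finset.sum_sub_distrib, ← mul_sub, hq]

theorem exists_perm_succAbove (σ : Equiv.Perm (Fin (k + 1))) (i : Fin (k + 1)) :
    ∃ τ : Equiv.Perm (Fin k), (∀ j, σ (i.succAbove j) = (σ i).succAbove (τ j)) ∧
      Equiv.Perm.sign τ = (-1) ^ (σ i : ℕ) * Equiv.Perm.sign σ * (-1) ^ (i : ℕ) := by
  let ρ : Equiv.Perm (Fin (k + 1)) := (σ i).cycleRange * σ * i.cycleRange.symm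
  have hρ0 : ρ 0 = 0 := by simp [ρ, Equiv.Perm.mul_apply, Fin.cycleRange_symm_zero]
  obtain ⟨⟨p, τ⟩, hpτ⟩ := Equiv.Perm.decomposeFin.symm.surjective ρ
  obtain rfl : p = 0 := by rw [← hρ0, ← hpτ, Equiv.Perm.decomposeFin_symm_apply_zero]
  refine ⟨τ, fun j => ?_, ?_⟩
  · have hsucc : ρ j.succ = (τ j).succ := by
      simp [← hpτ, Equiv.Perm.decomposeFin_symm_apply_succ]
    simp only [ρ, Equiv.Perm.mul_apply, Fin.cycleRange_symm_succ] at hsucc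
    rw [← Fin.cycleRange_symm_succ (σ i), ← hsucc, Equiv.symm_apply_apply]
  · have hsign : Equiv.Perm.sign ρ = Equiv.Perm.sign τ := by
      simp [← hpτ, Equiv.Perm.decomposeFin.symm_sign]
    simp only [← hsign, ρ, Equiv.Perm.sign_mul, Fin.sign_cycleRange, Equiv.Perm.sign_symm]

theorem chargeTerm_perm {ξ : L2 k} (hξ : IsAntisymm ξ) (σ : Equiv.Perm (Fin (k + 1)))
    (i : Fin (k + 1)) : ∀ᵐ q, chargeTerm ξ i (q ∘ σ) =
      ((Equiv.Perm.sign σ : ℤ) : ℂ) * chargeTerm ξ (σ i) q := by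
  obtain ⟨τ, hτ, hsign⟩ := exists_perm_succAbove σ i
  filter_upwards [(quasiMeasurePreserving_removeNth (σ i)).ae ((isAntisymm_iff_hat ξ).1 hξ τ)]
    with q hq
  have hremove : i.removeNth (q ∘ σ) = (σ i).removeNth q ∘ τ := by
    ext1 j
    simp only [Fin.removeNth, Function.comp_apply, hτ]
  have hsq : (-1 : ℂ) ^ (i : ℕ) * (-1) ^ (i : ℕ) = 1 := by simp [← mul_pow]
  rw [chargeTerm, chargeTerm, hremove, hq, hsign]
  push_cast
  linear_combination (-1) ^ (σ i : ℕ) * ((Equiv.Perm.sign σ : ℤ) : ℂ) *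
    hat ξ ((σ i).removeNth q) * hsq

theorem chargeSum_perm {ξ : L2 k} (hξ : IsAntisymm ξ) (σ : Equiv.Perm (Fin (k + 1))) :
    ∀ᵐ q, chargeSum ξ (q ∘ σ) = ((Equiv.Perm.sign σ : ℤ) : ℂ) * chargeSum ξ q := by
  filter_upwards [ae_all_iff.2 (chargeTerm_perm hξ σ)] with q hq
  simp only [chargeSum, hq]
  rw [← Finset.mul_sum, Equiv.sum_comp σ fun i => chargeTerm ξ i q]

/-- The `(i, j)` contribution to the weighted density `‖chargeSum ξ‖² V`. -/
def crossTerm (V : (Fin (k + 1) → R3) → ℝ) (ξ : L2 k) (i j : Fin (k + 1))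
    (q : Fin (k + 1) → R3) : ℂ :=
  star (chargeTerm ξ i q) * chargeTerm ξ j q * (V q : ℂ)

theorem crossTerm_self (V : (Fin (k + 1) → R3) → ℝ) (ξ : L2 k) (i : Fin (k + 1))
    (q : Fin (k + 1) → R3) :
    crossTerm V ξ i i q = ((‖chargeTerm ξ i q‖ ^ 2 * V q : ℝ) : ℂ) := by
  rw [crossTerm, Complex.star_def, Complex.conj_mul']
  push_cast
  rfl

theorem sum_crossTerm (V : (Fin (k + 1) → R3) → ℝ) (ξ : L2 k) (q : Fin (k + 1) → R3) :
    ∑ i, ∑ j, crossTerm V ξ i j q = ((‖chargeSum ξ q‖ ^ 2 * V q : ℝ) : ℂ) := by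
  push_cast
  rw [← Complex.conj_mul', ← Complex.star_def]
  simp only [chargeSum, crossTerm, star_sum, Finset.sum_mul, Finset.mul_sum]
  exact Finset.sum_comm

section Symmetric

variable {V : (Fin (k + 1) → R3) → ℝ} {ξ : L2 k}
  (hV : ∀ (σ : Equiv.Perm (Fin (k + 1))) q, V (q ∘ σ) = V q) (hξ : IsAntisymm ξ)

include hV hξ

theorem crossTerm_perm (σ : Equiv.Perm (Fin (k + 1))) (i j : Fin (k + 1)) :
    ∀ᵐ q, crossTerm V ξ i j (q ∘ σ) = crossTerm V ξ (σ i) (σ j) q := by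
  filter_upwards [chargeTerm_perm hξ σ i, chargeTerm_perm hξ σ j] with q hi hj
  have hsign : star ((Equiv.Perm.sign σ : ℤ) : ℂ) * ((Equiv.Perm.sign σ : ℤ) : ℂ) = 1 := by
    rcases Int.units_eq_one_or (Equiv.Perm.sign σ) with h | h <;> simp [h]
  rw [crossTerm, crossTerm, hi, hj, hV, star_mul']
  linear_combination star (chargeTerm ξ (σ i) q) * chargeTerm ξ (σ j) q * (V q : ℂ) * hsign

theorem integrable_crossTerm_perm (σ : Equiv.Perm (Fin (k + 1))) {i j : Fin (k + 1)}
    (h : Integrable (crossTerm V ξ i j)) : Integrable (crossTerm V ξ (σ i) (σ j)) :=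
  ((measurePreserving_perm σ).integrable_comp_of_integrable h).congr (crossTerm_perm hV hξ σ i j)

theorem integral_crossTerm_perm (σ : Equiv.Perm (Fin (k + 1))) (i j : Fin (k + 1)) :
    ∫ q, crossTerm V ξ (σ i) (σ j) q = ∫ q, crossTerm V ξ i j q := by
  rw [← integral_congr_ae (crossTerm_perm hV hξ σ i j)]
  exact (measurePreserving_perm σ).integral_comp (measurableEmbedding_perm σ) _

end Symmetric

theorem exists_perm_one_zero {i j : Fin (n + 2)} (h : i ≠ j) :
    ∃ σ : Equiv.Perm (Fin (n + 2)), σ 1 = i ∧ σ 0 = j :=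
  MulAction.is_two_pretransitive_iff.1 (Equiv.Perm.isMultiplyPretransitive (Fin (n + 2)) 2)
    one_ne_zero h

section SymmetricPair

variable {V : (Fin (n + 2) → R3) → ℝ} {ξ : L2 (n + 1)}
  (hV : ∀ (σ : Equiv.Perm (Fin (n + 2))) q, V (q ∘ σ) = V q) (hξ : IsAntisymm ξ)
  (hoff : Integrable (crossTerm V ξ 1 0))

include hV hξ hoff

theorem integrable_crossTerm_of_ne {i j : Fin (n + 2)} (hij : i ≠ j) :
    Integrable (crossTerm V ξ i j) := by
  obtain ⟨σ, rfl, rfl⟩ := exists_perm_one_zero hij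
  exact integrable_crossTerm_perm hV hξ σ hoff

theorem integrable_norm_chargeTerm_sq_of_chargeSum (hV0 : ∀ q, 0 ≤ V q) (hVm : Measurable V)
    (hsum : Integrable fun q => ‖chargeSum ξ q‖ ^ 2 * V q) :
    Integrable fun q => ‖chargeTerm ξ 0 q‖ ^ 2 * V q := by
  have hdiag_eq : ∀ q, ((‖chargeSum ξ q‖ ^ 2 * V q : ℝ) : ℂ) -
      ∑ i, ∑ j ∈ Finset.univ.erase i, crossTerm V ξ i j q =
        ((∑ i, ‖chargeTerm ξ i q‖ ^ 2 * V q : ℝ) : ℂ) := fun q => by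
    rw [← sum_crossTerm, ← Finset.sum_sub_distrib, Complex.ofReal_sum]
    refine Finset.sum_congr rfl fun i _ => ?_
    rw [← Finset.add_sum_erase _ _ (Finset.mem_univ i), add_sub_cancel_right, crossTerm_self]
  have hdiag : Integrable fun q => ∑ i, ‖chargeTerm ξ i q‖ ^ 2 * V q := by
    have hcross : Integrable fun q => ∑ i, ∑ j ∈ Finset.univ.erase i, crossTerm V ξ i j q :=
      integrable_finsetSum _ fun i _ => integrable_finsetSum _ fun j hj =>
        integrable_crossTerm_of_ne hV hξ hoff (Finset.ne_of_mem_erase hj).symm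
    exact ((hsum.ofReal.sub hcross).congr (.of_forall hdiag_eq)).re
  refine hdiag.mono' (by fun_prop) (.of_forall fun q => ?_)
  rw [Real.norm_of_nonneg (mul_nonneg (sq_nonneg _) (hV0 q))]
  exact Finset.single_le_sum (f := fun i => ‖chargeTerm ξ i q‖ ^ 2 * V q)
    (fun i _ => mul_nonneg (sq_nonneg _) (hV0 q)) (Finset.mem_univ 0)

variable (hdiag : Integrable (crossTerm V ξ 0 0))

include hdiag

theorem integrable_crossTerm (i j : Fin (n + 2)) : Integrable (crossTerm V ξ i j) := by
  rcases eq_or_ne i j with rfl | hij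
  · simpa using integrable_crossTerm_perm hV hξ (Equiv.swap 0 i) hdiag
  · exact integrable_crossTerm_of_ne hV hξ hoff hij

theorem integrable_norm_chargeSum_sq_mul : Integrable fun q => ‖chargeSum ξ q‖ ^ 2 * V q := by
  have hsum : Integrable fun q => ∑ i, ∑ j, crossTerm V ξ i j q :=
    integrable_finsetSum _ fun i _ => integrable_finsetSum _ fun j _ =>
      integrable_crossTerm hV hξ hoff hdiag i j
  simp only [sum_crossTerm] at hsum
  exact hsum.re

theorem integral_norm_chargeSum_sq_mul :
    ∫ q, ‖chargeSum ξ q‖ ^ 2 * V q = ((n : ℝ) + 2) * ((∫ q, crossTerm V ξ 0 0 q).re +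
      ((n : ℝ) + 1) * (∫ q, crossTerm V ξ 1 0 q).re) := by
  have hint := integrable_crossTerm hV hξ hoff hdiag
  have hself : ∀ i, ∫ q, crossTerm V ξ i i q = ∫ q, crossTerm V ξ 0 0 q := fun i => by
    simpa using integral_crossTerm_perm hV hξ (Equiv.swap 0 i) 0 0
  have hne : ∀ i, ∀ j ∈ Finset.univ.erase i,
      ∫ q, crossTerm V ξ i j q = ∫ q, crossTerm V ξ 1 0 q := fun i j hj => by
    obtain ⟨σ, rfl, rfl⟩ := exists_perm_one_zero (Finset.ne_of_mem_erase hj).symm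
    exact integral_crossTerm_perm hV hξ σ 1 0
  have hsum : ((∫ q, ‖chargeSum ξ q‖ ^ 2 * V q : ℝ) : ℂ) = ((n : ℝ) + 2 : ℝ) *
      ((∫ q, crossTerm V ξ 0 0 q) + ((n : ℝ) + 1 : ℝ) * ∫ q, crossTerm V ξ 1 0 q) := by
    calc ((∫ q, ‖chargeSum ξ q‖ ^ 2 * V q : ℝ) : ℂ)
        = ∑ i, ∑ j, ∫ q, crossTerm V ξ i j q := by
          simp_rw [← integral_complex_ofReal, ← sum_crossTerm]
          rw [integral_finsetSum _ fun i _ => integrable_finsetSum _ fun j _ => hint i j]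
          simp_rw [integral_finsetSum _ fun j _ => hint _ j]
      _ = ∑ _i : Fin (n + 2), ((∫ q, crossTerm V ξ 0 0 q) +
            ((n : ℝ) + 1 : ℝ) * ∫ q, crossTerm V ξ 1 0 q) := by
          refine Finset.sum_congr rfl fun i _ => ?_
          rw [← Finset.add_sum_erase _ _ (Finset.mem_univ i), hself, Finset.sum_congr rfl (hne i)]
          simp
      _ = _ := by
          rw [Finset.sum_const, Finset.card_univ, Fintype.card_fin, nsmul_eq_mul]
          push_cast
          ring
  rw [← Complex.ofReal_re (∫ q, ‖chargeSum ξ q‖ ^ 2 * V q), hsum, Complex.re_ofReal_mul,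
    Complex.add_re, Complex.re_ofReal_mul]

end SymmetricPair

theorem measurePreserving_cons_cons (n : ℕ) :
    MeasurePreserving (fun p : (R3 × R3) × (Fin n → R3) =>
      (Fin.cons p.1.1 (Fin.cons p.1.2 p.2 : Fin (n + 1) → R3) : Fin (n + 2) → R3)) :=
  (measurePreserving_cons (n + 1)).comp
    (((MeasurePreserving.id (volume : Measure R3)).prod (measurePreserving_cons n)).comp
      (measurePreserving_prodAssoc (volume : Measure R3) (volume : Measure R3)
        (volume : Measure (Fin n → R3))))

theorem measurableEmbedding_cons_cons (n : ℕ) :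
    MeasurableEmbedding (fun p : (R3 × R3) × (Fin n → R3) =>
      (Fin.cons p.1.1 (Fin.cons p.1.2 p.2 : Fin (n + 1) → R3) : Fin (n + 2) → R3)) :=
  (measurableEmbedding_cons (n + 1)).comp
    ((MeasurableEmbedding.id.prodMap (measurableEmbedding_cons n)).comp
      MeasurableEquiv.prodAssoc.measurableEmbedding)

theorem crossTerm_G_one_zero_cons_cons (m μ : ℝ) (ξ : L2 (n + 1))
    (p : (R3 × R3) × (Fin n → R3)) :
    crossTerm (G m μ) ξ 1 0 (Fin.cons p.1.1 (Fin.cons p.1.2 p.2 : Fin (n + 1) → R3)) =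
      -offIntegrand m μ ξ p := by
  have hremove : (1 : Fin (n + 2)).removeNth
      (Fin.cons p.1.1 (Fin.cons p.1.2 p.2 : Fin (n + 1) → R3) : Fin (n + 2) → R3) =
      (Fin.cons p.1.1 p.2 : Fin (n + 1) → R3) := by
    ext1 j
    refine Fin.cases ?_ (fun j => ?_) j
    · simp [Fin.removeNth]
    · simp [Fin.removeNth, Fin.one_succAbove_succ]
  rw [crossTerm, chargeTerm_zero_cons, chargeTerm, hremove, offIntegrand]
  simp

theorem integrable_crossTerm_G_one_zero_iff (m μ : ℝ) (ξ : L2 (n + 1)) :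
    Integrable (crossTerm (G m μ) ξ 1 0) ↔ Integrable (offIntegrand m μ ξ) := by
  rw [← (measurePreserving_cons_cons n).integrable_comp_emb (measurableEmbedding_cons_cons n),
    ← integrable_neg_iff (f := offIntegrand m μ ξ)]
  exact integrable_congr (.of_forall (crossTerm_G_one_zero_cons_cons m μ ξ))

theorem integral_crossTerm_G_one_zero (m μ : ℝ) (ξ : L2 (n + 1)) :
    ∫ q, crossTerm (G m μ) ξ 1 0 q = -∫ p, offIntegrand m μ ξ p := by
  rw [← (measurePreserving_cons_cons n).integral_comp (measurableEmbedding_cons_cons n),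
    ← integral_neg]
  exact integral_congr_ae (.of_forall (crossTerm_G_one_zero_cons_cons m μ ξ))

end Charge

section Resolvent

variable {m μ μ' : ℝ} {k : ℕ}

theorem symbol_eq_add (m μ μ' : ℝ) (q : Fin k → R3) :
    symbol m μ' q = symbol m μ q + (μ' - μ) := by
  simp only [symbol]
  ring

theorem G_perm (hm : 0 < m) (μ : ℝ) (σ : Equiv.Perm (Fin k)) (q : Fin k → R3) :
    G m μ (q ∘ σ) = G m μ q := by
  rw [G, G, symbol_perm hm]

theorem G_pos (hm : 0 < m) (hμ : 0 < μ) (q : Fin k → R3) : 0 < G m μ q :=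
  inv_pos.2 (symbol_pos hm hμ q)

theorem G_le_inv (hm : 0 < m) (hμ : 0 < μ) (q : Fin k → R3) : G m μ q ≤ μ⁻¹ :=
  inv_anti₀ hμ (le_symbol hm μ q)

theorem G_le_G (hm : 0 < m) (hμ : 0 < μ) (h : μ ≤ μ') (q : Fin k → R3) : G m μ' q ≤ G m μ q := by
  refine inv_anti₀ (symbol_pos hm hμ q) ?_
  rw [symbol_eq_add m μ μ']
  linarith

theorem G_sub_G_mul_symbol (hm : 0 < m) (hμ : 0 < μ) (hμ' : 0 < μ') (q : Fin k → R3) :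
    (G m μ' q - G m μ q) * symbol m μ' q = (μ - μ') * G m μ q := by
  have hs := symbol_pos hm hμ q
  have hs' := symbol_pos hm hμ' q
  rw [G, G]
  field_simp
  rw [symbol_eq_add m μ μ']
  ring

theorem integral_G_sub_G (hm : 0 < m) (hμ : 0 < μ) (hμ' : 0 < μ') (q : Fin k → R3) :
    Integrable (fun x : R3 => G m μ (Fin.cons x q : Fin (k + 1) → R3) -
        G m μ' (Fin.cons x q : Fin (k + 1) → R3)) ∧
      ∫ x : R3, (G m μ (Fin.cons x q : Fin (k + 1) → R3) -
        G m μ' (Fin.cons x q : Fin (k + 1) → R3)) = L m μ' q - L m μ q := by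
  have hL := L_pos hm hμ q
  have hL' := L_pos hm hμ' q
  have h := integral_inv_sub_inv (a := L m μ q / (2 * Real.pi ^ 2))
    (b := L m μ' q / (2 * Real.pi ^ 2)) (by positivity) (by positivity) ((m + 1)⁻¹ • ∑ i, q i)
  simp only [G, symbol_cons hm hμ, symbol_cons hm hμ']
  refine ⟨h.1, h.2.trans ?_⟩
  field_simp

theorem integral_norm_G_sub_G (hm : 0 < m) (hμ : 0 < μ) (hμ' : 0 < μ') (q : Fin k → R3) :
    ∫ x : R3, ‖G m μ (Fin.cons x q : Fin (k + 1) → R3) -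
      G m μ' (Fin.cons x q : Fin (k + 1) → R3)‖ = ‖L m μ' q - L m μ q‖ := by
  wlog h : μ ≤ μ' generalizing μ μ'
  · simp_rw [norm_sub_rev (G m μ _), norm_sub_rev (L m μ' _), this hμ' hμ (le_of_not_ge h)]
  have hG : ∀ x : R3, 0 ≤ G m μ (Fin.cons x q : Fin (k + 1) → R3) -
      G m μ' (Fin.cons x q : Fin (k + 1) → R3) := fun x => sub_nonneg.2 (G_le_G hm hμ h _)
  simp_rw [Real.norm_of_nonneg (hG _), (integral_G_sub_G hm hμ hμ' q).2]
  rw [Real.norm_of_nonneg]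
  exact (integral_G_sub_G hm hμ hμ' q).2 ▸ integral_nonneg hG

end Resolvent

section ChangeOfSpectralParameter

variable {m μ μ' : ℝ} {k n : ℕ}

section Diagonal

variable {ξ : L2 k} (hm : 0 < m) (hμ : 0 < μ) (hμ' : 0 < μ')
  (hξ : Integrable (diagIntegrand m μ ξ)) (hξ' : Integrable (diagIntegrand m μ' ξ))

include hm hμ hμ' hξ hξ'

theorem integrable_norm_chargeTerm_sq_mul_G_sub_G :
    Integrable fun q => ‖chargeTerm ξ 0 q‖ ^ 2 * (G m μ q - G m μ' q) := by
  rw [← (measurePreserving_cons k).integrable_comp_emb (measurableEmbedding_cons k)]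
  refine (integrable_prod_iff' ?_).2 ⟨.of_forall fun q => ?_, ?_⟩
  · exact Measurable.aestronglyMeasurable (by fun_prop)
  · simp only [Function.comp_def, chargeTerm_zero_cons]
    exact (integral_G_sub_G hm hμ hμ' q).1.const_mul _
  · refine (hξ'.sub hξ).norm.congr (.of_forall fun q => ?_)
    simp only [Function.comp_def, chargeTerm_zero_cons, norm_mul, integral_const_mul,
      integral_norm_G_sub_G hm hμ hμ']
    rw [Pi.sub_apply, diagIntegrand, diagIntegrand, ← mul_sub, norm_mul]

theorem integral_norm_chargeTerm_sq_mul_G_sub_G :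
    ∫ q, ‖chargeTerm ξ 0 q‖ ^ 2 * (G m μ q - G m μ' q) = Tdiag m μ' ξ - Tdiag m μ ξ := by
  have hint := integrable_norm_chargeTerm_sq_mul_G_sub_G hm hμ hμ' hξ hξ'
  rw [← (measurePreserving_cons k).integrable_comp_emb (measurableEmbedding_cons k)] at hint
  rw [← (measurePreserving_cons k).integral_comp (measurableEmbedding_cons k),
    Measure.volume_eq_prod]
  refine (integral_prod_symm _ hint).trans ?_
  rw [Tdiag, Tdiag, ← integral_sub hξ' hξ]
  refine integral_congr_ae (.of_forall fun q => ?_)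
  simp only [Function.comp_apply, chargeTerm_zero_cons, integral_const_mul,
    (integral_G_sub_G hm hμ hμ' q).2, diagIntegrand, ← mul_sub]

end Diagonal

theorem integral_norm_chargeSum_sq_mul_G_sub_G (hm : 0 < m) (hμ : 0 < μ) (hμ' : 0 < μ')
    {ξ : L2 (n + 1)} (hξ : ξ ∈ sobolevAs (1 / 2) (n + 1)) :
    Integrable (fun q => ‖chargeSum ξ q‖ ^ 2 * (G m μ q - G m μ' q)) ∧
      ∫ q, ‖chargeSum ξ q‖ ^ 2 * (G m μ q - G m μ' q) =
        ((n : ℝ) + 2) * (Tdiag m μ' ξ + Toff m μ' ξ - (Tdiag m μ ξ + Toff m μ ξ)) := by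
  have hd := ((mem_sobolevAs_half_iff hm hμ ξ).1 hξ).2
  have hd' := ((mem_sobolevAs_half_iff hm hμ' ξ).1 hξ).2
  have hoff := (integrable_crossTerm_G_one_zero_iff m μ ξ).2 (integrable_offIntegrand hm hμ hξ.1 hd)
  have hoff' :=
    (integrable_crossTerm_G_one_zero_iff m μ' ξ).2 (integrable_offIntegrand hm hμ' hξ.1 hd')
  let V : (Fin (n + 2) → R3) → ℝ := fun q => G m μ q - G m μ' q
  have hV : ∀ (σ : Equiv.Perm (Fin (n + 2))) q, V (q ∘ σ) = V q := fun σ q => by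
    simp only [V, G_perm hm]
  have hcross : ∀ i j, crossTerm V ξ i j =
      fun q => crossTerm (G m μ) ξ i j q - crossTerm (G m μ') ξ i j q := fun i j => by
    ext1 q
    simp only [crossTerm, V]
    push_cast
    ring
  have hself : crossTerm V ξ 0 0 = fun q => ((‖chargeTerm ξ 0 q‖ ^ 2 * V q : ℝ) : ℂ) :=
    funext fun q => crossTerm_self V ξ 0 q
  have hoffV : Integrable (crossTerm V ξ 1 0) := hcross 1 0 ▸ hoff.sub hoff'
  have hdiagV : Integrable (crossTerm V ξ 0 0) :=
    hself ▸ (integrable_norm_chargeTerm_sq_mul_G_sub_G hm hμ hμ' hd hd').ofReal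
  refine ⟨integrable_norm_chargeSum_sq_mul hV hξ.1 hoffV hdiagV,
    (integral_norm_chargeSum_sq_mul hV hξ.1 hoffV hdiagV).trans ?_⟩
  rw [hself, integral_complex_ofReal, Complex.ofReal_re,
    integral_norm_chargeTerm_sq_mul_G_sub_G hm hμ hμ' hd hd', hcross, integral_sub hoff hoff',
    integral_crossTerm_G_one_zero, integral_crossTerm_G_one_zero, Toff, Toff, Complex.sub_re,
    Complex.neg_re, Complex.neg_re]
  ring

theorem integrable_norm_G_sub_G_mul_chargeSum_sq_mul_symbol (hm : 0 < m) (hμ : 0 < μ)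
    (hμ' : 0 < μ') {ξ : L2 (n + 1)} (hξ : ξ ∈ sobolevAs (1 / 2) (n + 1)) :
    Integrable fun q => ‖((G m μ' q - G m μ q : ℝ) : ℂ) * chargeSum ξ q‖ ^ 2 * symbol m μ' q := by
  refine ((integral_norm_chargeSum_sq_mul_G_sub_G hm hμ' hμ hξ).1.norm.const_mul
    (|μ - μ'| * μ⁻¹)).mono' (by fun_prop) (.of_forall fun q => ?_)
  have hsymbol := symbol_pos hm hμ' q
  have hresolvent : |G m μ' q - G m μ q| * symbol m μ' q = |μ - μ'| * G m μ q := by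
    rw [← abs_of_pos hsymbol, ← abs_mul, G_sub_G_mul_symbol hm hμ hμ', abs_mul,
      abs_of_pos (G_pos hm hμ q)]
  rw [Real.norm_of_nonneg (by positivity)]
  simp only [norm_mul, norm_pow, Complex.norm_real, Real.norm_eq_abs, abs_norm]
  calc (|G m μ' q - G m μ q| * ‖chargeSum ξ q‖) ^ 2 * symbol m μ' q
      = (|G m μ' q - G m μ q| * symbol m μ' q) *
        (‖chargeSum ξ q‖ ^ 2 * |G m μ' q - G m μ q|) := by ring
    _ ≤ (|μ - μ'| * μ⁻¹) * (‖chargeSum ξ q‖ ^ 2 * |G m μ' q - G m μ q|) := by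
        rw [hresolvent]
        gcongr
        exact G_le_inv hm hμ q

theorem exists_hat_eq_G_sub_G_mul_chargeSum (hm : 0 < m) (hμ : 0 < μ) (hμ' : 0 < μ')
    {ξ : L2 (n + 1)} (hξ : ξ ∈ sobolevAs (1 / 2) (n + 1)) :
    ∃ d ∈ sobolevAs 1 (n + 2),
      hat d =ᵐ[volume] fun q => ((G m μ' q - G m μ q : ℝ) : ℂ) * chargeSum ξ q := by
  let h : (Fin (n + 2) → R3) → ℂ := fun q => ((G m μ' q - G m μ q : ℝ) : ℂ) * chargeSum ξ q
  have hmeas : Measurable h := by fun_prop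
  have hint : Integrable fun q => ‖h q‖ ^ 2 * symbol m μ' q :=
    integrable_norm_G_sub_G_mul_chargeSum_sq_mul_symbol hm hμ hμ' hξ
  have hsq : Integrable fun q => ‖h q‖ ^ 2 := by
    refine (hint.const_mul μ'⁻¹).mono' (by fun_prop) (.of_forall fun q => ?_)
    rw [Real.norm_of_nonneg (by positivity), le_inv_mul_iff₀ hμ', mul_comm]
    gcongr
    exact le_symbol hm μ' q
  obtain ⟨d, hd⟩ := exists_hat_ae_eq hmeas ((memLp_two_iff_lintegral_enorm_sq_lt_top
    hmeas.aestronglyMeasurable).1 ((memLp_two_iff_integrable_sq_norm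
      hmeas.aestronglyMeasurable).2 hsq))
  refine ⟨d, (mem_sobolevAs_one_iff hm hμ' d).2 ⟨(isAntisymm_iff_hat d).2 fun σ => ?_,
    hint.congr ?_⟩, hd⟩
  · filter_upwards [hd, (measurePreserving_perm σ).quasiMeasurePreserving.ae hd,
      chargeSum_perm hξ.1 σ] with q hq hqσ hperm
    simp only [hq, hqσ, h, hperm, G_perm hm]
    ring
  · filter_upwards [hd] with q hq
    rw [hq]

theorem sub_mem_sobolevAs {r : ℝ} {f g : L2 k} (hf : f ∈ sobolevAs r k) (hg : g ∈ sobolevAs r k) :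
    f - g ∈ sobolevAs r k := by
  refine ⟨hf.1.sub hg.1, ?_⟩
  have h := hf.2.sub hg.2
  rwa [← Lp.toTemperedDistributionCLM_apply, ← Lp.toTemperedDistributionCLM_apply, ← map_sub] at h

theorem IsDecomp.exists_isDecomp (hm : 0 < m) (hμ : 0 < μ) (hμ' : 0 < μ') {u w : L2 (n + 2)}
    {ξ : L2 (n + 1)} (h : IsDecomp m μ u w ξ) : ∃ w', IsDecomp m μ' u w' ξ := by
  obtain ⟨d, hd, hdhat⟩ := exists_hat_eq_G_sub_G_mul_chargeSum hm hμ hμ' h.2.1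
  refine ⟨w - d, sub_mem_sobolevAs h.1 hd, h.2.1, ?_⟩
  have hsub : u - w = u - (w - d) - d := by abel
  filter_upwards [hsub ▸ hat_sub (u - (w - d)) d, h.2.2, hdhat] with q hq hw hdq
  rw [hw, hdq, potentialHat_eq] at hq
  rw [potentialHat_eq]
  push_cast at hq
  linear_combination -hq

theorem norm_sub_G_mul_sq_mul_symbol_sub (hm : 0 < m) (hμ : 0 < μ) (q : Fin k → R3) (z c : ℂ) :
    ‖z - G m μ q * c‖ ^ 2 * symbol m μ q - μ * ‖z‖ ^ 2 =
      ‖z‖ ^ 2 * symbol m 0 q - 2 * (z * star c).re + ‖c‖ ^ 2 * G m μ q := by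
  have hG : G m μ q * symbol m μ q = 1 := inv_mul_cancel₀ (symbol_pos hm hμ q).ne'
  have hexpand : ‖z - G m μ q * c‖ ^ 2 =
      ‖z‖ ^ 2 - 2 * G m μ q * (z * star c).re + G m μ q ^ 2 * ‖c‖ ^ 2 := by
    simp only [← Complex.normSq_eq_norm_sq]
    rw [Complex.normSq_sub, Complex.normSq_mul, map_mul, Complex.conj_ofReal,
      Complex.normSq_ofReal, mul_left_comm, Complex.re_ofReal_mul, Complex.star_def]
    ring
  rw [hexpand]
  linear_combination ‖z‖ ^ 2 * symbol_eq_add m 0 μ q +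
    (G m μ q * ‖c‖ ^ 2 - 2 * (z * star c).re) * hG

theorem IsDecomp.formValue_eq (hm : 0 < m) (hμ : 0 < μ) (hμ' : 0 < μ') {u w w' : L2 (n + 2)}
    {ξ : L2 (n + 1)} (h : IsDecomp m μ u w ξ) (h' : IsDecomp m μ' u w' ξ) (α : ℝ) :
    formValue m μ α u w ξ = formValue m μ' α u w' ξ := by
  have hdensity : ∀ {ν x}, 0 < ν → IsDecomp m ν u x ξ → ∀ᵐ q,
      ‖hat x q‖ ^ 2 * symbol m ν q - ν * ‖hat u q‖ ^ 2 = ‖hat u q‖ ^ 2 * symbol m 0 q -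
        2 * (hat u q * star (chargeSum ξ q)).re + ‖chargeSum ξ q‖ ^ 2 * G m ν q :=
    fun {ν x} hν hx => by
      filter_upwards [hat_sub u x, hx.2.2] with q hq hpot
      rw [hpot, potentialHat_eq] at hq
      rw [← norm_sub_G_mul_sq_mul_symbol_sub hm hν, hq, sub_sub_cancel]
  have hint : ∀ {ν x}, 0 < ν → IsDecomp m ν u x ξ →
      Integrable (fun q => ‖hat x q‖ ^ 2 * symbol m ν q - ν * ‖hat u q‖ ^ 2) ∧
        ∫ q, (‖hat x q‖ ^ 2 * symbol m ν q - ν * ‖hat u q‖ ^ 2) =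
          (∫ q, ‖hat x q‖ ^ 2 * symbol m ν q) - ν * ‖u‖ ^ 2 := fun {ν x} hν hx => by
    have hx := ((mem_sobolevAs_one_iff hm hν x).1 hx.1).2
    have hu := (integrable_norm_hat_sq u).const_mul ν
    exact ⟨hx.sub hu, by rw [integral_sub hx hu, integral_const_mul, integral_norm_hat_sq]⟩
  have hdiff : ∫ q, ‖chargeSum ξ q‖ ^ 2 * (G m μ q - G m μ' q) =
      ((∫ q, ‖hat w q‖ ^ 2 * symbol m μ q) - μ * ‖u‖ ^ 2) -
        ((∫ q, ‖hat w' q‖ ^ 2 * symbol m μ' q) - μ' * ‖u‖ ^ 2) := by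
    rw [← (hint hμ h).2, ← (hint hμ' h').2, ← integral_sub (hint hμ h).1 (hint hμ' h').1]
    refine integral_congr_ae ?_
    filter_upwards [hdensity hμ h, hdensity hμ' h'] with q hq hq'
    rw [hq, hq']
    ring
  rw [(integral_norm_chargeSum_sq_mul_G_sub_G hm hμ hμ' h.2.1).2] at hdiff
  rw [formValue, formValue]
  linarith

end ChangeOfSpectralParameter

section Uniqueness

variable {m μ μ' : ℝ} {k n : ℕ}

theorem IsDecomp.sub {u w u' w' : L2 (n + 2)} {ξ ξ' : L2 (n + 1)}
    (h : IsDecomp m μ u w ξ) (h' : IsDecomp m μ u' w' ξ') :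
    IsDecomp m μ (u - u') (w - w') (ξ - ξ') := by
  refine ⟨sub_mem_sobolevAs h.1 h'.1, sub_mem_sobolevAs h.2.1 h'.2.1, ?_⟩
  rw [sub_sub_sub_comm]
  filter_upwards [hat_sub (u - w) (u' - w'), h.2.2, h'.2.2, chargeSum_sub ξ ξ'] with
    q hsub hq hq' hcharge
  rw [hsub, hq, hq', potentialHat_eq, potentialHat_eq, potentialHat_eq, hcharge, mul_sub]

-- Integrating out the momentum that the charge does not see gives `∫ G dx = ∞`.
theorem eq_zero_of_integrable_chargeTerm (hm : 0 < m) (hμ : 0 < μ) {ξ : L2 k}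
    (h : Integrable fun q => ‖chargeTerm ξ 0 q‖ ^ 2 * G m μ q) : ξ = 0 := by
  have hfin := h.2
  rw [hasFiniteIntegral_iff_ofReal (.of_forall fun q =>
    mul_nonneg (sq_nonneg _) (G_pos hm hμ q).le), lintegral_cons (by fun_prop)] at hfin
  have hslice : ∀ q : Fin k → R3, ∫⁻ x : R3, ENNReal.ofReal
      (‖chargeTerm ξ 0 (Fin.cons x q)‖ ^ 2 * G m μ (Fin.cons x q : Fin (k + 1) → R3)) =
      ‖hat ξ q‖ₑ ^ 2 * ⊤ := fun q => by
    have hL := L_pos hm hμ q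
    simp only [chargeTerm_zero_cons, ENNReal.ofReal_mul (sq_nonneg ‖hat ξ q‖), G,
      symbol_cons hm hμ]
    rw [lintegral_const_mul' _ _ ENNReal.ofReal_ne_top,
      lintegral_inv_norm_add_sq_add (by positivity), ENNReal.ofReal_pow (norm_nonneg _),
      ofReal_norm]
  simp_rw [hslice] at hfin
  rw [lintegral_mul_const _ (by fun_prop), lintegral_enorm_hat_sq] at hfin
  by_contra hne
  exact hfin.ne (ENNReal.mul_top (pow_ne_zero 2 (enorm_ne_zero.2 hne)))

theorem IsDecomp.eq_zero (hm : 0 < m) (hμ : 0 < μ) {w : L2 (n + 2)} {ξ : L2 (n + 1)}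
    (h : IsDecomp m μ 0 w ξ) : w = 0 ∧ ξ = 0 := by
  obtain ⟨hw, hξ, hpot⟩ := h
  have hw_int := ((mem_sobolevAs_one_iff hm hμ w).1 hw).2
  have hd := ((mem_sobolevAs_half_iff hm hμ ξ).1 hξ).2
  have hoff := (integrable_crossTerm_G_one_zero_iff m μ ξ).2 (integrable_offIntegrand hm hμ hξ.1 hd)
  have hzero : hat (0 : L2 (n + 2)) =ᵐ[volume] 0 := by
    filter_upwards [hat_sub (0 : L2 (n + 2)) 0] with q hq
    simpa using hq
  have hhat : ∀ᵐ q, hat w q = -((G m μ q : ℂ) * chargeSum ξ q) := by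
    filter_upwards [hpot, hat_sub 0 w, hzero] with q hq hsub h0
    rw [← potentialHat_eq, ← hq, hsub, h0, Pi.zero_apply, zero_sub, neg_neg]
  have hsum : Integrable fun q => ‖chargeSum ξ q‖ ^ 2 * G m μ q := by
    refine hw_int.congr ?_
    filter_upwards [hhat] with q hq
    have hs := symbol_pos hm hμ q
    rw [hq, norm_neg, norm_mul, Complex.norm_real, Real.norm_of_nonneg (G_pos hm hμ q).le, G]
    field_simp
  have hξ0 : ξ = 0 := eq_zero_of_integrable_chargeTerm hm hμ
    (integrable_norm_chargeTerm_sq_of_chargeSum (fun σ q => G_perm hm μ σ q) hξ.1 hoff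
      (fun q => (G_pos hm hμ q).le) (measurable_G m μ) hsum)
  refine ⟨eq_of_hat_ae_eq ?_, hξ0⟩
  filter_upwards [hhat, hzero, chargeSum_sub ξ ξ] with q hq h0 hcharge
  rw [sub_self, ← hξ0, sub_self] at hcharge
  rw [hq, hcharge, h0, mul_zero, neg_zero, Pi.zero_apply]

theorem IsDecomp.unique (hm : 0 < m) (hμ : 0 < μ) {u w w' : L2 (n + 2)} {ξ ξ' : L2 (n + 1)}
    (h : IsDecomp m μ u w ξ) (h' : IsDecomp m μ u w' ξ') : w = w' ∧ ξ = ξ' := by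
  have hsub := h.sub h'
  rw [sub_self] at hsub
  exact (hsub.eq_zero hm hμ).imp sub_eq_zero.1 sub_eq_zero.1

theorem IsDecomp.form_eq (hm : 0 < m) (hμ : 0 < μ) (hμ' : 0 < μ') (α : ℝ) {u w : L2 (n + 2)}
    {ξ : L2 (n + 1)} (h : IsDecomp m μ' u w ξ) : form m μ α u = formValue m μ' α u w ξ := by
  obtain ⟨w', h'⟩ := h.exists_isDecomp hm hμ' hμ
  have hex : ∃ p : L2 (n + 2) × L2 (n + 1), IsDecomp m μ u p.1 p.2 := ⟨(w', ξ), h'⟩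
  obtain ⟨hw, hξ⟩ := hex.choose_spec.unique hm hμ h'
  rw [form, dif_pos hex, hw, hξ, h'.formValue_eq hm hμ hμ' h]

end Uniqueness

/-! ### Closedness and lower bounds -/

section WeightedCompleteness

variable {k : ℕ} {W : (Fin k → R3) → ℝ}

theorem mul_norm_sq_le_integral_norm_hat_sq_mul {c : ℝ} (hc : ∀ q, c ≤ W q) {f : L2 k}
    (hf : Integrable fun q => ‖hat f q‖ ^ 2 * W q) :
    c * ‖f‖ ^ 2 ≤ ∫ q, ‖hat f q‖ ^ 2 * W q := by
  rw [← integral_norm_hat_sq, ← integral_const_mul]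
  refine integral_mono ((integrable_norm_hat_sq f).const_mul c) hf fun q => ?_
  dsimp only
  rw [mul_comm]
  gcongr
  exact hc q

theorem integral_norm_hat_sq_mul_le_of_tendsto (hW : Measurable W) (hW0 : ∀ q, 0 ≤ W q)
    {f : ℕ → L2 k} {g : L2 k} (hf : Tendsto f atTop (𝓝 g)) {B : ℝ} (hB : 0 ≤ B)
    (hint : ∀ᶠ i in atTop, Integrable fun q => ‖hat (f i) q‖ ^ 2 * W q)
    (hle : ∀ᶠ i in atTop, ∫ q, ‖hat (f i) q‖ ^ 2 * W q ≤ B) :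
    Integrable (fun q => ‖hat g q‖ ^ 2 * W q) ∧ ∫ q, ‖hat g q‖ ^ 2 * W q ≤ B := by
  have hpos : ∀ (h : L2 k) q, 0 ≤ ‖hat h q‖ ^ 2 * W q := fun h q =>
    mul_nonneg (sq_nonneg _) (hW0 q)
  have hmeas : ∀ h : L2 k, Measurable fun q => ‖hat h q‖ ^ 2 * W q := fun h => by fun_prop
  obtain ⟨ns, hns, hae⟩ := exists_subseq_tendsto_hat hf
  have hfatou : ∫⁻ q, ENNReal.ofReal (‖hat g q‖ ^ 2 * W q) ≤ ENNReal.ofReal B :=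
    calc ∫⁻ q, ENNReal.ofReal (‖hat g q‖ ^ 2 * W q)
        = ∫⁻ q, liminf (fun j => ENNReal.ofReal (‖hat (f (ns j)) q‖ ^ 2 * W q)) atTop := by
          refine lintegral_congr_ae ?_
          filter_upwards [hae] with q hq
          refine (Tendsto.liminf_eq ?_).symm
          exact (ENNReal.continuous_ofReal.tendsto _).comp ((hq.norm.pow 2).mul_const _)
      _ ≤ liminf (fun j => ∫⁻ q, ENNReal.ofReal (‖hat (f (ns j)) q‖ ^ 2 * W q)) atTop :=
          lintegral_liminf_le fun j => (hmeas _).ennreal_ofReal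
      _ ≤ ENNReal.ofReal B := by
          refine liminf_le_of_frequently_le' (Eventually.frequently ?_)
          filter_upwards [hns.tendsto_atTop.eventually hint, hns.tendsto_atTop.eventually hle]
            with j hj hjB
          rw [← ofReal_integral_eq_lintegral_ofReal hj (.of_forall (hpos _))]
          exact ENNReal.ofReal_le_ofReal hjB
  refine ⟨⟨(hmeas g).aestronglyMeasurable, ?_⟩, ?_⟩
  · rw [hasFiniteIntegral_iff_ofReal (.of_forall (hpos g))]
    exact hfatou.trans_lt ENNReal.ofReal_lt_top
  · rw [integral_eq_lintegral_of_nonneg_ae (.of_forall (hpos g)) (hmeas g).aestronglyMeasurable]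
    exact ENNReal.toReal_le_of_le_ofReal hB hfatou

variable {c : ℝ} (hc0 : 0 < c) (hc : ∀ q, c ≤ W q) {f : ℕ → L2 k}
  (hf : ∀ i j, Integrable fun q => ‖hat (f i - f j) q‖ ^ 2 * W q)
  (hlim : Tendsto (fun p : ℕ × ℕ => ∫ q, ‖hat (f p.1 - f p.2) q‖ ^ 2 * W q) atTop (𝓝 0))

include hc0 hc hf hlim

theorem cauchySeq_of_tendsto_integral_norm_hat_sub_sq_mul : CauchySeq f := by
  rw [cauchySeq_iff_tendsto_dist_atTop_0]
  have hsqrt : Tendsto (fun p : ℕ × ℕ =>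
      Real.sqrt (c⁻¹ * ∫ q, ‖hat (f p.1 - f p.2) q‖ ^ 2 * W q)) atTop (𝓝 0) := by
    simpa using (hlim.const_mul c⁻¹).sqrt
  refine squeeze_zero (fun _ => dist_nonneg) (fun p => ?_) hsqrt
  rw [dist_eq_norm]
  refine Real.le_sqrt_of_sq_le ?_
  rw [le_inv_mul_iff₀ hc0]
  exact mul_norm_sq_le_integral_norm_hat_sq_mul hc (hf _ _)

theorem exists_tendsto_integral_norm_hat_sub_sq_mul (hW : Measurable W) :
    ∃ g, Tendsto f atTop (𝓝 g) ∧
      (∀ᶠ i in atTop, Integrable fun q => ‖hat (f i - g) q‖ ^ 2 * W q) ∧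
      Tendsto (fun i => ∫ q, ‖hat (f i - g) q‖ ^ 2 * W q) atTop (𝓝 0) := by
  have hW0 : ∀ q, 0 ≤ W q := fun q => hc0.le.trans (hc q)
  obtain ⟨g, hg⟩ := cauchySeq_tendsto_of_complete
    (cauchySeq_of_tendsto_integral_norm_hat_sub_sq_mul hc0 hc hf hlim)
  have hbound : ∀ ε : ℝ, 0 < ε → ∀ᶠ i in atTop,
      Integrable (fun q => ‖hat (f i - g) q‖ ^ 2 * W q) ∧
        ∫ q, ‖hat (f i - g) q‖ ^ 2 * W q ≤ ε := fun ε hε => by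
    have hsmall := hlim.eventually (eventually_le_nhds hε)
    rw [← prod_atTop_atTop_eq] at hsmall
    filter_upwards [hsmall.curry] with i hi
    exact integral_norm_hat_sq_mul_le_of_tendsto hW hW0 (tendsto_const_nhds.sub hg) hε.le
      (.of_forall (hf i)) hi
  refine ⟨g, hg, (hbound 1 one_pos).mono fun i hi => hi.1, Metric.tendsto_nhds.2 fun ε hε => ?_⟩
  filter_upwards [hbound (ε / 2) (by positivity)] with i hi
  rw [Real.dist_eq, sub_zero,
    abs_of_nonneg (integral_nonneg fun q => mul_nonneg (sq_nonneg _) (hW0 q))]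
  exact hi.2.trans_lt (half_lt_self hε)

end WeightedCompleteness

section SobolevCompleteness

variable {m μ : ℝ} {k : ℕ}

theorem exists_mem_sobolevAs_tendsto {r : ℝ} {W : (Fin k → R3) → ℝ} (hW : Measurable W) {c : ℝ}
    (hc0 : 0 < c) (hc : ∀ q, c ≤ W q)
    (hmem : ∀ g : L2 k,
      g ∈ sobolevAs r k ↔ IsAntisymm g ∧ Integrable fun q => ‖hat g q‖ ^ 2 * W q)
    {f : ℕ → L2 k} (hf : ∀ i, f i ∈ sobolevAs r k)
    (hlim : Tendsto (fun p : ℕ × ℕ => ∫ q, ‖hat (f p.1 - f p.2) q‖ ^ 2 * W q) atTop (𝓝 0)) :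
    ∃ g ∈ sobolevAs r k, Tendsto f atTop (𝓝 g) ∧
      Tendsto (fun i => ∫ q, ‖hat (f i - g) q‖ ^ 2 * W q) atTop (𝓝 0) := by
  obtain ⟨g, hg, hint, hg0⟩ := exists_tendsto_integral_norm_hat_sub_sq_mul hc0 hc
    (fun i j => ((hmem _).1 (sub_mem_sobolevAs (hf i) (hf j))).2) hlim hW
  have hgas : IsAntisymm g :=
    (isClosed_isAntisymm k).mem_of_tendsto hg (.of_forall fun i => (hf i).1)
  obtain ⟨i, hi⟩ := hint.exists
  have hgi := sub_mem_sobolevAs (hf i) ((hmem (f i - g)).2 ⟨(hf i).1.sub hgas, hi⟩)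
  rw [sub_sub_cancel] at hgi
  exact ⟨g, hgi, hg, hg0⟩

theorem exists_mem_sobolevAs_one_tendsto (hm : 0 < m) (hμ : 0 < μ) {w : ℕ → L2 k}
    (hw : ∀ i, w i ∈ sobolevAs 1 k)
    (hlim : Tendsto (fun p : ℕ × ℕ => ∫ q, ‖hat (w p.1 - w p.2) q‖ ^ 2 * symbol m μ q)
      atTop (𝓝 0)) :
    ∃ x ∈ sobolevAs 1 k, Tendsto w atTop (𝓝 x) ∧
      Tendsto (fun i => ∫ q, ‖hat (w i - x) q‖ ^ 2 * symbol m μ q) atTop (𝓝 0) :=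
  exists_mem_sobolevAs_tendsto (measurable_symbol m μ) hμ (le_symbol hm μ)
    (mem_sobolevAs_one_iff hm hμ) hw hlim

theorem exists_mem_sobolevAs_half_tendsto (hm : 0 < m) (hμ : 0 < μ) {ξ : ℕ → L2 k}
    (hξ : ∀ i, ξ i ∈ sobolevAs (1 / 2) k)
    (hlim : Tendsto (fun p : ℕ × ℕ => Tdiag m μ (ξ p.1 - ξ p.2)) atTop (𝓝 0)) :
    ∃ ζ ∈ sobolevAs (1 / 2) k, Tendsto ξ atTop (𝓝 ζ) ∧
      Tendsto (fun i => Tdiag m μ (ξ i - ζ)) atTop (𝓝 0) :=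
  exists_mem_sobolevAs_tendsto (measurable_L m μ)
    (show 0 < 2 * Real.pi ^ 2 * Real.sqrt μ by positivity) (sqrt_le_L hm μ)
    (mem_sobolevAs_half_iff hm hμ) hξ hlim

end SobolevCompleteness

section LowerBound

variable {m μ μ' α : ℝ} {k n : ℕ}

theorem one_sub_toReal_Lam_pos (hΛ : Lam m < 1) : 0 < 1 - (Lam m).toReal := by
  rw [sub_pos, ← ENNReal.toReal_one]
  exact (ENNReal.toReal_lt_toReal hΛ.ne_top ENNReal.one_ne_top).2 hΛ

variable (hm : 0 < m) (hμ : 0 < μ)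

include hm

theorem sqrt_mul_norm_sq_le_Tdiag {ξ : L2 k} (hd : Integrable (diagIntegrand m μ ξ)) :
    2 * Real.pi ^ 2 * Real.sqrt μ * ‖ξ‖ ^ 2 ≤ Tdiag m μ ξ :=
  mul_norm_sq_le_integral_norm_hat_sq_mul (sqrt_le_L hm μ) hd

include hμ

theorem integral_norm_hat_sq_mul_symbol_nonneg (w : L2 k) :
    0 ≤ ∫ q, ‖hat w q‖ ^ 2 * symbol m μ q :=
  integral_nonneg fun q => mul_nonneg (sq_nonneg _) (symbol_pos hm hμ q).le

theorem Tdiag_nonneg (ξ : L2 k) : 0 ≤ Tdiag m μ ξ :=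
  integral_nonneg (diagIntegrand_nonneg hm hμ ξ)

theorem IsDecomp.le_formValue {u w : L2 (n + 2)} {ξ : L2 (n + 1)} (h : IsDecomp m μ u w ξ) :
    (∫ q, ‖hat w q‖ ^ 2 * symbol m μ q) - μ * ‖u‖ ^ 2
      + ((n : ℝ) + 2) * (α * ‖ξ‖ ^ 2 + (1 - (Lam m).toReal) * Tdiag m μ ξ)
      ≤ formValue m μ α u w ξ := by
  obtain ⟨hξ, hd⟩ := (mem_sobolevAs_half_iff hm hμ ξ).1 h.2.1
  have hcharge : α * ‖ξ‖ ^ 2 + (1 - (Lam m).toReal) * Tdiag m μ ξ ≤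
      α * ‖ξ‖ ^ 2 + Tdiag m μ ξ + Toff m μ ξ := by
    linarith [neg_Lam_mul_Tdiag_le_Toff hm hμ hξ hd]
  rw [formValue]
  gcongr

theorem neg_mul_norm_sq_le_form (hμ' : 0 < μ') (hΛ : Lam m < 1)
    (hα : 0 ≤ α + 2 * Real.pi ^ 2 * (1 - (Lam m).toReal) * Real.sqrt μ') {u : L2 (n + 2)}
    (hu : u ∈ formDomain m μ n) : -μ' * ‖u‖ ^ 2 ≤ form m μ α u := by
  obtain ⟨-, w, ξ, h⟩ := hu
  obtain ⟨w', h'⟩ := h.exists_isDecomp hm hμ hμ'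
  have hδ := one_sub_toReal_Lam_pos hΛ
  have hcharge : 0 ≤ α * ‖ξ‖ ^ 2 + (1 - (Lam m).toReal) * Tdiag m μ' ξ :=
    calc 0 ≤ (α + 2 * Real.pi ^ 2 * (1 - (Lam m).toReal) * Real.sqrt μ') * ‖ξ‖ ^ 2 := by positivity
      _ = α * ‖ξ‖ ^ 2 +
          (1 - (Lam m).toReal) * (2 * Real.pi ^ 2 * Real.sqrt μ' * ‖ξ‖ ^ 2) := by ring
      _ ≤ α * ‖ξ‖ ^ 2 + (1 - (Lam m).toReal) * Tdiag m μ' ξ := by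
        gcongr
        exact sqrt_mul_norm_sq_le_Tdiag hm ((mem_sobolevAs_half_iff hm hμ' ξ).1 h'.2.1).2
  rw [h'.form_eq hm hμ hμ' α]
  refine le_trans ?_ (h'.le_formValue hm hμ')
  linarith [integral_norm_hat_sq_mul_symbol_nonneg hm hμ' w',
    mul_nonneg (show (0 : ℝ) ≤ n + 2 by positivity) hcharge]

theorem form_nonneg (hΛ : Lam m < 1) (hα : 0 ≤ α) {u : L2 (n + 2)}
    (hu : u ∈ formDomain m μ n) : 0 ≤ form m μ α u := by
  have hδ := one_sub_toReal_Lam_pos hΛ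
  have hlim : Tendsto (fun μ' : ℝ => -μ' * ‖u‖ ^ 2) (𝓝[>] 0) (𝓝 0) := by
    have hcont : Continuous fun μ' : ℝ => -μ' * ‖u‖ ^ 2 := by fun_prop
    simpa using (hcont.tendsto 0).mono_left nhdsWithin_le_nhds
  refine le_of_tendsto hlim (eventually_mem_nhdsWithin.mono fun μ' hμ' => ?_)
  exact neg_mul_norm_sq_le_form hm hμ hμ' hΛ (by positivity) hu

theorem neg_sq_mul_norm_sq_le_form (hΛ : Lam m < 1) (hα : α < 0) {u : L2 (n + 2)}
    (hu : u ∈ formDomain m μ n) :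
    -(α / (2 * Real.pi ^ 2 * (1 - (Lam m).toReal))) ^ 2 * ‖u‖ ^ 2 ≤ form m μ α u := by
  have hδ := one_sub_toReal_Lam_pos hΛ
  have hdenom : 0 < 2 * Real.pi ^ 2 * (1 - (Lam m).toReal) := by positivity
  have hneg := div_neg_of_neg_of_pos hα hdenom
  refine neg_mul_norm_sq_le_form hm hμ (sq_pos_of_neg hneg) hΛ ?_ hu
  rw [Real.sqrt_sq_eq_abs, abs_of_neg hneg, mul_neg, mul_div_cancel₀ _ hdenom.ne', add_neg_cancel]

end LowerBound

section Closedness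

variable {m μ α : ℝ} {n : ℕ}

theorem IsDecomp.integral_add_mul_Tdiag_le_formValue_add (hm : 0 < m) (hμ : 0 < μ)
    (hα : |α| ≤ Real.pi ^ 2 * (1 - (Lam m).toReal) * Real.sqrt μ) {u w : L2 (n + 2)}
    {ξ : L2 (n + 1)} (h : IsDecomp m μ u w ξ) :
    (∫ q, ‖hat w q‖ ^ 2 * symbol m μ q) +
        ((n : ℝ) + 2) * ((1 - (Lam m).toReal) / 2) * Tdiag m μ ξ ≤
      formValue m μ α u w ξ + μ * ‖u‖ ^ 2 := by
  have hd := ((mem_sobolevAs_half_iff hm hμ ξ).1 h.2.1).2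
  have hδ : 0 ≤ 1 - (Lam m).toReal := by
    have hprod := (abs_nonneg α).trans hα
    rw [mul_right_comm] at hprod
    exact nonneg_of_mul_nonneg_right hprod (by positivity)
  have hcharge : -α * ‖ξ‖ ^ 2 ≤ (1 - (Lam m).toReal) / 2 * Tdiag m μ ξ :=
    calc -α * ‖ξ‖ ^ 2 ≤ Real.pi ^ 2 * (1 - (Lam m).toReal) * Real.sqrt μ * ‖ξ‖ ^ 2 := by
          gcongr
          exact (neg_le_abs α).trans hα
      _ = (1 - (Lam m).toReal) / 2 * (2 * Real.pi ^ 2 * Real.sqrt μ * ‖ξ‖ ^ 2) := by ring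
      _ ≤ (1 - (Lam m).toReal) / 2 * Tdiag m μ ξ := by
        gcongr
        exact sqrt_mul_norm_sq_le_Tdiag hm hd
  have hscaled := mul_le_mul_of_nonneg_left hcharge (show (0 : ℝ) ≤ n + 2 by positivity)
  linarith [h.le_formValue (α := α) hm hμ]

theorem exists_pos_abs_le_mul_sqrt (α : ℝ) {c : ℝ} (hc : 0 < c) :
    ∃ ν : ℝ, 0 < ν ∧ |α| ≤ c * Real.sqrt ν := by
  refine ⟨(|α| / c + 1) ^ 2, by positivity, ?_⟩
  rw [Real.sqrt_sq (by positivity), mul_add, mul_div_cancel₀ _ hc.ne']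
  linarith

theorem IsDecomp.of_tendsto {u w : ℕ → L2 (n + 2)} {ξ : ℕ → L2 (n + 1)} {v x : L2 (n + 2)}
    {ζ : L2 (n + 1)} (h : ∀ i, IsDecomp m μ (u i) (w i) (ξ i)) (hu : Tendsto u atTop (𝓝 v))
    (hw : Tendsto w atTop (𝓝 x)) (hξ : Tendsto ξ atTop (𝓝 ζ))
    (hx : x ∈ sobolevAs 1 (n + 2)) (hζ : ζ ∈ sobolevAs (1 / 2) (n + 1)) :
    IsDecomp m μ v x ζ := by
  refine ⟨hx, hζ, ?_⟩
  obtain ⟨a, ha, hsub⟩ := exists_subseq_tendsto_hat (hu.sub hw)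
  obtain ⟨b, hb, hcharge⟩ := exists_subseq_tendsto_hat (hξ.comp ha.tendsto_atTop)
  have hpot : ∀ᵐ q, ∀ i, hat (u i - w i) q = potentialHat m μ (ξ i) q :=
    ae_all_iff.2 fun i => (h i).2.2
  have hterm : ∀ᵐ q : Fin (n + 2) → R3, ∀ j : Fin (n + 2),
      Tendsto (fun i => hat (ξ (a (b i))) (j.removeNth q)) atTop (𝓝 (hat ζ (j.removeNth q))) :=
    ae_all_iff.2 fun j => (quasiMeasurePreserving_removeNth j).ae hcharge
  filter_upwards [hsub, hpot, hterm] with q hsub hpot hterm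
  have hlim : Tendsto (fun i => potentialHat m μ (ξ (a (b i))) q) atTop
      (𝓝 (potentialHat m μ ζ q)) :=
    tendsto_const_nhds.mul (tendsto_finsetSum _ fun j _ => tendsto_const_nhds.mul (hterm j))
  exact tendsto_nhds_unique (hsub.comp hb.tendsto_atTop) (hlim.congr fun i => (hpot _).symm)

theorem tendsto_Toff (hm : 0 < m) (hμ : 0 < μ) {ξ : ℕ → L2 (n + 1)}
    (hξ : ∀ i, ξ i ∈ sobolevAs (1 / 2) (n + 1))
    (hT : Tendsto (fun i => Tdiag m μ (ξ i)) atTop (𝓝 0)) :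
    Tendsto (fun i => Toff m μ (ξ i)) atTop (𝓝 0) := by
  refine squeeze_zero_norm (fun i => ?_)
    (by simpa only [mul_zero] using hT.const_mul (ENNReal.ofReal (2 * Real.pi ^ 2)⁻¹ *
      schurBound m (fun s t K Q => |resolventKernel m s t K Q|)).toReal)
  obtain ⟨has, hd⟩ := (mem_sobolevAs_half_iff hm hμ _).1 (hξ i)
  exact abs_Toff_le hm hμ has hd

theorem tendsto_formValue (hm : 0 < m) (hμ : 0 < μ) (α : ℝ) {u w : ℕ → L2 (n + 2)}
    {ξ : ℕ → L2 (n + 1)} (hξmem : ∀ i, ξ i ∈ sobolevAs (1 / 2) (n + 1))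
    (hu : Tendsto u atTop (𝓝 0)) (hξ : Tendsto ξ atTop (𝓝 0))
    (hw : Tendsto (fun i => ∫ q, ‖hat (w i) q‖ ^ 2 * symbol m μ q) atTop (𝓝 0))
    (hT : Tendsto (fun i => Tdiag m μ (ξ i)) atTop (𝓝 0)) :
    Tendsto (fun i => formValue m μ α (u i) (w i) (ξ i)) atTop (𝓝 0) := by
  have hlim := (hw.sub ((hu.norm.pow 2).const_mul μ)).add
    (((((hξ.norm.pow 2).const_mul α).add hT).add (tendsto_Toff hm hμ hξmem hT)).const_mul
      ((n : ℝ) + 2))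
  simpa [formValue] using hlim

theorem exists_isDecomp_tendsto_formValue (hm : 0 < m) (hμ : 0 < μ) (hΛ : Lam m < 1)
    (hα : |α| ≤ Real.pi ^ 2 * (1 - (Lam m).toReal) * Real.sqrt μ) {u w : ℕ → L2 (n + 2)}
    {ξ : ℕ → L2 (n + 1)} {v : L2 (n + 2)} (hd : ∀ i, IsDecomp m μ (u i) (w i) (ξ i))
    (hu : Tendsto u atTop (𝓝 v))
    (hF : Tendsto (fun p : ℕ × ℕ =>
      formValue m μ α (u p.1 - u p.2) (w p.1 - w p.2) (ξ p.1 - ξ p.2)) atTop (𝓝 0)) :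
    ∃ x ζ, IsDecomp m μ v x ζ ∧
      Tendsto (fun i => formValue m μ α (u i - v) (w i - x) (ξ i - ζ)) atTop (𝓝 0) := by
  have hδ := one_sub_toReal_Lam_pos hΛ
  set c := ((n : ℝ) + 2) * ((1 - (Lam m).toReal) / 2)
  have hc0 : 0 < c := by positivity
  have hupper : Tendsto (fun p : ℕ × ℕ =>
      formValue m μ α (u p.1 - u p.2) (w p.1 - w p.2) (ξ p.1 - ξ p.2) +
        μ * ‖u p.1 - u p.2‖ ^ 2) atTop (𝓝 0) := by
    have hdist := cauchySeq_iff_tendsto_dist_atTop_0.1 hu.cauchySeq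
    simp only [dist_eq_norm] at hdist
    simpa using hF.add ((hdist.pow 2).const_mul μ)
  have hcoercive := fun p : ℕ × ℕ =>
    ((hd p.1).sub (hd p.2)).integral_add_mul_Tdiag_le_formValue_add hm hμ hα
  have hdiag := fun p : ℕ × ℕ => mul_nonneg hc0.le (Tdiag_nonneg hm hμ (ξ p.1 - ξ p.2))
  have hkin := fun p : ℕ × ℕ => integral_norm_hat_sq_mul_symbol_nonneg hm hμ (w p.1 - w p.2)
  obtain ⟨x, hx, hwx, hx0⟩ := exists_mem_sobolevAs_one_tendsto hm hμ (fun i => (hd i).1)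
    (squeeze_zero hkin (fun p => (le_add_of_nonneg_right (hdiag p)).trans (hcoercive p)) hupper)
  obtain ⟨ζ, hζ, hξζ, hζ0⟩ := exists_mem_sobolevAs_half_tendsto hm hμ (fun i => (hd i).2.1) (by
    have hcT := squeeze_zero hdiag
      (fun p => (le_add_of_nonneg_left (hkin p)).trans (hcoercive p)) hupper
    simpa [hc0.ne'] using hcT.const_mul c⁻¹)
  refine ⟨x, ζ, .of_tendsto hd hu hwx hξζ hx hζ, tendsto_formValue hm hμ α
    (fun i => sub_mem_sobolevAs (hd i).2.1 hζ) ?_ ?_ hx0 hζ0⟩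
  · exact tendsto_sub_nhds_zero_iff.2 hu
  · exact tendsto_sub_nhds_zero_iff.2 hξζ

theorem isClosedForm_form (hm : 0 < m) (hμ : 0 < μ) (α : ℝ) (hΛ : Lam m < 1) (n : ℕ) :
    IsClosedForm (formDomain m μ n) (form m μ α) := by
  intro u hu hcauchy hF
  have hδ := one_sub_toReal_Lam_pos hΛ
  obtain ⟨ν, hν, hα⟩ :=
    exists_pos_abs_le_mul_sqrt α (show 0 < Real.pi ^ 2 * (1 - (Lam m).toReal) by positivity)
  have hdecomp : ∀ i, ∃ w ξ, IsDecomp m ν (u i) w ξ := fun i => by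
    obtain ⟨-, w, ξ, h⟩ := hu i
    obtain ⟨w', h'⟩ := h.exists_isDecomp hm hμ hν
    exact ⟨w', ξ, h'⟩
  choose w ξ hd using hdecomp
  obtain ⟨v, hv⟩ := cauchySeq_tendsto_of_complete hcauchy
  obtain ⟨x, ζ, hvd, hlim⟩ := exists_isDecomp_tendsto_formValue hm hν hΛ hα hd hv
    (hF.congr fun p => ((hd p.1).sub (hd p.2)).form_eq hm hμ hν α)
  obtain ⟨x', hx'⟩ := hvd.exists_isDecomp hm hν hμ
  have hvas : IsAntisymm v :=
    (isClosed_isAntisymm _).mem_of_tendsto hv (.of_forall fun i => (hu i).1)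
  exact ⟨v, ⟨hvas, x', ζ, hx'⟩, hv,
    hlim.congr fun i => (((hd i).sub hvd).form_eq hm hμ hν α).symm⟩

end Closedness

end PointInteraction

end

theorem theorem1 (m : ℝ) (hm : 0 < m) :
    Lam m < ⊤ ∧
    (∀ (n : ℕ) (μ : ℝ), 0 < μ → ∀ ξ ∈ sobolevAs (1 / 2) (n + 1),
      Integrable (diagIntegrand m μ ξ) ∧ Integrable (offIntegrand m μ ξ) ∧
      -(Lam m).toReal * Tdiag m μ ξ ≤ Toff m μ ξ) ∧
    (Lam m < 1 → ∀ (n : ℕ) (μ : ℝ), 0 < μ → ∀ α : ℝ,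
      IsClosedForm (formDomain m μ n) (form m μ α) ∧
      ∀ u ∈ formDomain m μ n,
        (0 ≤ α → 0 ≤ form m μ α u) ∧
        (α < 0 →
          -(α / (2 * Real.pi ^ 2 * (1 - (Lam m).toReal))) ^ 2 * ‖u‖ ^ 2 ≤ form m μ α u)) := by
  refine ⟨Lam_lt_top hm, fun n μ hμ ξ hξ => ?_, fun hΛ n μ hμ α => ?_⟩
  · obtain ⟨hξas, hd⟩ := (mem_sobolevAs_half_iff hm hμ ξ).1 hξ
    exact ⟨hd, integrable_offIntegrand hm hμ hξas hd, neg_Lam_mul_Tdiag_le_Toff hm hμ hξas hd⟩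
  · exact ⟨isClosedForm_form hm hμ α hΛ n, fun u hu =>
      ⟨fun hα => form_nonneg hm hμ hΛ hα hu, fun hα => neg_sq_mul_norm_sq_le_form hm hμ hΛ hα hu⟩⟩
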